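/- Let $\delta_-,\delta_+\in[0,1/2)$, $\mu\ge 1$ and $\kappa>0$. For $\nu\in(0,1]$ let $\mathcal L(\mu,\nu)$ be the set of functions $\phi:[-\pi,\pi]\to\mathbb R_+$ with $\phi(\omega)\le\mu\,\phi(0)$ for all $\omega\in[-\pi,\pi]$ and, for all $\omega,\omega'\in[-\pi,\pi]\setminus\{0\}$, $$|\phi(\omega)-\phi(\omega')|\le\mu\,\phi(0)\,\frac{|\omega-\omega'|}{|\omega|\wedge|\omega'|},\qquad |\phi(\omega)-\phi(\omega')|\le\mu\,\phi(0)\,\big||\omega|-|\omega'|\big|^{\nu}.$$ Then there are an integer $K\ge1$ and a constant $C>0$, depending only on $\delta_-,\delta_+,\mu,\kappa$, such that the following holds. Let $\nu\in(0,1]$, $d\in[-\delta_-,\delta_+]$, and let $f_\star\in\mathcal L(\mu,\nu)$ be continuous at $0$ with $0<f_\star(0)<\infty$ and $\int_{-\pi}^{\pi} f_\star<\infty$. Let $(X_t)_{t\in\mathbb Z}$ be a real covariance stationary Gaussian process with spectral density $f(\omega)=|\omega|^{-2d}f_\star(\omega)$, i.e. $\mathrm{Cov}(X_s,X_t)=\int_{-\pi}^{\pi}e^{i(s-t)\omega}f(\omega)\,d\omega$.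 For integers $g\ge1$ and $n$, put $\omega_k=2\pi k/n$, $$\bar I_{g,n}(\omega_k)=\frac1g\sum_{\ell=0}^{g-1}\frac1{2\pi n}\Big|\sum_{t=1}^nX_{t+\ell n}e^{it\omega_k}\Big|^2,\qquad \xi_{n,k}=\log\bar I_{g,n}(\omega_k)-\log f(\omega_k)-\psi(g)+\log g,$$ where $\psi=\Gamma'/\Gamma$ is the digamma function. Then: 1. for every integer $j$ with $K\le j\le\lfloor(n-1)/2\rfloor$ and $f_\star(\omega_j)\ge\kappa f_\star(0)$, the variable $\xi_{n,j}$ is square integrable and $$|\mathbb E\,\xi_{n,j}|\le C\,\frac{\log(1+j)}{j},\qquad |\mathrm{Var}(\xi_{n,j})-\psi'(g)|\le C\,\frac{\log^2(1+j)}{j^2};$$ 2. for all integers $K\le j<k\le\lfloor(n-1)/2\rfloor$ with $f_\star(\omega_j)\ge\kappa f_\star(0)$ and $f_\star(\omega_k)\ge\kappa f_\star(0)$, $$|\mathrm{Cov}(\xi_{n,j},\xi_{n,k})|\le C\,\log^2(k)\,j^{-2|d|}\,k^{2|d|-2}.$$ -/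

import Mathlib

open MeasureTheory ProbabilityTheory

noncomputable section

namespace AvgPeriodogram

/-- The real-valued process `X` is covariance stationary with spectral density `f` on `[-π, π]`. -/
structure HasSpectralDensity {Ω : Type*} [MeasurableSpace Ω] (P : Measure Ω)
    (X : ℤ → Ω → ℝ) (f : ℝ → ℝ) : Prop where
  memLp : ∀ t, MemLp (X t) 2 P
  mean_eq : ∀ s t, ∫ a, X s a ∂P = ∫ a, X t a ∂P
  nonneg : ∀ x ∈ Set.Icc (-Real.pi) Real.pi, 0 ≤ f x
  integrableOn : IntegrableOn f (Set.Icc (-Real.pi) Real.pi)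
  cov_eq : ∀ s t : ℤ, ((cov[X s, X t; P] : ℝ) : ℂ) =
    ∫ x in (-Real.pi)..Real.pi,
      Complex.exp (Complex.I * (((s - t : ℤ) : ℝ) * x : ℝ)) * (f x : ℂ)

/-- The spectral density `|x|^(-2d) f⋆(x)` (its value at the single point `0` is immaterial). -/
def spectralDensity (d : ℝ) (fstar : ℝ → ℝ) (x : ℝ) : ℝ :=
  |x| ^ (-2 * d) * fstar x

/-- Standing assumptions on the short-memory part `f⋆` of the spectral density. -/
structure IsShortMemoryPart (fstar : ℝ → ℝ) : Prop where
  continuousAt_zero : ContinuousWithinAt fstar (Set.Icc (-Real.pi) Real.pi) 0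
  pos_zero : 0 < fstar 0
  integrableOn : IntegrableOn fstar (Set.Icc (-Real.pi) Real.pi)

/-- The class `L(μ, ν)` of functions `φ : [-π, π] → ℝ₊`. Only the values of `φ` on `[-π, π]`
matter. -/
structure MemLipschitzClass (μ ν : ℝ) (φ : ℝ → ℝ) : Prop where
  nonneg : ∀ x ∈ Set.Icc (-Real.pi) Real.pi, 0 ≤ φ x
  le_mul_zero : ∀ x ∈ Set.Icc (-Real.pi) Real.pi, φ x ≤ μ * φ 0
  lipschitz : ∀ x ∈ Set.Icc (-Real.pi) Real.pi, ∀ y ∈ Set.Icc (-Real.pi) Real.pi,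
    x ≠ 0 → y ≠ 0 → |φ x - φ y| ≤ μ * φ 0 * (|x - y| / min |x| |y|)
  hoelder : ∀ x ∈ Set.Icc (-Real.pi) Real.pi, ∀ y ∈ Set.Icc (-Real.pi) Real.pi,
    x ≠ 0 → y ≠ 0 → |φ x - φ y| ≤ μ * φ 0 * |(|x| - |y|)| ^ ν

/-- The Fourier frequency `2πk/n`. -/
def fourierFreq (n k : ℕ) : ℝ := 2 * Real.pi * k / n

variable {Ω : Type*}

/-- The discrete Fourier transform of the `ℓ`-th epoch, `ℓ = 0, 1, …`, at frequency `x`. -/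
def dft (X : ℤ → Ω → ℝ) (n ℓ : ℕ) (x : ℝ) (a : Ω) : ℂ :=
  ((Real.sqrt (2 * Real.pi * n))⁻¹ : ℝ) *
    ∑ t ∈ Finset.Icc 1 n, (X ((t + ℓ * n : ℕ) : ℤ) a : ℂ) * Complex.exp (Complex.I * (t * x : ℝ))

/-- The periodogram of the `ℓ`-th epoch. -/
def periodogram (X : ℤ → Ω → ℝ) (n ℓ : ℕ) (x : ℝ) (a : Ω) : ℝ :=
  ‖dft X n ℓ x a‖ ^ 2

/-- The periodogram averaged over the epochs `0, …, g - 1`. -/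
def averagedPeriodogram (X : ℤ → Ω → ℝ) (g n : ℕ) (x : ℝ) (a : Ω) : ℝ :=
  (g : ℝ)⁻¹ * ∑ ℓ ∈ Finset.range g, periodogram X n ℓ x a

/-- The digamma function `ψ = Γ' / Γ` on the real line. -/
def digamma : ℝ → ℝ := logDeriv Real.Gamma

/-- The centered log averaged periodogram at the `k`-th Fourier frequency, for spectral
density `f`. -/
def xi (X : ℤ → Ω → ℝ) (f : ℝ → ℝ) (g n k : ℕ) (a : Ω) : ℝ :=
  Real.log (averagedPeriodogram X g n (fourierFreq n k) a)
    - Real.log (f (fourierFreq n k)) - digamma g + Real.log g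

end AvgPeriodogram

end

/-! At `ω_j` collect the real and imaginary parts of the `g` epoch transforms, scaled by `√(2 /
f(ω_j))`, into a Gaussian vector `U_j` in dimension `2g`. Almost surely `ξ_j = log |U_j|² - ψ(g) -
log 2`. If `U_j` were standard, `|U_j|²` would be Gamma with shape `g` and rate `1/2`, and its
logarithm would have mean `ψ(g) + log 2` and variance `ψ'(g)`. Everything thus rests on how far the
covariance of `(U_j, U_k)` is from the identity, as a quadratic form and uniformly in `g`.

Spectral side. The covariance of two linear forms is an integral of `f` against a product of
trigonometric polynomials. Replacing `f` by the constant `f(ω_k)` gives exactly the white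
covariance, because Fourier frequencies are orthogonal. The error involves `|f - f(ω_k)|`, two
Dirichlet kernels, and polynomials in the epoch index. The latter are `2π/n`-periodic, so on every
cell of that length their energy is a fixed multiple of `|v|²`; bounding the other factors cell by
cell gives a rate `A log k · j^(-|d|) k^(|d|-1)` free of `g` and `n` (`sum_kernelBound_le`,
`integral_epochEnergy`, `abs_covariance_sum_scaledDft_sub_le`).

Probabilistic side. If the covariance of `U` is within `ε` of the identity, the mean of `log |U|²`
moves by `O(ε)`. Its variance moves only by `O(ε²)`, because for a standard vector the logarithm of
the radius is uncorrelated with the normalised squared coordinates (`log_norm_sq_moments`,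
`covariance_log_sum_sq_sqRatio`). If two nearly white vectors have cross-covariance at most `ρ`,
their logarithms have covariance `O(ρ²)`. Indeed, regressing one on the other shows that
conditioning only shifts the centre of a Gaussian vector, and a shift `c` moves the mean log squared
norm by at most `|c|² / g`, which is quadratic (`abs_integral_log_shift_sub_le`,
`abs_covariance_log_norm_sq_le`). -/

namespace AvgPeriodogram

/-- The law of a family of independent standard Gaussian variables. -/
noncomputable abbrev stdPi (ι : Type*) [Fintype ι] : Measure (ι → ℝ) :=
  Measure.pi fun _ : ι => gaussianReal 0 1

/-! ### Chi-square and log-Gamma laws, digamma and trigamma. -/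

section ChiSquare

/-- Valid for every `t`: when `t ≥ 1/2` the integral diverges and has default value `0`, as does the
square root of `1 / 0` or of a negative number. -/
lemma mgf_sq_gaussianReal (t : ℝ) :
    mgf (fun x => x ^ 2) (gaussianReal 0 1) t = √(1 / (1 - 2 * t)) := by
  rw [mgf, integral_gaussianReal_eq_integral_smul one_ne_zero]
  have h : ∀ x : ℝ, gaussianPDFReal 0 1 x • Real.exp (t * x ^ 2)
      = (√(2 * Real.pi))⁻¹ * Real.exp (-(1 / 2 - t) * x ^ 2) := by
    intro x
    simp only [gaussianPDFReal, NNReal.coe_one, mul_one, smul_eq_mul, mul_assoc, sub_zero]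
    rw [← Real.exp_add]
    congr 2
    ring
  simp_rw [h]
  rw [integral_const_mul, integral_gaussian, ← Real.sqrt_inv, ← Real.sqrt_mul (by positivity)]
  congr 1
  rcases eq_or_ne (1 - 2 * t) 0 with h0 | h0
  · have : (1 / 2 - t) = 0 := by linarith
    rw [h0, this]; simp
  · have : (1 / 2 - t) ≠ 0 := fun h' => h0 (by linarith)
    field_simp

lemma measurable_gammaPDF (a r : ℝ) : Measurable (gammaPDF a r) :=
  (measurable_gammaPDFReal a r).ennreal_ofReal

/-- For `t ≥ r` the integrand dominates a multiple of `x ^ (a - 1)`, which is not integrable on the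
half-line, so the integral takes its default value `0`. -/
lemma mgf_gammaMeasure {a r : ℝ} (ha : 0 < a) (hr : 0 < r) (t : ℝ) :
    mgf id (gammaMeasure a r) t = if t < r then (r / (r - t)) ^ a else 0 := by
  have h1 : mgf id (gammaMeasure a r) t
      = ∫ x in Set.Ioi (0 : ℝ), r ^ a / Real.Gamma a * (x ^ (a - 1) * Real.exp (-((r - t) * x))) := by
    rw [mgf, gammaMeasure, integral_withDensity_eq_integral_toReal_smul
      (measurable_gammaPDF a r) (by simp [gammaPDF]),
      ← integral_indicator measurableSet_Ioi]
    apply integral_congr_ae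
    have h0 : ∀ᵐ x : ℝ, x ≠ 0 := by simp [ae_iff, measure_singleton]
    filter_upwards [h0] with x hx
    simp only [gammaPDF, ENNReal.toReal_ofReal (gammaPDFReal_nonneg ha hr x), id, smul_eq_mul]
    rcases lt_or_gt_of_ne hx with hx | hx
    · simp [gammaPDFReal, not_le.2 hx, not_lt.2 hx.le]
    · simp only [gammaPDFReal, hx.le, if_true, Set.indicator, Set.mem_Ioi, hx, mul_assoc]
      rw [← Real.exp_add]
      congr 4
      ring
  rw [h1, integral_const_mul]
  split_ifs with h
  · have hrt : 0 < r - t := by linarith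
    rw [Real.integral_rpow_mul_exp_neg_mul_Ioi ha hrt, Real.div_rpow hr.le hrt.le,
      Real.div_rpow zero_le_one hrt.le, Real.one_rpow]
    have := (Real.Gamma_pos_of_pos ha).ne'
    field_simp
  · rw [integral_undef, mul_zero]
    intro hint
    refine not_integrableOn_Ioi_rpow (a - 1) (hint.mono' ?_ ?_)
    · exact (measurable_id.pow_const _).aestronglyMeasurable
    · filter_upwards [ae_restrict_mem measurableSet_Ioi] with x hx
      have hx : 0 < x := hx
      rw [Real.norm_of_nonneg (by positivity)]
      have : 1 ≤ Real.exp (-((r - t) * x)) := Real.one_le_exp (by nlinarith)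
      exact le_mul_of_one_le_right (by positivity) this

lemma integrableExpSet_gammaMeasure {a r : ℝ} (ha : 0 < a) (hr : 0 < r) :
    Set.Iio r ⊆ integrableExpSet id (gammaMeasure a r) := by
  intro t ht
  have ht : t < r := ht
  have : mgf id (gammaMeasure a r) t ≠ 0 := by
    rw [mgf_gammaMeasure ha hr, if_pos ht]
    have : 0 < r - t := by linarith
    positivity
  by_contra hcon
  exact this (integral_undef hcon)

/-- The two moment generating functions agree on all of `ℝ`, including the range where both diverge
and are `0`. Hence the complex ones agree on a strip containing the imaginary axis, and so do the
characteristic functions. -/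
lemma map_sum_sq_stdPi {ι : Type*} [Fintype ι] {g : ℕ} (hg : 1 ≤ g) (hι : Fintype.card ι = 2 * g) :
    (stdPi ι).map (fun z => ∑ i, z i ^ 2) = gammaMeasure g (1 / 2) := by
  have hg0 : (0 : ℝ) < g := by exact_mod_cast hg
  have := isProbabilityMeasure_gammaMeasure hg0 (r := 1 / 2) (by norm_num)
  have hind : iIndepFun (fun (i : ι) (z : ι → ℝ) => z i ^ 2) (stdPi ι) :=
    iIndepFun_pi (X := fun _ x => x ^ 2) (fun _ => by fun_prop)
  have hmgf : mgf (∑ i, fun z : ι → ℝ => z i ^ 2) (stdPi ι) = mgf id (gammaMeasure g (1 / 2)) := by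
    ext t
    rw [hind.mgf_sum (fun i => by fun_prop), mgf_gammaMeasure hg0 (by norm_num)]
    have h1 : ∀ i : ι, mgf (fun z : ι → ℝ => z i ^ 2) (stdPi ι) t = √(1 / (1 - 2 * t)) := by
      intro i
      rw [← mgf_sq_gaussianReal, mgf, mgf]
      exact integral_comp_eval (μ := fun _ : ι => gaussianReal 0 1)
        (f := fun x => Real.exp (t * x ^ 2)) (by fun_prop)
    simp only [h1, Finset.prod_const, Finset.card_univ, hι, pow_mul]
    split_ifs with h
    · rw [Real.sq_sqrt (by apply div_nonneg <;> linarith), Real.rpow_natCast]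
      have : 1 - 2 * t ≠ 0 := by linarith
      have : 1 / 2 - t ≠ 0 := by linarith
      congr 1
      field_simp
    · rw [Real.sqrt_eq_zero_of_nonpos, zero_pow two_ne_zero, zero_pow (by omega)]
      exact div_nonpos_of_nonneg_of_nonpos zero_le_one (by linarith)
  have heq := eqOn_complexMGF_of_mgf hmgf
  have hset := integrableExpSet_eq_of_mgf hmgf
  have hm : AEMeasurable (∑ i, fun z : ι → ℝ => z i ^ 2) (stdPi ι) := by fun_prop
  have : (fun z : ι → ℝ => ∑ i, z i ^ 2) = ∑ i, fun z : ι → ℝ => z i ^ 2 := by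
    ext z; simp
  rw [this]
  have : IsFiniteMeasure ((stdPi ι).map (∑ i, fun z : ι → ℝ => z i ^ 2)) := inferInstance
  refine Measure.ext_of_charFun ?_
  ext t
  rw [← complexMGF_mul_I hm, ← complexMGF_id_mul_I]
  apply heq
  simp only [Set.mem_ofPred_eq, hset]
  apply interior_maximal (integrableExpSet_gammaMeasure hg0 (by norm_num)) isOpen_Iio
  simp

/-- The exponential moments of `log` are power moments of the Gamma law, hence ratios of Gamma
values. The cumulants of `log` are therefore read off from derivatives of `log Γ`. -/
lemma mgf_log_gammaMeasure {a r t : ℝ} (ha : 0 < a) (hr : 0 < r) (ht : 0 < a + t) :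
    mgf Real.log (gammaMeasure a r) t = Real.Gamma (a + t) / Real.Gamma a * (1 / r) ^ t := by
  have h1 : mgf Real.log (gammaMeasure a r) t
      = ∫ x in Set.Ioi (0 : ℝ), r ^ a / Real.Gamma a * (x ^ (a + t - 1) * Real.exp (-(r * x))) := by
    rw [mgf, gammaMeasure, integral_withDensity_eq_integral_toReal_smul
      (measurable_gammaPDF a r) (by simp [gammaPDF]),
      ← integral_indicator measurableSet_Ioi]
    apply integral_congr_ae
    have h0 : ∀ᵐ x : ℝ, x ≠ 0 := by simp [ae_iff, measure_singleton]
    filter_upwards [h0] with x hx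
    simp only [gammaPDF, ENNReal.toReal_ofReal (gammaPDFReal_nonneg ha hr x), smul_eq_mul]
    rcases lt_or_gt_of_ne hx with hx | hx
    · simp [gammaPDFReal, not_le.2 hx, not_lt.2 hx.le]
    · simp only [gammaPDFReal, hx.le, if_true, Set.indicator, Set.mem_Ioi, hx]
      rw [mul_comm t, ← Real.rpow_def_of_pos hx, show a + t - 1 = (a - 1) + t by ring,
        Real.rpow_add hx]
      ring
  rw [h1, integral_const_mul, Real.integral_rpow_mul_exp_neg_mul_Ioi ht hr,
    Real.rpow_add (by positivity), Real.div_rpow zero_le_one hr.le, Real.one_rpow]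
  have := (Real.rpow_pos_of_pos hr a).ne'
  field_simp

lemma zero_mem_interior_integrableExpSet_log_gammaMeasure {a r : ℝ} (ha : 0 < a) (hr : 0 < r) :
    0 ∈ interior (integrableExpSet Real.log (gammaMeasure a r)) := by
  have : Set.Ioi (-a) ⊆ integrableExpSet Real.log (gammaMeasure a r) := by
    intro t ht
    have ht : 0 < a + t := by have : -a < t := ht; linarith
    have h : mgf Real.log (gammaMeasure a r) t ≠ 0 := by
      rw [mgf_log_gammaMeasure ha hr ht]
      have := Real.Gamma_pos_of_pos ht
      have := Real.Gamma_pos_of_pos ha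
      positivity
    by_contra hcon
    exact h (integral_undef hcon)
  exact interior_maximal this isOpen_Ioi (by simpa using ha)

lemma eventually_cgf_log_gammaMeasure {a r : ℝ} (ha : 0 < a) (hr : 0 < r) :
    ∀ᶠ t in nhds (0 : ℝ), cgf Real.log (gammaMeasure a r) t
      = Real.log (Real.Gamma (a + t)) - Real.log (Real.Gamma a) - t * Real.log r := by
  filter_upwards [Ioi_mem_nhds (show -a < 0 by linarith)] with t ht
  have ht : 0 < a + t := by have : -a < t := ht; linarith
  have h1 := (Real.Gamma_pos_of_pos ht)
  have h2 := (Real.Gamma_pos_of_pos ha)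
  rw [cgf, mgf_log_gammaMeasure ha hr ht, Real.log_mul (by positivity) (by positivity),
    Real.log_div h1.ne' h2.ne', Real.log_rpow (by positivity), one_div, Real.log_inv]
  ring

lemma deriv_log_Gamma {x : ℝ} (hx : 0 < x) :
    HasDerivAt (fun y => Real.log (Real.Gamma y)) (digamma x) x := by
  have h := Real.differentiableAt_Gamma (s := x) (fun m => by
    have : (0 : ℝ) ≤ m := Nat.cast_nonneg m
    linarith)
  exact h.hasDerivAt.log (Real.Gamma_pos_of_pos hx).ne'

lemma eventually_deriv_cgf_log_gammaMeasure {a r : ℝ} (ha : 0 < a) (hr : 0 < r) :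
    ∀ᶠ t in nhds (0 : ℝ), deriv (cgf Real.log (gammaMeasure a r)) t
      = digamma (a + t) - Real.log r := by
  filter_upwards [(eventually_cgf_log_gammaMeasure ha hr).eventually_nhds,
    Ioi_mem_nhds (show -a < 0 by linarith)] with t h ht
  have ht : 0 < a + t := by have : -a < t := ht; linarith
  rw [Filter.EventuallyEq.deriv_eq h]
  have h1 : HasDerivAt (fun t => Real.log (Real.Gamma (a + t))) (digamma (a + t)) t :=
    (deriv_log_Gamma ht).comp_const_add a t
  have h2 := (h1.sub_const (Real.log (Real.Gamma a))).fun_sub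
    ((hasDerivAt_id' t).mul_const (Real.log r))
  simpa using h2.deriv

/-- Near `x` the digamma function is, up to translation, the derivative of a cumulant generating
function, which is analytic at `0`. -/
lemma differentiableAt_digamma {x : ℝ} (hx : 0 < x) : DifferentiableAt ℝ digamma x := by
  have h := (analyticAt_cgf
    (zero_mem_interior_integrableExpSet_log_gammaMeasure hx one_pos)).deriv.differentiableAt
  have h1 : DifferentiableAt ℝ (fun t => digamma (x + t) - Real.log 1) 0 :=
    h.congr_of_eventuallyEq ((eventually_deriv_cgf_log_gammaMeasure hx one_pos).mono
      fun _ ht => ht.symm)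
  have h2 : DifferentiableAt ℝ (fun t => digamma (t + x)) 0 := by simpa [add_comm] using h1
  simpa using differentiableAt_comp_add_const.1 h2

lemma integral_log_gammaMeasure {a r : ℝ} (ha : 0 < a) (hr : 0 < r) :
    ∫ x, Real.log x ∂(gammaMeasure a r) = digamma a - Real.log r := by
  have := isProbabilityMeasure_gammaMeasure ha hr
  have h := deriv_cgf_zero (zero_mem_interior_integrableExpSet_log_gammaMeasure ha hr)
  rw [(eventually_deriv_cgf_log_gammaMeasure ha hr).self_of_nhds] at h
  simpa using h.symm

lemma variance_log_gammaMeasure {a r : ℝ} (ha : 0 < a) (hr : 0 < r) :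
    Var[Real.log; gammaMeasure a r] = deriv digamma a := by
  have := isProbabilityMeasure_gammaMeasure ha hr
  have h0 := zero_mem_interior_integrableExpSet_log_gammaMeasure ha hr
  have h := iteratedDeriv_two_cgf_eq_integral h0
  have hd := eventually_deriv_cgf_log_gammaMeasure ha hr
  rw [iteratedDeriv_succ, iteratedDeriv_one, Filter.EventuallyEq.deriv_eq hd, deriv_sub_const,
    deriv_comp_const_add, hd.self_of_nhds] at h
  rw [variance_eq_integral (Real.measurable_log.aemeasurable), integral_log_gammaMeasure ha hr]
  simpa using h.symm

lemma memLp_log_gammaMeasure {a r : ℝ} (ha : 0 < a) (hr : 0 < r) :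
    MemLp Real.log 2 (gammaMeasure a r) :=
  memLp_of_mem_interior_integrableExpSet
    (zero_mem_interior_integrableExpSet_log_gammaMeasure ha hr) 2

variable {ι : Type*} [Fintype ι] {g : ℕ}

lemma measurable_sum_sq : Measurable fun z : ι → ℝ => ∑ i, z i ^ 2 := by fun_prop

lemma memLp_log_sum_sq (hg : 1 ≤ g) (hι : Fintype.card ι = 2 * g) :
    MemLp (fun z => Real.log (∑ i, z i ^ 2)) 2 (stdPi ι) := by
  have h := memLp_log_gammaMeasure (a := g) (r := 1 / 2) (by exact_mod_cast hg) (by norm_num)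
  rw [← map_sum_sq_stdPi hg hι] at h
  exact (memLp_map_measure_iff Real.measurable_log.aestronglyMeasurable measurable_sum_sq.aemeasurable).1 h

lemma integral_log_sum_sq (hg : 1 ≤ g) (hι : Fintype.card ι = 2 * g) :
    ∫ z, Real.log (∑ i, z i ^ 2) ∂(stdPi ι) = digamma g + Real.log 2 := by
  have h := integral_log_gammaMeasure (a := g) (r := 1 / 2) (by exact_mod_cast hg) (by norm_num)
  rw [← map_sum_sq_stdPi hg hι, integral_map measurable_sum_sq.aemeasurable
    Real.measurable_log.aestronglyMeasurable] at h
  rw [h, one_div, Real.log_inv]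
  ring

lemma variance_log_sum_sq (hg : 1 ≤ g) (hι : Fintype.card ι = 2 * g) :
    Var[fun z => Real.log (∑ i, z i ^ 2); stdPi ι] = deriv digamma g := by
  have h := variance_log_gammaMeasure (a := g) (r := 1 / 2) (by exact_mod_cast hg) (by norm_num)
  rw [← map_sum_sq_stdPi hg hι, variance_map Real.measurable_log.aemeasurable
    measurable_sum_sq.aemeasurable] at h
  exact h

lemma digamma_add_one {x : ℝ} (hx : 0 < x) : digamma (x + 1) = digamma x + x⁻¹ := by
  have h1 : HasDerivAt (fun y => Real.log (Real.Gamma (y + 1))) (digamma (x + 1)) x :=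
    (deriv_log_Gamma (by linarith)).comp_add_const x 1
  have h2 := (deriv_log_Gamma hx).add (Real.hasDerivAt_log hx.ne')
  refine h1.unique (h2.congr_of_eventuallyEq ?_)
  filter_upwards [Ioi_mem_nhds hx] with y hy
  have hy : 0 < y := hy
  simp only [Pi.add_apply]
  rw [Real.Gamma_add_one hy.ne', Real.log_mul hy.ne' (Real.Gamma_pos_of_pos hy).ne', add_comm]

lemma deriv_digamma_add_one_le {x : ℝ} (hx : 0 < x) : deriv digamma (x + 1) ≤ deriv digamma x := by
  have h1 : deriv digamma (x + 1) = deriv (fun y => digamma (y + 1)) x :=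
    (deriv_comp_add_const digamma 1 x).symm
  have h2 : (fun y => digamma (y + 1)) =ᶠ[nhds x] fun y => digamma y + y⁻¹ := by
    filter_upwards [Ioi_mem_nhds hx] with y hy using digamma_add_one hy
  rw [h1, h2.deriv_eq, deriv_fun_add (differentiableAt_digamma hx)
    (differentiableAt_inv hx.ne'), deriv_inv]
  have : 0 < (x ^ 2)⁻¹ := by positivity
  linarith

/-- This makes the constants uniform in the number of epochs: `ψ'(g)` is always replaced by `ψ'(1)`.
-/
lemma deriv_digamma_le (hg : 1 ≤ g) : deriv digamma g ≤ deriv digamma 1 := by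
  induction g, hg using Nat.le_induction with
  | base => simp
  | succ n hn ih =>
    push_cast
    exact (deriv_digamma_add_one_le (by exact_mod_cast hn)).trans ih

end ChiSquare

/-! ### Log of a weighted sum of squares with weights near one. -/

section Perturbation

variable {ι : Type*} [Fintype ι] {g : ℕ}

lemma abs_log_one_add_sub_le {x : ℝ} (hx : |x| ≤ 1 / 2) : |Real.log (1 + x) - x| ≤ 2 * x ^ 2 := by
  obtain ⟨h1, h2⟩ := abs_le.1 hx
  have hpos : 0 < 1 + x := by linarith
  have hu := Real.log_le_sub_one_of_pos hpos
  have hl := Real.one_sub_inv_le_log_of_pos hpos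
  have : 1 - (1 + x)⁻¹ - x ≥ - (2 * x ^ 2) := by
    have h3 : 1 - (1 + x)⁻¹ - x = - (x ^ 2 / (1 + x)) := by field_simp; ring
    rw [h3, ge_iff_le, neg_le_neg_iff, div_le_iff₀ hpos]
    nlinarith [sq_nonneg x]
  rw [abs_le]
  constructor <;> nlinarith [sq_nonneg x]

/-- The weighted average of the squared coordinates. -/
noncomputable def sqRatio (a : ι → ℝ) (z : ι → ℝ) : ℝ := (∑ i, a i * z i ^ 2) / ∑ i, z i ^ 2

lemma measurable_sqRatio (a : ι → ℝ) : Measurable (sqRatio a) := by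
  unfold sqRatio; fun_prop

lemma abs_sqRatio_le {a : ι → ℝ} {ε : ℝ} (hε : 0 ≤ ε) (ha : ∀ i, |a i| ≤ ε) (z : ι → ℝ) :
    |sqRatio a z| ≤ ε := by
  have h0 : 0 ≤ ∑ i, z i ^ 2 := Finset.sum_nonneg fun i _ => sq_nonneg _
  rw [sqRatio, abs_div, abs_of_nonneg h0]
  refine div_le_of_le_mul₀ h0 hε ?_
  rw [Finset.mul_sum]
  refine (Finset.abs_sum_le_sum_abs _ _).trans (Finset.sum_le_sum fun i _ => ?_)
  rw [abs_mul, abs_of_nonneg (sq_nonneg (z i))]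
  exact mul_le_mul_of_nonneg_right (ha i) (sq_nonneg _)

/-- At `z = 0` the identity survives through `log 0 = 0` and `0 / 0 = 0`, so no exceptional null set
is needed. -/
lemma log_weighted_sum_sq (a : ι → ℝ) {ε : ℝ} (hε : 0 ≤ ε) (hε' : ε ≤ 1 / 2)
    (ha : ∀ i, |a i - 1| ≤ ε) (z : ι → ℝ) :
    Real.log (∑ i, a i * z i ^ 2)
      = Real.log (∑ i, z i ^ 2) + Real.log (1 + sqRatio (fun i => a i - 1) z) := by
  have h0 : 0 ≤ ∑ i, z i ^ 2 := Finset.sum_nonneg fun i _ => sq_nonneg _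
  rcases h0.eq_or_lt with h | h
  · have hz : ∀ i, z i ^ 2 = 0 := fun i =>
      (Finset.sum_eq_zero_iff_of_nonneg (fun i _ => sq_nonneg (z i))).1 h.symm i (Finset.mem_univ i)
    simp [sqRatio, hz]
  · have hA := abs_le.1 (abs_sqRatio_le hε ha z)
    rw [← Real.log_mul h.ne' (by linarith)]
    congr 1
    rw [sqRatio, mul_add, mul_div_cancel₀ _ h.ne', mul_one, ← Finset.sum_add_distrib]
    exact Finset.sum_congr rfl fun i _ => by ring

lemma ae_sum_sq_ne_zero [Nonempty ι] : ∀ᵐ z ∂(stdPi ι), ∑ i, z i ^ 2 ≠ 0 := by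
  have h : stdPi ι {0} = 0 := by
    have : ({0} : Set (ι → ℝ)) = Set.univ.pi fun _ => {0} := by
      ext; simp [funext_iff]
    rw [this, Measure.pi_pi]
    obtain ⟨i⟩ := ‹Nonempty ι›
    have := nullSingletonClass_gaussianReal (μ := 0) (v := 1) one_ne_zero
    exact Finset.prod_eq_zero (Finset.mem_univ i) (measure_singleton _)
  rw [ae_iff]
  refine measure_mono_null (fun z hz => ?_) h
  have hz : ∑ i, z i ^ 2 = 0 := by simpa using hz
  ext i
  have := (Finset.sum_eq_zero_iff_of_nonneg (fun i _ => sq_nonneg (z i))).1 hz i (Finset.mem_univ i)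
  simpa using this

lemma memLp_two_of_abs_le {Ω : Type*} [MeasurableSpace Ω] {P : Measure Ω} [IsFiniteMeasure P]
    {f : Ω → ℝ} (hf : AEMeasurable f P) {C : ℝ} (h : ∀ x, |f x| ≤ C) : MemLp f 2 P :=
  MemLp.of_bound hf.aestronglyMeasurable C (Filter.Eventually.of_forall h)

lemma covariance_congr_ae {Ω : Type*} [MeasurableSpace Ω] {P : Measure Ω} {X X' Y Y' : Ω → ℝ}
    (hX : X =ᵐ[P] X') (hY : Y =ᵐ[P] Y') : cov[X, Y; P] = cov[X', Y'; P] := by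
  rw [covariance, covariance, integral_congr_ae hX, integral_congr_ae hY]
  apply integral_congr_ae
  filter_upwards [hX, hY] with x h1 h2
  rw [h1, h2]

lemma covariance_eq_integral_sub_mul {Ω : Type*} [MeasurableSpace Ω] {P : Measure Ω}
    [IsProbabilityMeasure P] {X Y : Ω → ℝ} (hX : MemLp X 2 P) (hY : MemLp Y 2 P) :
    cov[X, Y; P] = ∫ x, (X x - ∫ y, X y ∂P) * Y x ∂P := by
  have hXi := hX.integrable one_le_two
  have hXc : MemLp (fun x => X x - ∫ y, X y ∂P) 2 P := hX.sub (memLp_const _)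
  have hm : Integrable (fun x => (X x - ∫ y, X y ∂P) * Y x) P := hXc.integrable_mul hY
  rw [covariance]
  simp_rw [mul_sub]
  rw [integral_sub hm ((hXc.integrable one_le_two).mul_const _),
    integral_mul_const, integral_sub hXi (integrable_const _)]
  simp

/-- Exchanging coordinates preserves the law and the norm, so the covariance of `L` with `z i ^ 2 /
|z|²` is the same for all `i`. These covariances add up to the covariance with the constant `1`, so
each vanishes. This removes the first-order term from the variance expansion. -/
lemma covariance_log_sum_sq_sqRatio (hg : 1 ≤ g) (hι : Fintype.card ι = 2 * g) (a : ι → ℝ) :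
    cov[fun z => Real.log (∑ i, z i ^ 2), sqRatio a; stdPi ι] = 0 := by
  classical
  have hne : Nonempty ι := Fintype.card_pos_iff.1 (by omega)
  set L : (ι → ℝ) → ℝ := fun z => Real.log (∑ i, z i ^ 2) with hL
  have hLp : MemLp L 2 (stdPi ι) := memLp_log_sum_sq hg hι
  set B : ι → (ι → ℝ) → ℝ := fun i => sqRatio (Pi.single i 1) with hB
  have hBapp : ∀ i z, B i z = z i ^ 2 / ∑ i, z i ^ 2 := by
    intro i z
    simp [hB, sqRatio, Pi.single_apply]
  have hBp : ∀ i, MemLp (B i) 2 (stdPi ι) := fun i =>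
    memLp_two_of_abs_le (measurable_sqRatio _).aemeasurable
      (abs_sqRatio_le zero_le_one fun j => by
        by_cases h : j = i
        · subst h; simp
        · simp [h])
  have hsym : ∀ i j, cov[L, B i; stdPi ι] = cov[L, B j; stdPi ι] := by
    intro i j
    set e := MeasurableEquiv.piCongrLeft (fun _ : ι => ℝ) (Equiv.swap i j)
    have hmp : (stdPi ι).map e = stdPi ι :=
      (measurePreserving_piCongrLeft (fun _ : ι => gaussianReal 0 1) (Equiv.swap i j)).map_eq
    have he : ∀ z k, e z k = z (Equiv.swap i j k) := by
      intro z k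
      have := MeasurableEquiv.piCongrLeft_apply_apply (β := fun _ : ι => ℝ) (Equiv.swap i j) z
        (Equiv.swap i j k)
      simpa using this
    have hs : ∀ z, ∑ k, e z k ^ 2 = ∑ k, z k ^ 2 := by
      intro z
      simp_rw [he]
      exact Equiv.sum_comp (Equiv.swap i j) (fun k => z k ^ 2)
    have h := covariance_map_equiv (μ := stdPi ι) L (B i) e
    rw [hmp] at h
    rw [h]
    congr 1
    · ext z; simp only [hL, Function.comp, hs]
    · ext z; rw [Function.comp_apply, hBapp, hBapp, hs, he, Equiv.swap_apply_left]
  have hsum : ∑ i, cov[L, B i; stdPi ι] = 0 := by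
    rw [← covariance_sum_right hBp hLp]
    have : (∑ i, B i) =ᵐ[stdPi ι] fun _ => 1 := by
      filter_upwards [ae_sum_sq_ne_zero] with z hz
      simp only [Finset.sum_apply, hBapp]
      rw [← Finset.sum_div, div_self hz]
    rw [covariance_congr_ae Filter.EventuallyEq.rfl this, covariance_const_right]
  have hzero : ∀ i, cov[L, B i; stdPi ι] = 0 := by
    intro i
    rw [Finset.sum_congr rfl fun j _ => hsym j i, Finset.sum_const, Finset.card_univ,
      nsmul_eq_mul] at hsum
    rcases mul_eq_zero.1 hsum with h | h
    · rw [hι] at h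
      have : 2 * g = 0 := by exact_mod_cast h
      omega
    · exact h
  have hA : sqRatio a = fun z => ∑ i, a i * B i z := by
    ext z
    simp only [hBapp, sqRatio, Finset.sum_div, mul_div_assoc]
  rw [hA, covariance_fun_sum_right (fun i => (hBp i).const_mul _) hLp]
  exact Finset.sum_eq_zero fun i _ => by rw [covariance_const_mul_right, hzero, mul_zero]

variable {a : ι → ℝ} {ε : ℝ}

lemma abs_log_one_add_sqRatio_le (hε : 0 ≤ ε) (hε' : ε ≤ 1 / 2) (ha : ∀ i, |a i - 1| ≤ ε)
    (z : ι → ℝ) : |Real.log (1 + sqRatio (fun i => a i - 1) z)| ≤ 2 * ε := by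
  have hA := abs_sqRatio_le hε ha z
  have h1 := abs_log_one_add_sub_le (hA.trans hε')
  have h2 : sqRatio (fun i => a i - 1) z ^ 2 ≤ ε ^ 2 := sq_le_sq' (abs_le.1 hA).1 (abs_le.1 hA).2
  have h3 := abs_sub_abs_le_abs_sub (Real.log (1 + sqRatio (fun i => a i - 1) z))
    (sqRatio (fun i => a i - 1) z)
  nlinarith

lemma memLp_log_weighted_sum_sq (hg : 1 ≤ g) (hι : Fintype.card ι = 2 * g)
    (hε : 0 ≤ ε) (hε' : ε ≤ 1 / 2) (ha : ∀ i, |a i - 1| ≤ ε) :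
    MemLp (fun z => Real.log (∑ i, a i * z i ^ 2)) 2 (stdPi ι) := by
  have h : (fun z => Real.log (∑ i, a i * z i ^ 2)) = fun z : ι → ℝ => Real.log (∑ i, z i ^ 2)
      + Real.log (1 + sqRatio (fun i => a i - 1) z) := by
    ext z; exact log_weighted_sum_sq a hε hε' ha z
  rw [h]
  exact (memLp_log_sum_sq hg hι).add (memLp_two_of_abs_le
    (Real.measurable_log.comp ((measurable_sqRatio _).const_add 1)).aemeasurable
    (abs_log_one_add_sqRatio_le hε hε' ha))

lemma abs_integral_log_weighted_sum_sq_sub_le (hg : 1 ≤ g) (hι : Fintype.card ι = 2 * g)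
    (hε : 0 ≤ ε) (hε' : ε ≤ 1 / 2) (ha : ∀ i, |a i - 1| ≤ ε) :
    |∫ z, Real.log (∑ i, a i * z i ^ 2) ∂(stdPi ι) - (digamma g + Real.log 2)| ≤ 2 * ε := by
  rw [← integral_log_sum_sq hg hι, ← integral_sub
    ((memLp_log_weighted_sum_sq hg hι hε hε' ha).integrable one_le_two)
    ((memLp_log_sum_sq hg hι).integrable one_le_two)]
  have := norm_integral_le_of_norm_le_const (μ := stdPi ι) (C := 2 * ε)
    (f := fun z => Real.log (∑ i, a i * z i ^ 2) - Real.log (∑ i, z i ^ 2))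
    (Filter.Eventually.of_forall fun z => by
      rw [log_weighted_sum_sq a hε hε' ha z, add_sub_cancel_left]
      exact abs_log_one_add_sqRatio_le hε hε' ha z)
  simpa using this

lemma abs_covariance_le_of_abs_le {Ω : Type*} [MeasurableSpace Ω] {P : Measure Ω}
    [IsProbabilityMeasure P] {X Y : Ω → ℝ} (hX : MemLp X 2 P) (hY : AEMeasurable Y P) {C : ℝ}
    (h : ∀ x, |Y x| ≤ C) : |cov[X, Y; P]| ≤ C * (1 + Var[X; P]) := by
  have hYp := memLp_two_of_abs_le hY h
  have h1 := covariance_eq_integral_sub_mul hX hYp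
  have hC : 0 ≤ C := by
    obtain ⟨x⟩ := P.nonempty_of_neZero
    exact (abs_nonneg _).trans (h x)
  have hsq : Integrable (fun x => (X x - ∫ y, X y ∂P) ^ 2) P :=
    (hX.sub (memLp_const _)).integrable_sq
  rw [h1, variance_eq_integral hX.aemeasurable]
  have hint : Integrable (fun x => C * (1 + (X x - ∫ y, X y ∂P) ^ 2)) P :=
    ((integrable_const 1).add hsq).const_mul C
  calc |∫ x, (X x - ∫ y, X y ∂P) * Y x ∂P|
      ≤ ∫ x, C * (1 + (X x - ∫ y, X y ∂P) ^ 2) ∂P := by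
        rw [← Real.norm_eq_abs]
        refine norm_integral_le_of_norm_le hint (Filter.Eventually.of_forall fun x => ?_)
        rw [Real.norm_eq_abs, abs_mul, mul_comm]
        have h2 : |X x - ∫ y, X y ∂P| ≤ 1 + (X x - ∫ y, X y ∂P) ^ 2 := by
          rw [← sq_abs]
          nlinarith [sq_nonneg (|X x - ∫ y, X y ∂P| - 1), abs_nonneg (X x - ∫ y, X y ∂P)]
        exact mul_le_mul (h x) h2 (abs_nonneg _) hC
    _ = C * (1 + ∫ x, (X x - ∫ y, X y ∂P) ^ 2 ∂P) := by
        rw [integral_const_mul, integral_add (integrable_const _) hsq]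
        simp

/-- Writing the logarithm as `L + D` with `D = log (1 + A)`, the part `A` of `D` is uncorrelated
with `L` and the remainder `D - A` is at most `2ε²`. Twice the covariance and `Var D ≤ 4ε²` together
give `8 + 4ψ'(1)`. -/
lemma abs_variance_log_weighted_sum_sq_sub_le (hg : 1 ≤ g) (hι : Fintype.card ι = 2 * g)
    (hε : 0 ≤ ε) (hε' : ε ≤ 1 / 2) (ha : ∀ i, |a i - 1| ≤ ε) :
    |Var[fun z => Real.log (∑ i, a i * z i ^ 2); stdPi ι] - deriv digamma g|
      ≤ (8 + 4 * deriv digamma 1) * ε ^ 2 := by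
  set L : (ι → ℝ) → ℝ := fun z => Real.log (∑ i, z i ^ 2) with hL
  set A : (ι → ℝ) → ℝ := sqRatio (fun i => a i - 1)
  set D : (ι → ℝ) → ℝ := fun z => Real.log (1 + A z) with hD
  have hLp : MemLp L 2 (stdPi ι) := memLp_log_sum_sq hg hι
  have hAm : Measurable A := measurable_sqRatio _
  have hAb : ∀ z, |A z| ≤ ε := abs_sqRatio_le hε ha
  have hDm : Measurable D := Real.measurable_log.comp (hAm.const_add 1)
  have hDb : ∀ z, |D z| ≤ 2 * ε := abs_log_one_add_sqRatio_le hε hε' ha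
  have hAp := memLp_two_of_abs_le (P := stdPi ι) hAm.aemeasurable hAb
  have hDp := memLp_two_of_abs_le (P := stdPi ι) hDm.aemeasurable hDb
  have hR : ∀ z, |(D - A) z| ≤ 2 * ε ^ 2 := fun z => by
    refine (abs_log_one_add_sub_le ((hAb z).trans hε')).trans ?_
    have : A z ^ 2 ≤ ε ^ 2 := sq_le_sq' (abs_le.1 (hAb z)).1 (abs_le.1 (hAb z)).2
    linarith
  have h : (fun z => Real.log (∑ i, a i * z i ^ 2)) = L + D := by
    ext z; exact log_weighted_sum_sq a hε hε' ha z
  have hcov : |cov[L, D; stdPi ι]| ≤ 2 * ε ^ 2 * (1 + Var[L; stdPi ι]) := by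
    have h1 : D = A + (D - A) := by ext z; simp
    rw [h1, covariance_add_right hLp hAp (hDp.sub hAp), covariance_log_sum_sq_sqRatio hg hι,
      zero_add]
    exact abs_covariance_le_of_abs_le hLp (hDm.sub hAm).aemeasurable hR
  have hVL : Var[L; stdPi ι] = deriv digamma g := variance_log_sum_sq hg hι
  have hVD : Var[D; stdPi ι] ≤ 4 * ε ^ 2 := by
    refine (variance_le_expectation_sq hDm.aestronglyMeasurable).trans ?_
    have := integral_mono (μ := stdPi ι) hDp.integrable_sq (integrable_const (4 * ε ^ 2))
      (fun z => by
        have h2 := sq_le_sq' (abs_le.1 (hDb z)).1 (abs_le.1 (hDb z)).2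
        simp only
        linarith)
    simpa using this
  rw [h, variance_add hLp hDp, hVL]
  rw [hVL] at hcov
  have hV0 : 0 ≤ Var[D; stdPi ι] := variance_nonneg _ _
  have hle := deriv_digamma_le hg
  have : |2 * cov[L, D; stdPi ι]| ≤ 4 * ε ^ 2 * (1 + deriv digamma 1) := by
    rw [abs_mul, abs_two]
    nlinarith [sq_nonneg ε]
  rw [abs_le] at this ⊢
  constructor <;> nlinarith [sq_nonneg ε]

lemma variance_log_weighted_sum_sq_le (hg : 1 ≤ g) (hι : Fintype.card ι = 2 * g)
    (hε : 0 ≤ ε) (hε' : ε ≤ 1 / 2) (ha : ∀ i, |a i - 1| ≤ ε) :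
    Var[fun z => Real.log (∑ i, a i * z i ^ 2); stdPi ι] ≤ 2 + 2 * deriv digamma 1 := by
  have h1 := (abs_le.1 (abs_variance_log_weighted_sum_sq_sub_le hg hι hε hε' ha)).2
  have h2 := deriv_digamma_le hg
  have h3 : ε ^ 2 ≤ 1 / 4 := by nlinarith
  have h4 : 0 ≤ deriv digamma 1 := by
    have := variance_log_sum_sq (ι := Fin 2) (g := 1) le_rfl (by simp)
    rw [Nat.cast_one] at this
    exact this ▸ variance_nonneg _ _
  nlinarith

end Perturbation

/-! ### Frullani's integral for the difference of two logarithms. -/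

section Frullani

lemma integrableOn_inv_mul_exp_sub_exp {a b : ℝ} (ha : 0 < a) (hb : 0 < b) :
    IntegrableOn (fun t => t⁻¹ * (Real.exp (-(t * a)) - Real.exp (-(t * b)))) (Set.Ioi 0) := by
  set m := min a b with hm
  have hm0 : 0 < m := lt_min ha hb
  have hdom : IntegrableOn (fun t => |b - a| * Real.exp (-m * t)) (Set.Ioi 0) :=
    (exp_neg_integrableOn_Ioi 0 hm0).const_mul _
  refine hdom.mono' (Measurable.aestronglyMeasurable (by fun_prop)) ?_
  filter_upwards [ae_restrict_mem measurableSet_Ioi] with t ht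
  have ht : 0 < t := ht
  have key : ∀ x y : ℝ, 0 < x → x ≤ y →
      |Real.exp (-(t * x)) - Real.exp (-(t * y))| ≤ t * (y - x) * Real.exp (-(x * t)) := by
    intro x y _ hxy
    have h1 : Real.exp (-(t * y)) = Real.exp (-(t * x)) * Real.exp (-(t * (y - x))) := by
      rw [← Real.exp_add]; congr 1; ring
    have h2 : Real.exp (-(t * (y - x))) ≤ 1 :=
      Real.exp_le_one_iff.2 (by nlinarith)
    have h3 := Real.add_one_le_exp (-(t * (y - x)))
    have h4 := Real.exp_pos (-(t * x))
    rw [h1, abs_of_nonneg (by nlinarith), mul_comm x t]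
    nlinarith
  rw [norm_mul, Real.norm_eq_abs, Real.norm_eq_abs, abs_of_pos (inv_pos.2 ht),
    inv_mul_le_iff₀ ht, neg_mul]
  rcases le_total a b with h | h
  · rw [hm, min_eq_left h, abs_of_nonneg (by linarith : 0 ≤ b - a), ← mul_assoc]
    exact key a b ha h
  · rw [hm, min_eq_right h, abs_sub_comm b a, abs_of_nonneg (by linarith : 0 ≤ a - b),
      ← mul_assoc, abs_sub_comm]
    exact key b a hb h

lemma integral_inv_mul_exp_sub_exp {a b : ℝ} (ha : 0 < a) (hb : 0 < b) :
    ∫ t in Set.Ioi 0, t⁻¹ * (Real.exp (-(t * a)) - Real.exp (-(t * b)))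
      = Real.log b - Real.log a := by
  have hcont : Continuous fun x : ℝ => Real.exp (-x) := by fun_prop
  have h := Frullani.integral_Ioi_eq (f := fun x : ℝ => Real.exp (-x)) (L := 1) (R := 0) (a := a)
    (b := b) (hcont.locallyIntegrable.locallyIntegrableOn _) ha hb ?_
    Real.tendsto_exp_neg_atTop_nhds_zero ?_
  · rw [Real.log_div hb.ne' ha.ne'] at h
    simpa [mul_comm a, mul_comm b] using h
  · simpa using (hcont.tendsto 0).mono_left nhdsWithin_le_nhds
  · simpa [mul_comm a, mul_comm b] using integrableOn_inv_mul_exp_sub_exp ha hb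

/-- The integrand has constant sign, so its `L¹` norm is the absolute value of its integral. This
reduces Fubini to integrability of the logarithms. -/
lemma integral_norm_inv_mul_exp_sub_exp {a b : ℝ} (ha : 0 < a) (hb : 0 < b) :
    ∫ t in Set.Ioi 0, ‖t⁻¹ * (Real.exp (-(t * a)) - Real.exp (-(t * b)))‖
      = |Real.log b - Real.log a| := by
  have key : ∀ {a b : ℝ}, 0 < a → a ≤ b →
      ∫ t in Set.Ioi 0, ‖t⁻¹ * (Real.exp (-(t * a)) - Real.exp (-(t * b)))‖
        = |Real.log b - Real.log a| := by
    intro a b ha h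
    have hb := ha.trans_le h
    rw [abs_of_nonneg (sub_nonneg.2 (Real.log_le_log ha h)), ← integral_inv_mul_exp_sub_exp ha hb]
    refine setIntegral_congr_fun measurableSet_Ioi fun t ht => ?_
    have ht : 0 < t := ht
    refine Real.norm_of_nonneg (mul_nonneg (inv_pos.2 ht).le (sub_nonneg.2 ?_))
    exact Real.exp_le_exp.2 (by nlinarith)
  rcases le_total a b with h | h
  · exact key ha h
  · rw [abs_sub_comm, ← key hb h]
    simp_rw [norm_mul, norm_sub_rev]

end Frullani

/-! ### Laplace transforms of Gaussian quadratic forms and the effect of a shift. -/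

section Laplace

/-- Completing the square turns the integrand into a translated Gaussian of precision `w = 1 + 2 t
s²`. -/
lemma integral_exp_neg_mul_sq_gaussianReal {t : ℝ} (ht : 0 ≤ t) (c s : ℝ) :
    ∫ x, Real.exp (-(t * (c + s * x) ^ 2)) ∂(gaussianReal 0 1)
      = (√(1 + 2 * t * s ^ 2))⁻¹ * Real.exp (-(t * c ^ 2 / (1 + 2 * t * s ^ 2))) := by
  set w := 1 + 2 * t * s ^ 2 with hw
  have hw0 : 0 < w := by positivity
  rw [integral_gaussianReal_eq_integral_smul one_ne_zero]
  have h : ∀ x : ℝ, gaussianPDFReal 0 1 x • Real.exp (-(t * (c + s * x) ^ 2))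
      = (√(2 * Real.pi))⁻¹ * Real.exp (-(t * c ^ 2 / w))
        * Real.exp (-(w / 2) * (x + 2 * t * c * s / w) ^ 2) := by
    intro x
    simp only [gaussianPDFReal, NNReal.coe_one, mul_one, smul_eq_mul, mul_assoc, sub_zero]
    rw [← Real.exp_add, ← Real.exp_add]
    congr 2
    field_simp
    rw [hw]
    ring
  simp_rw [h]
  rw [integral_const_mul, integral_add_right_eq_self (fun x => Real.exp (-(w / 2) * x ^ 2)),
    integral_gaussian, mul_right_comm]
  congr 1
  rw [← Real.sqrt_inv, ← Real.sqrt_inv, ← Real.sqrt_mul (by positivity)]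
  congr 1
  field_simp

variable {ι : Type*} [Fintype ι] {g : ℕ}

lemma integral_exp_neg_mul_sum_sq {t : ℝ} (ht : 0 ≤ t) (c s : ι → ℝ) :
    ∫ z, Real.exp (-(t * ∑ i, (c i + s i * z i) ^ 2)) ∂(stdPi ι)
      = (∏ i, (√(1 + 2 * t * s i ^ 2))⁻¹)
        * Real.exp (-∑ i, t * c i ^ 2 / (1 + 2 * t * s i ^ 2)) := by
  have h : ∀ z : ι → ℝ, Real.exp (-(t * ∑ i, (c i + s i * z i) ^ 2))
      = ∏ i, Real.exp (-(t * (c i + s i * z i) ^ 2)) := by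
    intro z
    rw [← Real.exp_sum, Finset.mul_sum, Finset.sum_neg_distrib]
  simp_rw [h]
  rw [integral_fintype_prod_eq_prod (fun i x => Real.exp (-(t * (c i + s i * x) ^ 2)))]
  simp_rw [integral_exp_neg_mul_sq_gaussianReal ht]
  rw [Finset.prod_mul_distrib, ← Real.exp_sum, Finset.sum_neg_distrib]

lemma integrableOn_inv_one_add_pow (hg : 1 ≤ g) :
    IntegrableOn (fun t : ℝ => ((1 + t) ^ (g + 1))⁻¹) (Set.Ioi 0) ∧
      ∫ t in Set.Ioi (0 : ℝ), ((1 + t) ^ (g + 1))⁻¹ = 1 / g := by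
  have hg0 : (g : ℝ) ≠ 0 := by positivity
  have hd : ∀ t ∈ Set.Ici (0 : ℝ), HasDerivAt (fun t : ℝ => -(g : ℝ)⁻¹ * ((1 + t) ^ g)⁻¹)
      (((1 + t) ^ (g + 1))⁻¹) t := by
    intro t ht
    have ht : 0 ≤ t := ht
    have h1 : (1 + t) ≠ 0 := by positivity
    have h2 : HasDerivAt (fun t : ℝ => (1 + t) ^ g) (g * (1 + t) ^ (g - 1) * 1) t :=
      ((hasDerivAt_id' t).const_add 1).fun_pow g
    have h3 := (h2.fun_inv (pow_ne_zero g h1)).const_mul (-(g : ℝ)⁻¹)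
    refine h3.congr_deriv ?_
    obtain ⟨m, rfl⟩ := Nat.exists_eq_add_of_le hg
    rw [Nat.add_sub_cancel_left]
    field_simp
    ring
  have hpos : ∀ t ∈ Set.Ioi (0 : ℝ), 0 ≤ ((1 + t) ^ (g + 1))⁻¹ := by
    intro t ht
    have ht : 0 < t := ht
    positivity
  have hlim : Filter.Tendsto (fun t : ℝ => -(g : ℝ)⁻¹ * ((1 + t) ^ g)⁻¹) Filter.atTop (nhds 0) := by
    rw [← mul_zero (-(g : ℝ)⁻¹)]
    refine Filter.Tendsto.const_mul _ (Filter.Tendsto.inv_tendsto_atTop ?_)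
    exact (Filter.tendsto_pow_atTop (by omega)).comp (Filter.tendsto_atTop_add_const_left _ 1
      Filter.tendsto_id)
  refine ⟨integrableOn_Ioi_deriv_of_nonneg' hd hpos hlim, ?_⟩
  rw [integral_Ioi_of_hasDerivAt_of_nonneg' hd hpos hlim]
  simp

lemma ae_sum_shift_sq_pos [Nonempty ι] (c : ι → ℝ) {s : ι → ℝ} (hs : ∀ i, s i ≠ 0) :
    ∀ᵐ z ∂(stdPi ι), 0 < ∑ i, (c i + s i * z i) ^ 2 := by
  have h : stdPi ι {fun i => -c i / s i} = 0 := by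
    have : ({fun i => -c i / s i} : Set (ι → ℝ)) = Set.univ.pi fun i => {-c i / s i} := by
      ext; simp [funext_iff]
    rw [this, Measure.pi_pi]
    obtain ⟨i⟩ := ‹Nonempty ι›
    have := nullSingletonClass_gaussianReal (μ := 0) (v := 1) one_ne_zero
    exact Finset.prod_eq_zero (Finset.mem_univ i) (measure_singleton _)
  have h0 : ∀ z : ι → ℝ, 0 ≤ ∑ i, (c i + s i * z i) ^ 2 :=
    fun z => Finset.sum_nonneg fun i _ => sq_nonneg _
  rw [ae_iff]
  refine measure_mono_null (fun z hz => ?_) h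
  have hz : ∑ i, (c i + s i * z i) ^ 2 = 0 := le_antisymm (by simpa using hz) (h0 z)
  ext i
  have := (Finset.sum_eq_zero_iff_of_nonneg (fun i _ => sq_nonneg (c i + s i * z i))).1 hz i
    (Finset.mem_univ i)
  have := pow_eq_zero_iff two_ne_zero |>.1 this
  have := hs i
  field_simp
  linarith

lemma prod_inv_sqrt_le {t : ℝ} (ht : 0 ≤ t) {s : ι → ℝ} (hι : Fintype.card ι = 2 * g)
    (hs : ∀ i, 1 / 2 ≤ s i ^ 2) :
    ∏ i, (√(1 + 2 * t * s i ^ 2))⁻¹ ≤ ((1 + t) ^ g)⁻¹ := by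
  have h : ∀ i, (√(1 + 2 * t * s i ^ 2))⁻¹ ≤ (√(1 + t))⁻¹ := fun i =>
    inv_anti₀ (Real.sqrt_pos.2 (by positivity)) (Real.sqrt_le_sqrt (by nlinarith [hs i]))
  refine (Finset.prod_le_prod (fun i _ => by positivity) fun i _ => h i).trans ?_
  rw [Finset.prod_const, Finset.card_univ, hι, pow_mul, inv_pow, Real.sq_sqrt (by positivity),
    inv_pow]

/-- Shifting the centre of a nondegenerate Gaussian vector moves the mean of the logarithm of its
squared norm by at most the squared norm of the shift, divided by half of the dimension. -/
lemma abs_integral_log_shift_sub_le (hg : 1 ≤ g) (hι : Fintype.card ι = 2 * g) (c s : ι → ℝ)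
    (hs : ∀ i, 1 / 2 ≤ s i ^ 2)
    (h0 : Integrable (fun z => Real.log (∑ i, (s i * z i) ^ 2)) (stdPi ι))
    (hc : Integrable (fun z => Real.log (∑ i, (c i + s i * z i) ^ 2)) (stdPi ι)) :
    |∫ z, Real.log (∑ i, (c i + s i * z i) ^ 2) ∂(stdPi ι)
      - ∫ z, Real.log (∑ i, (s i * z i) ^ 2) ∂(stdPi ι)| ≤ (∑ i, c i ^ 2) / g := by
  have hne : Nonempty ι := Fintype.card_pos_iff.1 (by omega)
  have hs0 : ∀ i, s i ≠ 0 := fun i h => by have := hs i; rw [h] at this; norm_num at this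
  set S0 : (ι → ℝ) → ℝ := fun z => ∑ i, (s i * z i) ^ 2 with hS0
  set Sc : (ι → ℝ) → ℝ := fun z => ∑ i, (c i + s i * z i) ^ 2 with hSc
  have hS0m : Measurable S0 := by fun_prop
  have hScm : Measurable Sc := by fun_prop
  have hpos0 : ∀ᵐ z ∂(stdPi ι), 0 < S0 z := by simpa using ae_sum_shift_sq_pos 0 hs0
  have hposc : ∀ᵐ z ∂(stdPi ι), 0 < Sc z := ae_sum_shift_sq_pos c hs0
  set F : (ι → ℝ) → ℝ → ℝ := fun z t => t⁻¹ * (Real.exp (-(t * S0 z)) - Real.exp (-(t * Sc z)))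
    with hF
  set ν : Measure ℝ := volume.restrict (Set.Ioi 0) with hν
  have hFm : AEStronglyMeasurable (Function.uncurry F) ((stdPi ι).prod ν) := by
    apply Measurable.aestronglyMeasurable
    have h1 : Measurable fun p : (ι → ℝ) × ℝ => S0 p.1 := hS0m.comp measurable_fst
    have h2 : Measurable fun p : (ι → ℝ) × ℝ => Sc p.1 := hScm.comp measurable_fst
    simp only [hF, Function.uncurry_def]
    fun_prop
  -- The `L¹` norm in `t` equals `|log (Sc z) - log (S0 z)|`, which is integrable in `z` by `hc` and
  -- `h0`.
  have hFi : Integrable (Function.uncurry F) ((stdPi ι).prod ν) := by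
    rw [integrable_prod_iff hFm]
    constructor
    · filter_upwards [hpos0, hposc] with z h1 h2 using integrableOn_inv_mul_exp_sub_exp h1 h2
    · refine (hc.sub h0).norm.congr ?_
      filter_upwards [hpos0, hposc] with z h1 h2
      exact (integral_norm_inv_mul_exp_sub_exp h1 h2).symm
  have hswap := integral_integral_swap hFi
  have hleft : ∫ z, Real.log (Sc z) ∂(stdPi ι) - ∫ z, Real.log (S0 z) ∂(stdPi ι)
      = ∫ z, ∫ t, F z t ∂ν ∂(stdPi ι) := by
    rw [← integral_sub hc h0]
    apply integral_congr_ae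
    filter_upwards [hpos0, hposc] with z h1 h2
    exact (integral_inv_mul_exp_sub_exp h1 h2).symm
  rw [hleft, hswap]
  obtain ⟨hi, hv⟩ := integrableOn_inv_one_add_pow hg
  have hbound : ∀ᵐ t ∂ν, ‖∫ z, F z t ∂(stdPi ι)‖
      ≤ (∑ i, c i ^ 2) * ((1 + t) ^ (g + 1))⁻¹ := by
    filter_upwards [ae_restrict_mem measurableSet_Ioi] with t ht
    have ht : 0 < t := ht
    have hint : ∀ S : (ι → ℝ) → ℝ, Measurable S → (∀ z, 0 ≤ S z) →
        Integrable (fun z => Real.exp (-(t * S z))) (stdPi ι) := by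
      intro S hS hS0
      refine Integrable.of_bound (Measurable.aestronglyMeasurable (by fun_prop)) 1
        (Filter.Eventually.of_forall fun z => ?_)
      rw [Real.norm_of_nonneg (Real.exp_pos _).le]
      exact Real.exp_le_one_iff.2 (by have := mul_nonneg ht.le (hS0 z); linarith)
    have e0 := integral_exp_neg_mul_sum_sq ht.le (0 : ι → ℝ) s
    have ec := integral_exp_neg_mul_sum_sq ht.le c s
    simp only [Pi.zero_apply, zero_add, ne_eq, OfNat.ofNat_ne_zero, not_false_eq_true, zero_pow,
      mul_zero, zero_div, Finset.sum_const_zero, neg_zero, Real.exp_zero, mul_one] at e0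
    simp only [hF]
    rw [integral_const_mul, integral_sub (hint S0 hS0m fun z => by positivity)
      (hint Sc hScm fun z => by positivity), e0, ec]
    set p := ∏ i, (√(1 + 2 * t * s i ^ 2))⁻¹ with hp
    set q := ∑ i, t * c i ^ 2 / (1 + 2 * t * s i ^ 2) with hq
    have hp0 : 0 ≤ p := Finset.prod_nonneg fun i _ => by positivity
    have hq0 : 0 ≤ q := Finset.sum_nonneg fun i _ => by positivity
    have hp1 : p ≤ ((1 + t) ^ g)⁻¹ := prod_inv_sqrt_le ht.le hι hs
    have hq1 : q ≤ t * (∑ i, c i ^ 2) * (1 + t)⁻¹ := by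
      rw [Finset.mul_sum, Finset.sum_mul]
      refine Finset.sum_le_sum fun i _ => ?_
      rw [← div_eq_mul_inv]
      exact div_le_div_of_nonneg_left (by positivity) (by positivity) (by nlinarith [hs i])
    have hexp : 1 - Real.exp (-q) ≤ q := by have := Real.add_one_le_exp (-q); linarith
    have hexp0 : 0 ≤ 1 - Real.exp (-q) := by
      have := Real.exp_le_one_iff.2 (show -q ≤ 0 by linarith); linarith
    -- The difference of Laplace transforms is `p (1 - e^(-q))`. Here `q` carries a factor `t` that
    -- cancels Frullani's `1/t`, and `p` contributes `(1 + t)^(-g)`; the remaining integral over `t`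
    -- equals `1/g`.
    have hfac : p - p * Real.exp (-q) = p * (1 - Real.exp (-q)) := by ring
    rw [hfac, Real.norm_of_nonneg (by positivity), inv_mul_le_iff₀ ht]
    calc p * (1 - Real.exp (-q)) ≤ ((1 + t) ^ g)⁻¹ * (t * (∑ i, c i ^ 2) * (1 + t)⁻¹) :=
          mul_le_mul hp1 (hexp.trans hq1) hexp0 (by positivity)
      _ = t * ((∑ i, c i ^ 2) * ((1 + t) ^ (g + 1))⁻¹) := by
          rw [pow_succ, mul_inv]; ring
  calc |∫ t, ∫ z, F z t ∂(stdPi ι) ∂ν| ≤ ∫ t, (∑ i, c i ^ 2) * ((1 + t) ^ (g + 1))⁻¹ ∂ν :=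
        norm_integral_le_of_norm_le (hi.const_mul _) hbound
    _ = (∑ i, c i ^ 2) / g := by rw [integral_const_mul, hv, mul_one_div]

end Laplace

/-! ### Reduction of nearly white Gaussian vectors to standard ones. -/

section Whitening

variable {Ω : Type*} [MeasurableSpace Ω] {P : Measure Ω} {ι : Type*} [Fintype ι] {g : ℕ}

lemma HasGaussianLaw.sum_mul {κ : Type*} [Fintype κ] {U : ι → Ω → ℝ}
    (hU : HasGaussianLaw (fun ω i => U i ω) P) (M : κ → ι → ℝ) :
    HasGaussianLaw (fun ω k => ∑ l, M k l * U l ω) P :=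
  hU.map_fun (LinearMap.toContinuousLinearMap (Matrix.mulVecLin (Matrix.of M)))

lemma memLp_sum_mul {U : ι → Ω → ℝ} (hU : ∀ i, MemLp (U i) 2 P) (v : ι → ℝ) :
    MemLp (fun ω => ∑ l, v l * U l ω) 2 P :=
  memLp_finsetSum _ fun i _ => (hU i).const_mul (v i)

lemma covariance_sum_mul_sum_mul [IsProbabilityMeasure P] {κ : Type*} [Fintype κ]
    {U : ι → Ω → ℝ} {W : κ → Ω → ℝ}
    (hU : ∀ i, MemLp (U i) 2 P) (hW : ∀ i, MemLp (W i) 2 P) (v : ι → ℝ) (w : κ → ℝ) :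
    cov[fun ω => ∑ l, v l * U l ω, fun ω => ∑ l, w l * W l ω; P]
      = ∑ i, ∑ j, v i * w j * cov[U i, W j; P] := by
  rw [covariance_fun_sum_fun_sum (fun i => (hU i).const_mul (v i))
    fun i => (hW i).const_mul (w i)]
  refine Finset.sum_congr rfl fun i _ => Finset.sum_congr rfl fun j _ => ?_
  rw [covariance_const_mul_left, covariance_const_mul_right, mul_assoc]

/-- The basis diagonalises the covariance matrix. An eigenvalue is the variance of the form given by
a unit eigenvector, so `hq` at that vector places it within `ε` of `1`. -/
lemma exists_orthonormalBasis_covariance [DecidableEq ι] [IsProbabilityMeasure P] {U : ι → Ω → ℝ}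
    (hU : ∀ i, MemLp (U i) 2 P) {ε : ℝ}
    (hq : ∀ v : ι → ℝ, |Var[fun ω => ∑ l, v l * U l ω; P] - ∑ l, v l ^ 2| ≤ ε * ∑ l, v l ^ 2) :
    ∃ (b : OrthonormalBasis ι ℝ (EuclideanSpace ℝ ι)) (a : ι → ℝ), (∀ i, |a i - 1| ≤ ε) ∧
      ∀ i j, cov[fun ω => ∑ l, b i l * U l ω, fun ω => ∑ l, b j l * U l ω; P]
        = if i = j then a i else 0 := by
  set A : Matrix ι ι ℝ := Matrix.of fun i j => cov[U i, U j; P] with hAdef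
  have hA : A.IsHermitian := by
    ext i j
    simp [hAdef, covariance_comm]
  have hinner : ∀ i j, ∑ l, hA.eigenvectorBasis i l * hA.eigenvectorBasis j l
      = if i = j then 1 else 0 := by
    intro i j
    have h := orthonormal_iff_ite.1 hA.eigenvectorBasis.orthonormal j i
    simp only [PiLp.inner_apply, RCLike.inner_apply, conj_trivial] at h
    rw [h]
    simp [eq_comm]
  have hcov : ∀ i j, cov[fun ω => ∑ l, hA.eigenvectorBasis i l * U l ω,
      fun ω => ∑ l, hA.eigenvectorBasis j l * U l ω; P] = if i = j then hA.eigenvalues i else 0 := by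
    intro i j
    rw [covariance_sum_mul_sum_mul hU hU]
    have h1 : ∀ k, ∑ l, A k l * hA.eigenvectorBasis j l
        = hA.eigenvalues j * hA.eigenvectorBasis j k := fun k =>
      congrFun (hA.mulVec_eigenvectorBasis j) k
    calc ∑ k, ∑ l, hA.eigenvectorBasis i k * hA.eigenvectorBasis j l * cov[U k, U l; P]
        = ∑ k, hA.eigenvectorBasis i k * ∑ l, A k l * hA.eigenvectorBasis j l := by
          refine Finset.sum_congr rfl fun k _ => ?_
          rw [Finset.mul_sum]
          exact Finset.sum_congr rfl fun l _ => by simp only [hAdef, Matrix.of_apply]; ring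
      _ = hA.eigenvalues j * ∑ k, hA.eigenvectorBasis i k * hA.eigenvectorBasis j k := by
          rw [Finset.mul_sum]
          exact Finset.sum_congr rfl fun k _ => by rw [h1]; ring
      _ = _ := by
          rw [hinner]
          split_ifs with h
          · rw [h, mul_one]
          · rw [mul_zero]
  refine ⟨hA.eigenvectorBasis, hA.eigenvalues, fun i => ?_, hcov⟩
  have h := hq (hA.eigenvectorBasis i)
  have h1 : ∑ l, hA.eigenvectorBasis i l ^ 2 = 1 := by
    simpa [sq] using hinner i i
  rw [← covariance_self ((memLp_sum_mul hU _).aemeasurable), hcov, if_pos rfl, h1, mul_one] at h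
  exact h

/-- A Gaussian vector whose covariance matrix is close to the identity is, after a linear change
of coordinates that almost preserves lengths, a standard Gaussian vector. -/
lemma exists_whitening [DecidableEq ι] [IsProbabilityMeasure P] {U : ι → Ω → ℝ}
    (hG : HasGaussianLaw (fun ω i => U i ω) P) (h0 : ∀ i, ∫ ω, U i ω ∂P = 0) {ε : ℝ}
    (hε' : ε ≤ 1 / 2)
    (hq : ∀ v : ι → ℝ, |Var[fun ω => ∑ l, v l * U l ω; P] - ∑ l, v l ^ 2| ≤ ε * ∑ l, v l ^ 2) :
    ∃ (a : ι → ℝ) (M : ι → ι → ℝ), (∀ i, |a i - 1| ≤ ε) ∧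
      P.map (fun ω i => ∑ l, M i l * U l ω) = stdPi ι ∧
      (∀ i j, cov[fun ω => ∑ l, M i l * U l ω, fun ω => ∑ l, M j l * U l ω; P]
        = if i = j then 1 else 0) ∧
      (∀ u : ι → ℝ, ∑ l, u l ^ 2 = ∑ i, a i * (∑ l, M i l * u l) ^ 2) ∧
      (∀ t : ι → ℝ, ∑ l, (∑ i, t i * M i l) ^ 2 ≤ 2 * ∑ i, t i ^ 2) := by
  have hU : ∀ i, MemLp (U i) 2 P := fun i => (hG.eval i).memLp_two
  obtain ⟨b, a, ha, hcov⟩ := exists_orthonormalBasis_covariance hU hq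
  have hapos : ∀ i, 1 / 2 ≤ a i := fun i => by have := (abs_le.1 (ha i)).1; linarith
  have hap : ∀ i, 0 < a i := fun i => by linarith [hapos i]
  have hZG := HasGaussianLaw.sum_mul hG (fun i l => (√(a i))⁻¹ * b i l)
  have hZeq : ∀ i, (fun ω => ∑ l, (√(a i))⁻¹ * b i l * U l ω)
      = fun ω => (√(a i))⁻¹ * ∑ l, b i l * U l ω := by
    intro i; ext ω
    rw [Finset.mul_sum]
    exact Finset.sum_congr rfl fun l _ => by ring
  have hZcov : ∀ i j, cov[fun ω => ∑ l, (√(a i))⁻¹ * b i l * U l ω,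
      fun ω => ∑ l, (√(a j))⁻¹ * b j l * U l ω; P] = if i = j then 1 else 0 := by
    intro i j
    rw [hZeq, hZeq, covariance_const_mul_left, covariance_const_mul_right, hcov]
    split_ifs with h
    · subst h
      rw [← mul_assoc, ← mul_inv, Real.mul_self_sqrt (hap i).le, inv_mul_cancel₀ (hap i).ne']
    · simp
  refine ⟨a, fun i l => (√(a i))⁻¹ * b i l, ha, ?_, hZcov, ?_, ?_⟩
  · have hind : iIndepFun (fun i ω => ∑ l, (√(a i))⁻¹ * b i l * U l ω) P :=
      hZG.iIndepFun_of_covariance_eq_zero fun i j hij => by rw [hZcov, if_neg hij]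
    have hmap := (iIndepFun_iff_map_fun_eq_pi_map
      (fun i => (hZG.eval i).aemeasurable)).1 hind
    rw [hmap]
    congr 1
    ext1 i
    rw [(hZG.eval i).map_eq_gaussianReal]
    congr 1
    · rw [integral_finsetSum _ fun l _ => ((hU l).integrable one_le_two).const_mul _]
      exact Finset.sum_eq_zero fun l _ => by rw [integral_const_mul, h0, mul_zero]
    · rw [← covariance_self (hZG.eval i).aemeasurable, hZcov, if_pos rfl, Real.toNNReal_one]
  · intro u
    have h1 : ∀ i, a i * (∑ l, (√(a i))⁻¹ * b i l * u l) ^ 2 = (∑ l, b i l * u l) ^ 2 := by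
      intro i
      have : ∑ l, (√(a i))⁻¹ * b i l * u l = (√(a i))⁻¹ * ∑ l, b i l * u l := by
        rw [Finset.mul_sum]
        exact Finset.sum_congr rfl fun l _ => by ring
      rw [this, mul_pow, inv_pow, Real.sq_sqrt (hap i).le, ← mul_assoc,
        mul_inv_cancel₀ (hap i).ne', one_mul]
    simp_rw [h1]
    have h2 := b.sum_sq_norm_inner_right (WithLp.toLp 2 u)
    simp only [PiLp.inner_apply, RCLike.inner_apply, conj_trivial, Real.norm_eq_abs, sq_abs,
      EuclideanSpace.norm_sq_eq] at h2
    rw [← h2]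
    exact Finset.sum_congr rfl fun i _ => by simp_rw [mul_comm]
  · intro t
    have h2 := b.orthonormal.inner_sum (fun i => (√(a i))⁻¹ * t i) (fun i => (√(a i))⁻¹ * t i)
      Finset.univ
    simp only [PiLp.inner_apply, RCLike.inner_apply, conj_trivial, WithLp.ofLp_sum,
      Finset.sum_apply, WithLp.ofLp_smul, Pi.smul_apply, smul_eq_mul] at h2
    have h3 : ∀ l, (∑ i, t i * ((√(a i))⁻¹ * b i l)) ^ 2
        = (∑ i, (√(a i))⁻¹ * t i * b i l) * ∑ i, (√(a i))⁻¹ * t i * b i l := by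
      intro l
      rw [sq]
      congr 1 <;> exact Finset.sum_congr rfl fun i _ => by ring
    simp_rw [h3]
    rw [h2, Finset.mul_sum]
    -- The factor `2` bounds `1 / a i`, since `ε ≤ 1/2` forces `a i ≥ 1/2`.
    refine Finset.sum_le_sum fun i _ => ?_
    have h4 : (√(a i))⁻¹ * t i * ((√(a i))⁻¹ * t i) = (a i)⁻¹ * t i ^ 2 := by
      rw [← Real.sqrt_inv]
      have := Real.mul_self_sqrt (inv_pos.2 (hap i)).le
      linear_combination t i ^ 2 * this
    rw [h4]
    refine mul_le_mul_of_nonneg_right ?_ (sq_nonneg _)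
    rw [inv_le_comm₀ (hap i) two_pos]
    linarith [hapos i]

/-- Moments of the log squared norm of a Gaussian vector with covariance close to the identity. -/
theorem log_norm_sq_moments [IsProbabilityMeasure P] (hg : 1 ≤ g) (hι : Fintype.card ι = 2 * g)
    {U : ι → Ω → ℝ}
    (hG : HasGaussianLaw (fun ω i => U i ω) P) (h0 : ∀ i, ∫ ω, U i ω ∂P = 0) {ε : ℝ} (hε : 0 ≤ ε)
    (hε' : ε ≤ 1 / 2)
    (hq : ∀ v : ι → ℝ, |Var[fun ω => ∑ l, v l * U l ω; P] - ∑ l, v l ^ 2| ≤ ε * ∑ l, v l ^ 2) :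
    MemLp (fun ω => Real.log (∑ l, U l ω ^ 2)) 2 P ∧
    |∫ ω, Real.log (∑ l, U l ω ^ 2) ∂P - (digamma g + Real.log 2)| ≤ 2 * ε ∧
    |Var[fun ω => Real.log (∑ l, U l ω ^ 2); P] - deriv digamma g|
      ≤ (8 + 4 * deriv digamma 1) * ε ^ 2 := by
  classical
  obtain ⟨a, M, ha, hmap, -, hsq, -⟩ := exists_whitening hG h0 hε' hq
  have hZ : AEMeasurable (fun ω i => ∑ l, M i l * U l ω) P :=
    (HasGaussianLaw.sum_mul hG M).aemeasurable
  have hFm : Measurable fun z : ι → ℝ => Real.log (∑ i, a i * z i ^ 2) :=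
    Real.measurable_log.comp (by fun_prop)
  simp_rw [hsq]
  refine ⟨?_, ?_, ?_⟩
  · have h := memLp_log_weighted_sum_sq hg hι hε hε' ha
    rw [← hmap] at h
    exact (memLp_map_measure_iff hFm.aestronglyMeasurable hZ).1 h
  · have h := abs_integral_log_weighted_sum_sq_sub_le hg hι hε hε' ha
    rw [← hmap, integral_map hZ hFm.aestronglyMeasurable] at h
    exact h
  · have h := abs_variance_log_weighted_sum_sq_sub_le hg hι hε hε' ha
    rw [← hmap, variance_map hFm.aemeasurable hZ] at h
    exact h

end Whitening

/-! ### Covariance of two log squared norms. -/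

section CrossCovariance

variable {Ω : Type*} [MeasurableSpace Ω] {P : Measure Ω} {ι : Type*} [Fintype ι] {g : ℕ}

/-- The second moment is the exponential moment of `log` at `2`, namely `4 g (g + 1) ≤ 8 g²`. The
growth `g²` is exactly what the factor `1/g` in the shift estimate absorbs. -/
lemma integral_sum_sq_sq_le (hg : 1 ≤ g) (hι : Fintype.card ι = 2 * g) :
    Integrable (fun z => (∑ i, z i ^ 2) ^ 2) (stdPi ι) ∧
      ∫ z, (∑ i, z i ^ 2) ^ 2 ∂(stdPi ι) ≤ 8 * (g : ℝ) ^ 2 := by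
  have hg1 : (1 : ℝ) ≤ g := by exact_mod_cast hg
  have hg0 : (0 : ℝ) < g := by linarith
  have hne : Nonempty ι := Fintype.card_pos_iff.1 (by omega)
  have hm := mgf_log_gammaMeasure (t := 2) hg0 (r := 1 / 2) (by norm_num) (by linarith)
  rw [show (g : ℝ) + 2 = (g + 1) + 1 by ring, Real.Gamma_add_one (by positivity),
    Real.Gamma_add_one (by positivity)] at hm
  have hG := (Real.Gamma_pos_of_pos hg0).ne'
  have hm' : mgf Real.log (gammaMeasure g (1 / 2)) 2 = 4 * (g * (g + 1)) := by
    rw [hm]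
    norm_num
    field_simp
  have hae : (fun z : ι → ℝ => Real.exp (2 * Real.log (∑ i, z i ^ 2)))
      =ᵐ[stdPi ι] fun z => (∑ i, z i ^ 2) ^ 2 := by
    filter_upwards [ae_sum_sq_ne_zero] with z hz
    have : 0 < ∑ i, z i ^ 2 := lt_of_le_of_ne (Finset.sum_nonneg fun i _ => sq_nonneg _) hz.symm
    rw [two_mul, Real.exp_add, Real.exp_log this, sq]
  have hmm : Measurable fun x : ℝ => Real.exp (2 * Real.log x) := by fun_prop
  have hi : Integrable (fun x => Real.exp (2 * Real.log x)) (gammaMeasure g (1 / 2)) := by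
    by_contra h
    have : mgf Real.log (gammaMeasure g (1 / 2)) 2 = 0 := integral_undef h
    rw [hm'] at this
    exact absurd this (by positivity)
  rw [mgf, ← map_sum_sq_stdPi hg hι, integral_map measurable_sum_sq.aemeasurable
    hmm.aestronglyMeasurable, integral_congr_ae hae] at hm'
  rw [← map_sum_sq_stdPi hg hι, integrable_map_measure hmm.aestronglyMeasurable
    measurable_sum_sq.aemeasurable] at hi
  refine ⟨hi.congr hae, ?_⟩
  rw [hm']
  nlinarith

/-- The squared correlation bound for the logarithms of the squared norms of two nearly white
jointly Gaussian vectors. -/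
theorem abs_covariance_log_norm_sq_le [IsProbabilityMeasure P] (hg : 1 ≤ g)
    (hι : Fintype.card ι = 2 * g) {U W : ι → Ω → ℝ}
    (hG : HasGaussianLaw (fun ω => (fun i => U i ω, fun i => W i ω)) P)
    (hU0 : ∀ i, ∫ ω, U i ω ∂P = 0) (hW0 : ∀ i, ∫ ω, W i ω ∂P = 0)
    {ε ρ : ℝ} (hε : 0 ≤ ε) (hρ : 0 < ρ) (hερ : ε + 2 * ρ ^ 2 ≤ 1 / 2)
    (hU : ∀ v : ι → ℝ, |Var[fun ω => ∑ l, v l * U l ω; P] - ∑ l, v l ^ 2| ≤ ε * ∑ l, v l ^ 2)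
    (hW : ∀ v : ι → ℝ, |Var[fun ω => ∑ l, v l * W l ω; P] - ∑ l, v l ^ 2| ≤ ε * ∑ l, v l ^ 2)
    (hUW : ∀ v w : ι → ℝ, |cov[fun ω => ∑ l, v l * U l ω, fun ω => ∑ l, w l * W l ω; P]|
      ≤ ρ * (∑ l, v l ^ 2 + ∑ l, w l ^ 2) / 2) :
    |cov[fun ω => Real.log (∑ l, U l ω ^ 2), fun ω => Real.log (∑ l, W l ω ^ 2); P]|
      ≤ (10 + 2 * deriv digamma 1) * ρ ^ 2 := by
  classical
  have hε' : ε ≤ 1 / 2 := by nlinarith [sq_nonneg ρ]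
  have hg0 : (0 : ℝ) < g := by exact_mod_cast hg
  obtain ⟨a, M, ha, hmap, hZcov, hsq, hM⟩ := exists_whitening (U := U) hG.fst hU0 hε' hU
  have hUp : ∀ i, MemLp (U i) 2 P := fun i => (hG.fst.eval i).memLp_two
  have hWp : ∀ i, MemLp (W i) 2 P := fun i => (hG.snd.eval i).memLp_two
  set Z : ι → Ω → ℝ := fun i ω => ∑ l, M i l * U l ω with hZ
  have hZp : ∀ i, MemLp (Z i) 2 P := fun i => memLp_sum_mul hUp (M i)
  have hZ0 : ∀ i, ∫ ω, Z i ω ∂P = 0 := fun i => by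
    simp only [hZ]
    rw [integral_finsetSum _ fun l _ => ((hUp l).integrable one_le_two).const_mul _]
    exact Finset.sum_eq_zero fun l _ => by rw [integral_const_mul, hU0, mul_zero]
  -- Linear regression: `B` holds the regression coefficients of `W` on the white vector `Z`, and
  -- `E` is the residual, uncorrelated with `Z` and hence independent of it.
  set B : ι → ι → ℝ := fun l i => cov[W l, Z i; P] with hB
  set E : ι → Ω → ℝ := fun l ω => W l ω - ∑ i, B l i * Z i ω with hE
  have hEp : ∀ i, MemLp (E i) 2 P := fun i => (hWp i).sub (memLp_sum_mul hZp (B i))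
  have hE0 : ∀ i, ∫ ω, E i ω ∂P = 0 := fun i => by
    simp only [hE]
    rw [integral_sub ((hWp i).integrable one_le_two)
      ((memLp_sum_mul hZp (B i)).integrable one_le_two), hW0,
      integral_finsetSum _ fun l _ => ((hZp l).integrable one_le_two).const_mul _]
    simp [integral_const_mul, hZ0]
  have hZE : HasGaussianLaw (fun ω => (fun i => Z i ω, fun l => E l ω)) P := by
    let A := LinearMap.toContinuousLinearMap (Matrix.mulVecLin (Matrix.of M))
    let B' := LinearMap.toContinuousLinearMap (Matrix.mulVecLin (Matrix.of B))
    exact hG.map_fun ((A.comp (.fst ℝ _ _)).prod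
      (ContinuousLinearMap.snd ℝ _ _ - (B'.comp A).comp (.fst ℝ _ _)))
  have hcovZ : ∀ (v t : ι → ℝ), cov[fun ω => ∑ l, v l * W l ω, fun ω => ∑ i, t i * Z i ω; P]
      = ∑ i, (∑ l, v l * B l i) * t i := by
    intro v t
    rw [covariance_sum_mul_sum_mul hWp hZp, Finset.sum_comm]
    refine Finset.sum_congr rfl fun i _ => ?_
    rw [Finset.sum_mul]
    exact Finset.sum_congr rfl fun l _ => by simp only [hB]; ring
  have hvarZ : ∀ (t : ι → ℝ), Var[fun ω => ∑ i, t i * Z i ω; P] = ∑ i, t i ^ 2 := by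
    intro t
    rw [← covariance_self (memLp_sum_mul hZp t).aemeasurable, covariance_sum_mul_sum_mul hZp hZp]
    refine Finset.sum_congr rfl fun i _ => ?_
    simp only [hZ, hZcov, mul_ite, mul_one, mul_zero, Finset.sum_ite_eq, Finset.mem_univ, if_true]
    ring
  -- The bound `hUW` is additive in the two squared norms, so the test vectors must be balanced.
  -- With the second one scaled to `2ρv` it reads `2ρ|t|² ≤ ρ(2|t|² + 4ρ²|v|²)/2`, that is `|t|² ≤
  -- 2ρ²|v|²`.
  have hBv : ∀ v : ι → ℝ, ∑ i, (∑ l, v l * B l i) ^ 2 ≤ 2 * ρ ^ 2 * ∑ l, v l ^ 2 := by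
    intro v
    set t : ι → ℝ := fun i => ∑ l, v l * B l i with ht
    have h1 : cov[fun ω => ∑ l, (∑ i, t i * M i l) * U l ω,
        fun ω => ∑ l, (2 * ρ * v l) * W l ω; P] = 2 * ρ * ∑ i, t i ^ 2 := by
      have e1 : (fun ω => ∑ l, (∑ i, t i * M i l) * U l ω) = fun ω => ∑ i, t i * Z i ω := by
        ext ω
        simp only [hZ, Finset.mul_sum, Finset.sum_mul]
        rw [Finset.sum_comm]
        exact Finset.sum_congr rfl fun i _ => Finset.sum_congr rfl fun l _ => by ring
      rw [e1, covariance_comm, hcovZ, Finset.mul_sum]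
      refine Finset.sum_congr rfl fun i _ => ?_
      have : ∑ l, 2 * ρ * v l * B l i = 2 * ρ * t i := by
        simp only [ht, Finset.mul_sum]
        exact Finset.sum_congr rfl fun l _ => by ring
      rw [this]; ring
    have h2 := hUW (fun l => ∑ i, t i * M i l) (fun l => 2 * ρ * v l)
    rw [h1, abs_of_nonneg (by positivity)] at h2
    have h3 := hM t
    have h4 : ∑ l, (2 * ρ * v l) ^ 2 = 4 * ρ ^ 2 * ∑ l, v l ^ 2 := by
      rw [Finset.mul_sum]
      exact Finset.sum_congr rfl fun l _ => by ring
    rw [h4] at h2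
    have h5 : ρ * ∑ i, t i ^ 2 ≤ ρ * (2 * ρ ^ 2 * ∑ l, v l ^ 2) := by nlinarith
    exact le_of_mul_le_mul_left h5 hρ
  -- The same operator bound for the transpose, by Cauchy–Schwarz applied to `|Bz|² = ⟨z, Bᵀ(Bz)⟩`.
  have hBz : ∀ z : ι → ℝ, ∑ l, (∑ i, B l i * z i) ^ 2 ≤ 2 * ρ ^ 2 * ∑ i, z i ^ 2 := by
    intro z
    set y : ι → ℝ := fun l => ∑ i, B l i * z i with hy
    have h1 : ∑ l, y l ^ 2 = ∑ i, z i * ∑ l, y l * B l i := by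
      simp only [Finset.mul_sum]
      rw [Finset.sum_comm]
      refine Finset.sum_congr rfl fun l _ => ?_
      rw [sq]
      conv_lhs => rw [hy]
      simp only [Finset.mul_sum]
      exact Finset.sum_congr rfl fun i _ => by simp only [hy]; ring
    have h2 := Finset.sum_mul_sq_le_sq_mul_sq Finset.univ z fun i => ∑ l, y l * B l i
    rw [← h1] at h2
    have h3 := hBv y
    have h4 : 0 ≤ ∑ i, z i ^ 2 := Finset.sum_nonneg fun i _ => sq_nonneg _
    have h5 : 0 ≤ ∑ l, y l ^ 2 := Finset.sum_nonneg fun i _ => sq_nonneg _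
    rcases h5.eq_or_lt with h6 | h6
    · rw [← h6]; positivity
    · have h7 := mul_le_mul_of_nonneg_left h3 h4
      refine le_of_mul_le_mul_left (?_ : (∑ l, y l ^ 2) * _ ≤ (∑ l, y l ^ 2) * _) h6
      nlinarith
  -- Removing the projection on `Z` lowers the variance by `|t|² ≤ 2ρ²|v|²`, so the residual is
  -- still nearly white and can be whitened in turn.
  have hEvar : ∀ v : ι → ℝ, |Var[fun ω => ∑ l, v l * E l ω; P] - ∑ l, v l ^ 2|
      ≤ (ε + 2 * ρ ^ 2) * ∑ l, v l ^ 2 := by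
    intro v
    set t : ι → ℝ := fun i => ∑ l, v l * B l i with ht
    have e1 : (fun ω => ∑ l, v l * E l ω)
        = (fun ω => ∑ l, v l * W l ω) - fun ω => ∑ i, t i * Z i ω := by
      ext ω
      simp only [hE, Pi.sub_apply, mul_sub, Finset.sum_sub_distrib, Finset.mul_sum, ht,
        Finset.sum_mul]
      congr 1
      rw [Finset.sum_comm]
      exact Finset.sum_congr rfl fun i _ => Finset.sum_congr rfl fun l _ => by ring
    have h1 := hcovZ v t
    have h2 : ∑ i, (∑ l, v l * B l i) * t i = ∑ i, t i ^ 2 :=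
      Finset.sum_congr rfl fun i _ => by simp only [ht]; ring
    rw [e1, variance_sub (memLp_sum_mul hWp v) (memLp_sum_mul hZp t), h1, h2, hvarZ]
    have h3 := abs_le.1 (hW v)
    have h4 := hBv v
    have h5 : 0 ≤ ∑ i, t i ^ 2 := Finset.sum_nonneg fun i _ => sq_nonneg _
    have h6 : 0 ≤ ∑ l, v l ^ 2 := Finset.sum_nonneg fun i _ => sq_nonneg _
    rw [abs_le]
    constructor <;> nlinarith [mul_nonneg (sq_nonneg ρ) h6]
  have hindep : IndepFun (fun ω i => Z i ω) (fun ω l => E l ω) P := by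
    refine hZE.indepFun_of_covariance_eval fun i l => ?_
    have e1 : E l = W l - fun ω => ∑ i, B l i * Z i ω := rfl
    rw [covariance_comm, e1, covariance_sub_left (hWp l) (memLp_sum_mul hZp (B l)) (hZp i),
      covariance_fun_sum_left (fun k => (hZp k).const_mul _) (hZp i)]
    simp only [covariance_const_mul_left, hZcov, hZ, hB, mul_ite, mul_one, mul_zero,
      Finset.sum_ite_eq', Finset.mem_univ, if_true, sub_self]
  obtain ⟨a', M', ha', hmap', -, hsq', -⟩ := exists_whitening (U := E) hZE.snd hE0 hερ hEvar
  have ha'pos : ∀ i, 1 / 2 ≤ a' i := fun i => by have := (abs_le.1 (ha' i)).1; linarith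
  set Z' : Ω → ι → ℝ := fun ω i => ∑ l, M' i l * E l ω with hZ'
  set s : ι → ℝ := fun i => √(a' i) with hs
  have hs2 : ∀ i, s i ^ 2 = a' i := fun i => Real.sq_sqrt (by linarith [ha'pos i])
  -- In the whitened coordinates of the residual, `|W|² = ∑ (c z i + s i * z' i)²` with `z, z'`
  -- independent and standard: conditioning on `z` only moves the centre.
  set c : (ι → ℝ) → ι → ℝ := fun z i => s i * ∑ l, M' i l * ∑ k, B l k * z k with hc
  have hcm : Measurable c := by
    refine measurable_pi_lambda _ fun i => ?_
    simp only [hc]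
    fun_prop
  have hcsq : ∀ z, ∑ i, c z i ^ 2 ≤ 2 * ρ ^ 2 * ∑ i, z i ^ 2 := by
    intro z
    have : ∑ i, c z i ^ 2 = ∑ l, (∑ k, B l k * z k) ^ 2 := by
      rw [hsq' fun l => ∑ k, B l k * z k]
      exact Finset.sum_congr rfl fun i _ => by simp only [hc]; rw [mul_pow, hs2]
    rw [this]
    exact hBz z
  set F : (ι → ℝ) → ℝ := fun z => Real.log (∑ i, a i * z i ^ 2) with hF
  set G : (ι → ℝ) × (ι → ℝ) → ℝ := fun p => Real.log (∑ i, (c p.1 i + s i * p.2 i) ^ 2) with hGdef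
  have hFm : Measurable F := Real.measurable_log.comp (by fun_prop)
  have hGm : Measurable G := Real.measurable_log.comp (by fun_prop)
  have hZm : AEMeasurable (fun ω i => Z i ω) P := hZE.fst.aemeasurable
  have hZ'm : AEMeasurable Z' P :=
    (HasGaussianLaw.sum_mul (U := E) hZE.snd M').aemeasurable
  have hZZ' : IndepFun (fun ω i => Z i ω) Z' P := by
    have : Measurable fun e : ι → ℝ => fun i => ∑ l, M' i l * e l := by fun_prop
    exact hindep.comp measurable_id this
  have hlaw : P.map (fun ω => ((fun i => Z i ω), Z' ω)) = (stdPi ι).prod (stdPi ι) := by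
    rw [(indepFun_iff_map_prod_eq_prod_map_map hZm hZ'm).1 hZZ', hmap, hmap']
  have hpair : AEMeasurable (fun ω => ((fun i => Z i ω), Z' ω)) P := hZm.prodMk hZ'm
  have hUF : (fun ω => Real.log (∑ l, U l ω ^ 2)) = fun ω => F (fun i => Z i ω) := by
    ext ω
    simp only [hF, hZ]
    rw [hsq fun l => U l ω]
  have hWG : (fun ω => Real.log (∑ l, W l ω ^ 2)) = fun ω => G ((fun i => Z i ω), Z' ω) := by
    ext ω
    simp only [hGdef]
    rw [hsq' fun l => W l ω]
    congr 1
    refine Finset.sum_congr rfl fun i _ => ?_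
    have : ∀ l, W l ω = (∑ k, B l k * Z k ω) + E l ω := fun l => by simp only [hE]; ring
    simp_rw [this, mul_add, Finset.sum_add_distrib, ← hs2, hc, hZ']
    ring
  have hWmem := (log_norm_sq_moments hg hι (U := W) hG.snd hW0 hε hε' hW).1
  have hGmem : MemLp G 2 ((stdPi ι).prod (stdPi ι)) := by
    rw [hWG] at hWmem
    rw [← hlaw]
    exact (memLp_map_measure_iff hGm.aestronglyMeasurable hpair).2 hWmem
  have hFmem : MemLp F 2 (stdPi ι) := memLp_log_weighted_sum_sq hg hι hε hε' ha
  have hFmem' : MemLp (fun p : (ι → ℝ) × (ι → ℝ) => F p.1) 2 ((stdPi ι).prod (stdPi ι)) :=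
    hFmem.comp_fst _
  have hcoveq : cov[fun ω => Real.log (∑ l, U l ω ^ 2), fun ω => Real.log (∑ l, W l ω ^ 2); P]
      = cov[fun p : (ι → ℝ) × (ι → ℝ) => F p.1, G; (stdPi ι).prod (stdPi ι)] := by
    rw [hUF, hWG, ← hlaw]
    exact (covariance_map_fun (X := fun p : (ι → ℝ) × (ι → ℝ) => F p.1)
      (hFm.comp measurable_fst).aestronglyMeasurable hGm.aestronglyMeasurable hpair).symm
  set m := ∫ z, F z ∂(stdPi ι) with hm
  have hmean : ∫ p : (ι → ℝ) × (ι → ℝ), F p.1 ∂((stdPi ι).prod (stdPi ι)) = m := by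
    rw [integral_fun_fst]; simp [hm]
  have hFGi : Integrable (fun p : (ι → ℝ) × (ι → ℝ) => (F p.1 - m) * G p)
      ((stdPi ι).prod (stdPi ι)) :=
    (hFmem'.sub (memLp_const m)).integrable_mul hGmem
  set h0 := ∫ z, Real.log (∑ i, (s i * z i) ^ 2) ∂(stdPi ι) with hh0
  set H : (ι → ℝ) → ℝ := fun z => ∫ z', G (z, z') ∂(stdPi ι) with hH
  have hFc : Integrable (fun z => F z - m) (stdPi ι) :=
    (hFmem.integrable one_le_two).sub (integrable_const _)
  have hFH : Integrable (fun z => (F z - m) * H z) (stdPi ι) := by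
    have := hFGi.integral_prod_left
    simpa only [integral_const_mul] using this
  -- `H` is the conditional mean of the second logarithm. As `F - m` is centred, a constant may be
  -- subtracted from `H`; the unshifted mean `h0` leaves a difference of order `ρ²`.
  have hfinal : cov[fun p : (ι → ℝ) × (ι → ℝ) => F p.1, G; (stdPi ι).prod (stdPi ι)]
      = ∫ z, (F z - m) * (H z - h0) ∂(stdPi ι) := by
    rw [covariance_eq_integral_sub_mul hFmem' hGmem, hmean, integral_prod _ hFGi]
    simp only [integral_const_mul, mul_sub]
    rw [integral_sub hFH (hFc.mul_const _), integral_mul_const,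
      integral_sub (hFmem.integrable one_le_two) (integrable_const _)]
    simp [hm, hH]
  have h0int : Integrable (fun z => Real.log (∑ i, (s i * z i) ^ 2)) (stdPi ι) := by
    have := (memLp_log_weighted_sum_sq hg hι (by positivity) hερ ha').integrable one_le_two
    simpa only [mul_pow, hs2] using this
  have hHb : ∀ᵐ z ∂(stdPi ι), |H z - h0| ≤ 2 * ρ ^ 2 * (∑ i, z i ^ 2) / g := by
    filter_upwards [(hGmem.integrable one_le_two).prod_right_ae] with z hz
    refine (abs_integral_log_shift_sub_le hg hι (c z) s (fun i => by rw [hs2]; exact ha'pos i)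
      h0int hz).trans ?_
    exact div_le_div_of_nonneg_right (hcsq z) hg0.le
  obtain ⟨hSi, hSb⟩ := integral_sum_sq_sq_le hg hι
  have hFsq : Integrable (fun z => (F z - m) ^ 2) (stdPi ι) :=
    (hFmem.sub (memLp_const m)).integrable_sq
  -- The dominating function comes from `2xy ≤ x² + y²` with `x = |F z - m|` and `y = |z|² / g`. Its
  -- integral is at most `ρ²` times `(2 + 2ψ'(1)) + 8`.
  have hdom : Integrable (fun z => ρ ^ 2 * ((F z - m) ^ 2 + (∑ i, z i ^ 2) ^ 2 / (g : ℝ) ^ 2))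
      (stdPi ι) := (hFsq.add (hSi.div_const _)).const_mul _
  rw [hcoveq, hfinal, ← Real.norm_eq_abs]
  refine (norm_integral_le_of_norm_le hdom ?_).trans ?_
  · filter_upwards [hHb] with z hz
    rw [Real.norm_eq_abs, abs_mul]
    refine (mul_le_mul_of_nonneg_left hz (abs_nonneg _)).trans ?_
    rw [← sq_abs (F z - m), ← div_pow, mul_div_assoc]
    nlinarith [mul_nonneg (sq_nonneg ρ) (sq_nonneg (|F z - m| - (∑ i, z i ^ 2) / g))]
  · rw [integral_const_mul, integral_add hFsq (hSi.div_const _), integral_div]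
    have hv := variance_log_weighted_sum_sq_le hg hι hε hε' ha
    rw [variance_eq_integral hFm.aemeasurable] at hv
    have h8 : (∫ z, (∑ i, z i ^ 2) ^ 2 ∂(stdPi ι)) / (g : ℝ) ^ 2 ≤ 8 := by
      rw [div_le_iff₀ (by positivity)]; exact hSb
    rw [mul_comm]
    refine mul_le_mul_of_nonneg_right ?_ (sq_nonneg ρ)
    have := add_le_add hv h8
    linarith

end CrossCovariance

/-! ### Deterministic bounds for products of kernels, cell by cell. -/

section KernelSums

/-- For `0 ≤ q ≤ 1` the power `x ^ q` lies between `1` and `x`. A negative exponent is treated by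
inversion, where `x ^ (-p) ≥ 1/2` costs the factor `2`. -/
lemma abs_rpow_sub_one_le {x p : ℝ} (hx : 1 / 2 ≤ x) (hp1 : -1 ≤ p) (hp2 : p ≤ 1) :
    |x ^ p - 1| ≤ 2 * |x - 1| := by
  have hx0 : 0 < x := by linarith
  have key : ∀ q : ℝ, 0 ≤ q → q ≤ 1 → |x ^ q - 1| ≤ |x - 1| := by
    intro q h0 h1
    rcases le_total 1 x with h | h
    · have h2 := Real.one_le_rpow h h0
      have h3 := Real.rpow_le_rpow_of_exponent_le h h1
      rw [Real.rpow_one] at h3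
      rw [abs_of_nonneg (by linarith), abs_of_nonneg (by linarith)]
      linarith
    · have h2 := Real.rpow_le_one hx0.le h h0
      have h3 := Real.rpow_le_rpow_of_exponent_ge hx0 h h1
      rw [Real.rpow_one] at h3
      rw [abs_of_nonpos (by linarith), abs_of_nonpos (by linarith)]
      linarith
  rcases le_total 0 p with h | h
  · have := key p h hp2
    linarith [abs_nonneg (x - 1)]
  · have h1 := key (-p) (by linarith) (by linarith)
    have hpos := Real.rpow_pos_of_pos hx0 (-p)
    have h2 : x ^ p - 1 = -((x ^ (-p) - 1) / x ^ (-p)) := by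
      rw [Real.rpow_neg hx0.le] at hpos ⊢
      have : 0 < x ^ p := Real.rpow_pos_of_pos hx0 p
      field_simp
      ring
    have h3 : 1 / 2 ≤ x ^ (-p) := by
      rcases le_total 1 x with h' | h'
      · linarith [Real.one_le_rpow h' (show 0 ≤ -p by linarith)]
      · have h3 := Real.rpow_le_rpow_of_exponent_ge hx0 h' (show -p ≤ 1 by linarith)
        rw [Real.rpow_one] at h3
        linarith
    rw [h2, abs_neg, abs_div, abs_of_pos hpos, div_le_iff₀ hpos]
    nlinarith [abs_nonneg (x - 1)]

/-- Modulus of continuity of a product of a power and a function bounded by `M`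
that is Lipschitz on dyadic scales. -/
lemma abs_rpow_mul_sub_le {a k p M A B : ℝ} (hk : 0 < k) (hak : k / 2 ≤ a) (hp1 : -1 ≤ p)
    (hp2 : p ≤ 1) (hA0 : 0 ≤ A) (hA : A ≤ M) (hAB : |A - B| ≤ M * (|a - k| / min a k)) :
    |a ^ p * A - k ^ p * B| ≤ 6 * M * k ^ p * |a - k| / k := by
  have ha : 0 < a := by linarith
  have hM : 0 ≤ M := hA0.trans hA
  have hkp := Real.rpow_pos_of_pos hk p
  have h1 : |a ^ p - k ^ p| ≤ k ^ p * (2 * (|a - k| / k)) := by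
    have h2 := abs_rpow_sub_one_le (x := a / k) (by rw [le_div_iff₀ hk]; linarith) hp1 hp2
    have h3 : a ^ p - k ^ p = k ^ p * ((a / k) ^ p - 1) := by
      rw [Real.div_rpow ha.le hk.le]; field_simp
    have h4 : a / k - 1 = (a - k) / k := by field_simp
    rw [h3, abs_mul, abs_of_pos hkp]
    rw [h4, abs_div, abs_of_pos hk] at h2
    exact mul_le_mul_of_nonneg_left h2 hkp.le
  have h5 : |A - B| ≤ M * (2 * (|a - k| / k)) := by
    refine hAB.trans (mul_le_mul_of_nonneg_left ?_ hM)
    rw [div_le_iff₀ (lt_min ha hk)]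
    have : k / 2 ≤ min a k := le_min hak (by linarith)
    calc |a - k| = 2 * (|a - k| / k) * (k / 2) := by field_simp
      _ ≤ _ := mul_le_mul_of_nonneg_left this (by positivity)
  have h6 : a ^ p * A - k ^ p * B = (a ^ p - k ^ p) * A + k ^ p * (A - B) := by ring
  rw [h6]
  refine (abs_add_le _ _).trans ?_
  rw [abs_mul, abs_mul, abs_of_nonneg hA0, abs_of_pos hkp]
  have h7 : |a ^ p - k ^ p| * A ≤ k ^ p * (2 * (|a - k| / k)) * M :=
    mul_le_mul h1 hA hA0 (by positivity)
  have h8 : k ^ p * |A - B| ≤ k ^ p * (M * (2 * (|a - k| / k))) :=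
    mul_le_mul_of_nonneg_left h5 hkp.le
  have h9 : 0 ≤ M * k ^ p * (|a - k| / k) := by positivity
  have h10 : 6 * M * k ^ p * |a - k| / k = 6 * (M * k ^ p * (|a - k| / k)) := by ring
  rw [h10]
  nlinarith

lemma rpow_le_mul_rpow {a b c p : ℝ} (hb : 0 < b) (hc : 1 ≤ c) (h1 : b / c ≤ a) (h2 : a ≤ c * b)
    (hp1 : -1 ≤ p) (hp2 : p ≤ 1) : a ^ p ≤ c * b ^ p := by
  have hc0 : 0 < c := by linarith
  have ha : 0 < a := (div_pos hb hc0).trans_le h1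
  rcases le_total 0 p with h | h
  · calc a ^ p ≤ (c * b) ^ p := Real.rpow_le_rpow ha.le h2 h
      _ = c ^ p * b ^ p := Real.mul_rpow hc0.le hb.le
      _ ≤ c * b ^ p := by
        refine mul_le_mul_of_nonneg_right ?_ (Real.rpow_nonneg hb.le p)
        simpa using Real.rpow_le_rpow_of_exponent_le hc hp2
  · calc a ^ p ≤ (b / c) ^ p := Real.rpow_le_rpow_of_nonpos (div_pos hb hc0) h1 h
      _ = c ^ (-p) * b ^ p := by
        rw [Real.div_rpow hb.le hc0.le, Real.rpow_neg hc0.le]; field_simp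
      _ ≤ c * b ^ p := by
        refine mul_le_mul_of_nonneg_right ?_ (Real.rpow_nonneg hb.le p)
        simpa using Real.rpow_le_rpow_of_exponent_le hc (show -p ≤ 1 by linarith)

/-- Cells below `j / 2`. Both kernels are away from their peaks, so `x ≤ s/j` and `y ≤ s/k`; only a
possible pole of `a ^ p` at the origin needs care. -/
lemma mul_mul_le_of_low {p M a s x y Δ : ℝ} {j k q : ℕ} (hj : 2 ≤ j) (hjk : j ≤ k)
    (hp1 : -1 < p) (hp2 : p < 1) (hM : 0 ≤ M) (hqa : (q : ℝ) ≤ a) (haq : a < q + 1) (ha : 0 < a)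
    (hs0 : 0 ≤ s) (hs1 : s ≤ 1) (hsa : s ≤ Real.pi * a)
    (hΔ1 : Δ ≤ M * (a ^ p + (k : ℝ) ^ p))
    (hx0 : 0 ≤ x) (hxs : 2 * |a - j| * x ≤ s)
    (hy0 : 0 ≤ y) (hys : 2 * |a - k| * y ≤ s) (hq : 2 * q + 2 ≤ j) :
    Δ * (x * y) ≤ M * (10 * (((q + 1 : ℕ) : ℝ) ^ p + (k : ℝ) ^ p) / (j * k)) := by
  have hj0 : (2 : ℝ) ≤ j := by exact_mod_cast hj
  have hjk' : (j : ℝ) ≤ k := by exact_mod_cast hjk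
  have hk0 : (0 : ℝ) < k := by linarith
  have hkp : 0 < (k : ℝ) ^ p := Real.rpow_pos_of_pos hk0 p
  have hap : 0 < a ^ p := Real.rpow_pos_of_pos ha p
  have hq' : 2 * (q : ℝ) + 2 ≤ j := by exact_mod_cast hq
  have hxj : x * j ≤ s := by
    rw [abs_of_nonpos (by linarith)] at hxs
    nlinarith
  have hyk : y * k ≤ s := by
    rw [abs_of_nonpos (by linarith)] at hys
    nlinarith
  have hs2 : s ^ 2 ≤ 1 := pow_le_one₀ hs0 hs1
  have hss : s ^ 2 * a ^ p ≤ 10 * ((q + 1 : ℕ) : ℝ) ^ p := by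
    push_cast
    rcases Nat.eq_zero_or_pos q with h0 | h0
    · subst h0
      simp only [Nat.cast_zero, zero_add, Real.one_rpow] at haq ⊢
      -- In the cell touching the origin, the numerator `s ≤ πa` compensates for `a ^ p`, since `p +
      -- 2 > 0`; the `10` dominates `π²`.
      have h1 : s ^ 2 ≤ 10 * a ^ (2 : ℝ) := by
        have hpi : Real.pi ^ 2 ≤ 10 := by nlinarith [Real.pi_lt_d2, Real.pi_pos]
        have h3 := pow_le_pow_left₀ hs0 hsa 2
        rw [mul_pow] at h3
        rw [Real.rpow_two]
        exact h3.trans (mul_le_mul_of_nonneg_right hpi (sq_nonneg a))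
      have h2 : a ^ (2 : ℝ) * a ^ p ≤ 1 := by
        rw [← Real.rpow_add ha]
        exact Real.rpow_le_one ha.le haq.le (by linarith)
      calc s ^ 2 * a ^ p ≤ 10 * a ^ (2 : ℝ) * a ^ p := mul_le_mul_of_nonneg_right h1 hap.le
        _ ≤ 10 * 1 := by rw [mul_assoc]; linarith
    · have h0' : (1 : ℝ) ≤ q := by exact_mod_cast h0
      have h1 := rpow_le_mul_rpow (a := a) (b := q + 1) (c := 2) (p := p) (by linarith)
        (by norm_num) (by linarith) (by linarith) hp1.le hp2.le
      have h2 : 0 < ((q : ℝ) + 1) ^ p := by positivity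
      have h3 : s ^ 2 * a ^ p ≤ 1 * a ^ p := mul_le_mul_of_nonneg_right hs2 hap.le
      linarith
  rw [mul_div_assoc', le_div_iff₀ (by positivity)]
  calc Δ * (x * y) * (j * k) = Δ * ((x * j) * (y * k)) := by ring
    _ ≤ (M * (a ^ p + (k : ℝ) ^ p)) * (s * s) :=
      mul_le_mul hΔ1 (mul_le_mul hxj hyk (by positivity) hs0) (by positivity) (by positivity)
    _ = M * (s ^ 2 * a ^ p + s ^ 2 * (k : ℝ) ^ p) := by ring
    _ ≤ _ := by
      refine mul_le_mul_of_nonneg_left ?_ hM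
      have : s ^ 2 * (k : ℝ) ^ p ≤ 1 * (k : ℝ) ^ p :=
        mul_le_mul_of_nonneg_right hs2 hkp.le
      linarith

/-- Cells from about `j / 2` to `2k`. The oscillation of the density vanishes linearly at `k` and
cancels the peak of the second kernel. Only the decay `1 / (1 + |q - j|)` of the first remains,
which sums to a logarithm. -/
lemma mul_mul_le_of_mid {p M a s x y Δ : ℝ} {j k q : ℕ} (hj : 2 ≤ j) (hjk : j ≤ k)
    (hp1 : -1 < p) (hp2 : p < 1) (hM : 0 ≤ M) (hqa : (q : ℝ) ≤ a) (haq : a < q + 1) (ha : 0 < a)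
    (hs1 : s ≤ 1)
    (hΔ1 : Δ ≤ M * (a ^ p + (k : ℝ) ^ p))
    (hΔ2 : (k : ℝ) / 2 ≤ a → Δ ≤ 6 * M * (k : ℝ) ^ p * |a - k| / k)
    (hx0 : 0 ≤ x) (hx1 : x ≤ 1) (hxs : 2 * |a - j| * x ≤ s)
    (hy0 : 0 ≤ y) (hys : 2 * |a - k| * y ≤ s) (hq : j < 2 * q + 2) :
    Δ * (x * y) ≤ M * (15 * ((j : ℝ) ^ p + (k : ℝ) ^ p) / k * (1 + |(q : ℝ) - j|)⁻¹) := by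
  have hj0 : (2 : ℝ) ≤ j := by exact_mod_cast hj
  have hjk' : (j : ℝ) ≤ k := by exact_mod_cast hjk
  have hk0 : (0 : ℝ) < k := by linarith
  have hjp : 0 < (j : ℝ) ^ p := Real.rpow_pos_of_pos (by linarith) p
  have hkp : 0 < (k : ℝ) ^ p := Real.rpow_pos_of_pos hk0 p
  have hxy : 0 ≤ x * y := mul_nonneg hx0 hy0
  have hq' : (j : ℝ) + 1 ≤ 2 * q + 2 := by exact_mod_cast hq
  have hxq : x ≤ 3 * (1 + |(q : ℝ) - j|)⁻¹ := by
    rw [← div_eq_mul_inv, le_div_iff₀ (by positivity)]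
    have h1 : |(q : ℝ) - j| ≤ |a - j| + 1 := by
      have := abs_sub_le (q : ℝ) a j
      have h2 : |(q : ℝ) - a| ≤ 1 := by rw [abs_le]; constructor <;> linarith
      linarith
    have h2 := mul_le_mul_of_nonneg_left h1 hx0
    linarith
  -- The linear bound persists below `k / 2`: there `|a - k| ≥ k / 2`, so the crude bound `hΔ1` is
  -- already of this form.
  have hΔ3 : Δ ≤ 10 * M * ((j : ℝ) ^ p + (k : ℝ) ^ p) / k * |a - k| := by
    rcases le_or_gt ((k : ℝ) / 2) a with h | h
    · refine (hΔ2 h).trans ?_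
      rw [mul_div_right_comm]
      refine mul_le_mul_of_nonneg_right (div_le_div_of_nonneg_right ?_ hk0.le) (abs_nonneg _)
      have h1 := mul_nonneg hM hjp.le
      have h2 := mul_nonneg hM hkp.le
      linarith
    · have h1 : a ^ p ≤ 4 * ((j : ℝ) ^ p + (k : ℝ) ^ p) := by
        rcases le_total a j with h' | h'
        · have := rpow_le_mul_rpow (a := a) (b := j) (c := 4) (p := p) (by linarith)
            (by norm_num) (by linarith) (by linarith) hp1.le hp2.le
          linarith
        · rcases le_total 0 p with h0 | h0
          · have := Real.rpow_le_rpow ha.le (show a ≤ k by linarith) h0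
            linarith
          · have := Real.rpow_le_rpow_of_nonpos (show (0 : ℝ) < j by linarith) h' h0
            linarith
      have h2 : (k : ℝ) / 2 ≤ |a - k| := by
        rw [abs_of_nonpos (by linarith)]; linarith
      calc Δ ≤ M * (a ^ p + (k : ℝ) ^ p) := hΔ1
        _ ≤ M * (5 * ((j : ℝ) ^ p + (k : ℝ) ^ p)) :=
          mul_le_mul_of_nonneg_left (by linarith) hM
        _ = 10 * M * ((j : ℝ) ^ p + (k : ℝ) ^ p) / k * (k / 2) := by field_simp; ring
        _ ≤ _ := mul_le_mul_of_nonneg_left h2 (by positivity)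
  calc Δ * (x * y) ≤ 10 * M * ((j : ℝ) ^ p + (k : ℝ) ^ p) / k * |a - k| * (x * y) :=
        mul_le_mul_of_nonneg_right hΔ3 hxy
    _ = 5 * M * ((j : ℝ) ^ p + (k : ℝ) ^ p) / k * x * (2 * |a - k| * y) := by ring
    _ ≤ 5 * M * ((j : ℝ) ^ p + (k : ℝ) ^ p) / k * (3 * (1 + |(q : ℝ) - j|)⁻¹) * 1 := by
        refine mul_le_mul (mul_le_mul_of_nonneg_left hxq (by positivity)) (hys.trans hs1)
          (by positivity) (by positivity)
    _ = _ := by ring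

/-- Cells beyond `2k`. The distances from `a` to `j` and to `k` are at least `a / 2`, so both
kernels are at most `1 / a`. -/
lemma mul_mul_le_of_high {p M a s x y Δ : ℝ} {j k q : ℕ} (hj : 2 ≤ j) (hjk : j ≤ k)
    (hp2 : p < 1) (hM : 0 ≤ M) (hqa : (q : ℝ) ≤ a) (ha : 0 < a)
    (hs1 : s ≤ 1) (hΔ1 : Δ ≤ M * (a ^ p + (k : ℝ) ^ p))
    (hx0 : 0 ≤ x) (hxs : 2 * |a - j| * x ≤ s)
    (hy0 : 0 ≤ y) (hys : 2 * |a - k| * y ≤ s) (hq : 2 * k < q) :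
    Δ * (x * y) ≤ M * ((q : ℝ) ^ (p - 2) + (k : ℝ) ^ p * (q : ℝ) ^ (-2 : ℝ)) := by
  have hj0 : (2 : ℝ) ≤ j := by exact_mod_cast hj
  have hjk' : (j : ℝ) ≤ k := by exact_mod_cast hjk
  have hk0 : (0 : ℝ) < k := by linarith
  have hkp : 0 < (k : ℝ) ^ p := Real.rpow_pos_of_pos hk0 p
  have hap : 0 < a ^ p := Real.rpow_pos_of_pos ha p
  have hq' : 2 * (k : ℝ) + 1 ≤ q := by exact_mod_cast hq
  have hq0 : (0 : ℝ) < q := by linarith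
  have hxa : x * a ≤ 1 := by
    rw [abs_of_nonneg (by linarith)] at hxs
    nlinarith
  have hya : y * a ≤ 1 := by
    rw [abs_of_nonneg (by linarith)] at hys
    nlinarith
  have h1 : x * y ≤ a ^ (-2 : ℝ) := by
    rw [Real.rpow_neg ha.le, Real.rpow_two, ← one_div, le_div_iff₀ (by positivity)]
    calc x * y * a ^ 2 = (x * a) * (y * a) := by ring
      _ ≤ 1 := mul_le_one₀ hxa (by positivity) hya
  have h2 : a ^ (-2 : ℝ) ≤ (q : ℝ) ^ (-2 : ℝ) :=
    Real.rpow_le_rpow_of_nonpos hq0 hqa (by norm_num)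
  have h3 : a ^ p * a ^ (-2 : ℝ) ≤ (q : ℝ) ^ (p - 2) := by
    rw [← Real.rpow_add ha, ← sub_eq_add_neg]
    exact Real.rpow_le_rpow_of_nonpos hq0 hqa (by linarith)
  calc Δ * (x * y) ≤ M * (a ^ p + (k : ℝ) ^ p) * a ^ (-2 : ℝ) :=
        mul_le_mul hΔ1 h1 (mul_nonneg hx0 hy0) (by positivity)
    _ = M * (a ^ p * a ^ (-2 : ℝ) + (k : ℝ) ^ p * a ^ (-2 : ℝ)) := by ring
    _ ≤ _ := mul_le_mul_of_nonneg_left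
      (add_le_add h3 (mul_le_mul_of_nonneg_left h2 hkp.le)) hM

/-- A bound, on the `q`-th unit interval, for the product of the two Dirichlet kernels centred at
`j` and `k` with the oscillation of a spectral density `x ↦ x ^ p` around `k`. -/
noncomputable def kernelBound (p : ℝ) (j k q : ℕ) : ℝ :=
  (if 2 * q + 2 ≤ j then 10 * (((q + 1 : ℕ) : ℝ) ^ p + (k : ℝ) ^ p) / (j * k) else 0)
  + (if q ≤ 2 * k then 15 * ((j : ℝ) ^ p + (k : ℝ) ^ p) / k * (1 + |(q : ℝ) - j|)⁻¹ else 0)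
  + (if 2 * k < q then (q : ℝ) ^ (p - 2) + (k : ℝ) ^ p * (q : ℝ) ^ (-2 : ℝ) else 0)

lemma kernelBound_nonneg (p : ℝ) (j k q : ℕ) : 0 ≤ kernelBound p j k q := by
  unfold kernelBound
  refine add_nonneg (add_nonneg ?_ ?_) ?_ <;> split_ifs <;> positivity

lemma mul_mul_le_kernelBound {p M a s x y Δ : ℝ} {j k q : ℕ} (hj : 2 ≤ j) (hjk : j ≤ k)
    (hp1 : -1 < p) (hp2 : p < 1) (hM : 0 ≤ M) (hqa : (q : ℝ) ≤ a) (haq : a < q + 1) (ha : 0 < a)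
    (hs0 : 0 ≤ s) (hs1 : s ≤ 1) (hsa : s ≤ Real.pi * a)
    (hΔ1 : Δ ≤ M * (a ^ p + (k : ℝ) ^ p))
    (hΔ2 : (k : ℝ) / 2 ≤ a → Δ ≤ 6 * M * (k : ℝ) ^ p * |a - k| / k)
    (hx0 : 0 ≤ x) (hx1 : x ≤ 1) (hxs : 2 * |a - j| * x ≤ s)
    (hy0 : 0 ≤ y) (hys : 2 * |a - k| * y ≤ s) :
    Δ * (x * y) ≤ M * kernelBound p j k q := by
  have hA0 : 0 ≤ (if 2 * q + 2 ≤ j then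
      10 * (((q + 1 : ℕ) : ℝ) ^ p + (k : ℝ) ^ p) / (j * k) else 0) := by
    split_ifs <;> positivity
  have hB0 : 0 ≤ (if q ≤ 2 * k then
      15 * ((j : ℝ) ^ p + (k : ℝ) ^ p) / k * (1 + |(q : ℝ) - j|)⁻¹ else 0) := by
    split_ifs <;> positivity
  have hC0 : 0 ≤ (if 2 * k < q then
      (q : ℝ) ^ (p - 2) + (k : ℝ) ^ p * (q : ℝ) ^ (-2 : ℝ) else 0) := by
    split_ifs <;> positivity
  unfold kernelBound
  rcases le_or_gt (2 * q + 2) j with hq | hq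
  · refine (mul_mul_le_of_low hj hjk hp1 hp2 hM hqa haq ha hs0 hs1 hsa hΔ1 hx0 hxs hy0 hys
      hq).trans (mul_le_mul_of_nonneg_left ?_ hM)
    rw [if_pos hq] at hA0 ⊢
    linarith
  rcases le_or_gt q (2 * k) with hq2 | hq2
  · refine (mul_mul_le_of_mid hj hjk hp1 hp2 hM hqa haq ha hs1 hΔ1 hΔ2 hx0 hx1 hxs hy0 hys
      hq).trans (mul_le_mul_of_nonneg_left ?_ hM)
    rw [if_pos hq2] at hB0 ⊢
    linarith
  · refine (mul_mul_le_of_high hj hjk hp2 hM hqa ha hs1 hΔ1 hx0 hxs hy0 hys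
      hq2).trans (mul_le_mul_of_nonneg_left ?_ hM)
    rw [if_pos hq2] at hC0 ⊢
    linarith

/-- The constant blows up as `p → -1`, and that of `sum_rpow_sub_two_le` as `p → 1`. This is where
`d` has to stay away from `±1/2`. -/
lemma sum_rpow_le {p : ℝ} (hp1 : -1 < p) {N : ℕ} (hN : 1 ≤ N) :
    ∑ q ∈ Finset.range N, ((q + 1 : ℕ) : ℝ) ^ p ≤ (1 + 1 / (p + 1)) * (N : ℝ) ^ (p + 1) := by
  have hN0 : (1 : ℝ) ≤ N := by exact_mod_cast hN
  have hp0 : 0 < p + 1 := by linarith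
  have hNp : 1 ≤ (N : ℝ) ^ (p + 1) := Real.one_le_rpow hN0 hp0.le
  rcases le_total 0 p with h | h
  · calc ∑ q ∈ Finset.range N, ((q + 1 : ℕ) : ℝ) ^ p ≤ ∑ q ∈ Finset.range N, (N : ℝ) ^ p := by
          refine Finset.sum_le_sum fun q hq => Real.rpow_le_rpow (by positivity) ?_ h
          exact_mod_cast Finset.mem_range.1 hq
      _ = 1 * (N : ℝ) ^ (p + 1) := by
          rw [Finset.sum_const, Finset.card_range, nsmul_eq_mul, Real.rpow_add (by linarith),
            Real.rpow_one]; ring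
      _ ≤ _ := by
          refine mul_le_mul_of_nonneg_right ?_ (by positivity)
          have : 0 ≤ 1 / (p + 1) := by positivity
          linarith
  · obtain ⟨m, rfl⟩ := Nat.exists_eq_add_of_le hN
    have hanti : AntitoneOn (fun x : ℝ => x ^ p) (Set.Icc 1 (1 + (m : ℝ))) := by
      intro x hx y _ hxy
      exact Real.rpow_le_rpow_of_nonpos (by linarith [hx.1]) hxy h
    have h1 := hanti.sum_le_integral
    rw [integral_rpow (Or.inl hp1), Real.one_rpow] at h1
    rw [add_comm 1 m, Finset.sum_range_succ']
    have h2 : ∑ q ∈ Finset.range m, ((q + 1 + 1 : ℕ) : ℝ) ^ p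
        = ∑ i ∈ Finset.range m, (1 + ((i + 1 : ℕ) : ℝ)) ^ p :=
      Finset.sum_congr rfl fun i _ => by push_cast; ring_nf
    rw [h2]
    push_cast at h1 hNp ⊢
    rw [add_comm (m : ℝ) 1, add_mul, one_mul, one_div_mul_eq_div]
    simp only [Real.one_rpow]
    have h3 : ((1 + (m : ℝ)) ^ (p + 1) - 1) / (p + 1) ≤ (1 + (m : ℝ)) ^ (p + 1) / (p + 1) :=
      div_le_div_of_nonneg_right (by linarith) hp0.le
    linarith

lemma sum_rpow_sub_two_le {p : ℝ} (hp2 : p < 1) {k : ℕ} (hk : 1 ≤ k) (n : ℕ) :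
    ∑ q ∈ Finset.range n, (if 2 * k < q then (q : ℝ) ^ (p - 2) else 0)
      ≤ 1 / (1 - p) * (k : ℝ) ^ (p - 1) := by
  have hk0 : (1 : ℝ) ≤ k := by exact_mod_cast hk
  have hp0 : 0 < 1 - p := by linarith
  have hpos : 0 ≤ 1 / (1 - p) * (k : ℝ) ^ (p - 1) := by positivity
  have hset : Finset.filter (fun q => 2 * k < q) (Finset.range n) = Finset.Ico (2 * k + 1) n := by
    ext q; simp only [Finset.mem_filter, Finset.mem_range, Finset.mem_Ico]; omega
  rw [← Finset.sum_filter, hset]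
  rcases le_or_gt n (2 * k + 1) with hn | hn
  · rw [Finset.Ico_eq_empty_of_le hn, Finset.sum_empty]
    exact hpos
  · obtain ⟨m, rfl⟩ : ∃ m, n = m + 1 := ⟨n - 1, by omega⟩
    have hm : 2 * k ≤ m := by omega
    have hm' : 2 * (k : ℝ) ≤ m := by exact_mod_cast hm
    have hanti : AntitoneOn (fun x : ℝ => x ^ (p - 2)) (Set.Icc ((2 * k : ℕ) : ℝ) m) := by
      intro x hx y _ hxy
      have := hx.1
      push_cast at this
      exact Real.rpow_le_rpow_of_nonpos (by linarith) hxy (by linarith)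
    have h1 := hanti.sum_le_integral_Ico hm
    have h0 : (0 : ℝ) ∉ Set.uIcc ((2 * k : ℕ) : ℝ) m := by
      push_cast
      rw [Set.uIcc_of_le hm']
      intro h
      linarith [h.1]
    rw [integral_rpow (Or.inr ⟨by linarith, h0⟩)] at h1
    rw [← Finset.sum_Ico_add' (fun q : ℕ => (q : ℝ) ^ (p - 2)) (2 * k) m 1]
    refine h1.trans ?_
    push_cast
    rw [show p - 2 + 1 = -(1 - p) by ring, div_neg, ← neg_div, neg_sub,
      show p - 1 = -(1 - p) by ring, one_div_mul_eq_div]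
    refine div_le_div_of_nonneg_right ?_ hp0.le
    have h2 : (2 * (k : ℝ)) ^ (-(1 - p)) ≤ (k : ℝ) ^ (-(1 - p)) :=
      Real.rpow_le_rpow_of_nonpos (by linarith) (by linarith) (by linarith)
    have h3 : 0 ≤ (m : ℝ) ^ (-(1 - p)) := by positivity
    linarith

lemma one_le_log_natCast {k : ℕ} (hk : 3 ≤ k) : 1 ≤ Real.log k := by
  have hk0 : (3 : ℝ) ≤ k := by exact_mod_cast hk
  rw [Real.le_log_iff_exp_le (by linarith)]
  linarith [Real.exp_one_lt_d9]

/-- Split at `j` into two harmonic sums. For `k ≥ 3` one has `2k + 1 ≤ k²` and `1 ≤ log k`, so each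
is at most `1 + 2 log k ≤ 3 log k`. -/
lemma sum_inv_one_add_abs_le {j k : ℕ} (hjk : j ≤ k) (hk : 3 ≤ k) :
    ∑ q ∈ Finset.range (2 * k + 1), (1 + |(q : ℝ) - j|)⁻¹ ≤ 6 * Real.log k := by
  have hk0 : (3 : ℝ) ≤ k := by exact_mod_cast hk
  have hlog := one_le_log_natCast hk
  have hharm : ∀ m, m ≤ 2 * k + 1 →
      ∑ i ∈ Finset.range m, (1 + (i : ℝ))⁻¹ ≤ 3 * Real.log k := by
    intro m hm
    have h1 : ∑ i ∈ Finset.range m, (1 + (i : ℝ))⁻¹ = (harmonic m : ℝ) := by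
      rw [harmonic]
      push_cast
      exact Finset.sum_congr rfl fun i _ => by rw [add_comm]
    rw [h1]
    refine (harmonic_le_one_add_log m).trans ?_
    have hm' : (m : ℝ) ≤ (k : ℝ) ^ 2 := by
      have : (m : ℝ) ≤ 2 * k + 1 := by exact_mod_cast hm
      nlinarith
    rcases Nat.eq_zero_or_pos m with h0 | h0
    · subst h0
      simp only [Nat.cast_zero, Real.log_zero]
      linarith
    · have h2 := Real.log_le_log (by exact_mod_cast h0) hm'
      rw [Real.log_pow] at h2
      push_cast at h2
      linarith
  rw [Finset.range_eq_Ico, ← Finset.sum_Ico_consecutive _ (Nat.zero_le j) (by omega : j ≤ 2 * k + 1),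
    ← Finset.range_eq_Ico, Finset.sum_Ico_eq_sum_range]
  have e1 : ∑ q ∈ Finset.range j, (1 + |(q : ℝ) - j|)⁻¹
      ≤ ∑ i ∈ Finset.range j, (1 + (i : ℝ))⁻¹ := by
    rw [← Finset.sum_range_reflect]
    refine Finset.sum_le_sum fun i hi => ?_
    have hi' := Finset.mem_range.1 hi
    have hcast : ((j - 1 - i : ℕ) : ℝ) = (j : ℝ) - 1 - i := by
      rw [Nat.cast_sub (by omega), Nat.cast_sub (by omega)]; simp
    rw [hcast, abs_of_nonpos (by have : (0 : ℝ) ≤ i := by positivity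
                                 linarith)]
    exact inv_anti₀ (by positivity) (by linarith)
  have e2 : ∑ i ∈ Finset.range (2 * k + 1 - j), (1 + |((j + i : ℕ) : ℝ) - j|)⁻¹
      = ∑ i ∈ Finset.range (2 * k + 1 - j), (1 + (i : ℝ))⁻¹ := by
    refine Finset.sum_congr rfl fun i _ => ?_
    push_cast
    rw [add_sub_cancel_left, abs_of_nonneg (by positivity)]
  rw [e2]
  have := hharm j (by omega)
  have := hharm (2 * k + 1 - j) (by omega)
  linarith

/-- The total mass of the kernel bound. -/
lemma sum_kernelBound_le {p η : ℝ} (hη : 0 < η) (hη1 : η ≤ 1) (hp1 : η - 1 ≤ p) (hp2 : p ≤ 1 - η)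
    {j k : ℕ} (hj : 2 ≤ j) (hjk : j ≤ k) (hk : 3 ≤ k) (n : ℕ) :
    ∑ q ∈ Finset.range n, kernelBound p j k q
      ≤ 122 / η * (((j : ℝ) ^ p + (k : ℝ) ^ p) * Real.log k / k) := by
  have hj0 : (2 : ℝ) ≤ j := by exact_mod_cast hj
  have hjk' : (j : ℝ) ≤ k := by exact_mod_cast hjk
  have hk0 : (0 : ℝ) < k := by linarith
  have hjp : 0 < (j : ℝ) ^ p := Real.rpow_pos_of_pos (by linarith) p
  have hkp : 0 < (k : ℝ) ^ p := Real.rpow_pos_of_pos hk0 p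
  have hlog := one_le_log_natCast hk
  have hη' : 1 ≤ 1 / η := by rw [le_div_iff₀ hη]; linarith
  set R := ((j : ℝ) ^ p + (k : ℝ) ^ p) / k with hR
  have hR0 : 0 < R := by positivity
  have hA : ∑ q ∈ Finset.range n, (if 2 * q + 2 ≤ j then
      10 * (((q + 1 : ℕ) : ℝ) ^ p + (k : ℝ) ^ p) / (j * k) else 0) ≤ 30 / η * R := by
    have hsub : Finset.filter (fun q => 2 * q + 2 ≤ j) (Finset.range n) ⊆ Finset.range j := by
      intro q; simp only [Finset.mem_filter, Finset.mem_range]; omega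
    rw [← Finset.sum_filter]
    refine (Finset.sum_le_sum_of_subset_of_nonneg hsub fun q _ _ => by positivity).trans ?_
    rw [← Finset.sum_div, ← Finset.mul_sum, Finset.sum_add_distrib, Finset.sum_const,
      Finset.card_range, nsmul_eq_mul, div_le_iff₀ (by positivity)]
    have h1 := sum_rpow_le (p := p) (by linarith) (show 1 ≤ j by omega)
    have h2 : (1 + 1 / (p + 1)) * (j : ℝ) ^ (p + 1) ≤ 2 / η * (j : ℝ) ^ (p + 1) := by
      refine mul_le_mul_of_nonneg_right ?_ (by positivity)
      have : 1 / (p + 1) ≤ 1 / η := one_div_le_one_div_of_le hη (by linarith)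
      have h3 : 2 / η = 1 / η + 1 / η := by ring
      linarith
    have h4 : (j : ℝ) ^ (p + 1) = j * (j : ℝ) ^ p := by
      rw [Real.rpow_add (by linarith), Real.rpow_one, mul_comm]
    rw [h4] at h1 h2
    have h5 : 30 / η * R * (j * k) = 30 * (1 / η) * (j * (j : ℝ) ^ p + j * (k : ℝ) ^ p) := by
      rw [hR]; field_simp
    have h6 : (j : ℝ) * (k : ℝ) ^ p ≤ 1 / η * (j * (k : ℝ) ^ p) :=
      le_mul_of_one_le_left (by positivity) hη'
    have h7 : 2 / η * ((j : ℝ) * (j : ℝ) ^ p) = 2 * (1 / η * (j * (j : ℝ) ^ p)) := by ring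
    have h8 : 0 ≤ 1 / η * ((j : ℝ) * (j : ℝ) ^ p) := by positivity
    have h9 : 0 ≤ 1 / η * ((j : ℝ) * (k : ℝ) ^ p) := by positivity
    rw [h5]
    linarith
  have hB : ∑ q ∈ Finset.range n, (if q ≤ 2 * k then
      15 * ((j : ℝ) ^ p + (k : ℝ) ^ p) / k * (1 + |(q : ℝ) - j|)⁻¹ else 0)
      ≤ 90 * (R * Real.log k) := by
    have hsub : Finset.filter (fun q => q ≤ 2 * k) (Finset.range n) ⊆ Finset.range (2 * k + 1) := by
      intro q; simp only [Finset.mem_filter, Finset.mem_range]; omega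
    rw [← Finset.sum_filter]
    refine (Finset.sum_le_sum_of_subset_of_nonneg hsub fun q _ _ => by positivity).trans ?_
    rw [← Finset.mul_sum]
    calc 15 * ((j : ℝ) ^ p + (k : ℝ) ^ p) / k
          * ∑ q ∈ Finset.range (2 * k + 1), (1 + |(q : ℝ) - j|)⁻¹
        ≤ 15 * ((j : ℝ) ^ p + (k : ℝ) ^ p) / k * (6 * Real.log k) :=
          mul_le_mul_of_nonneg_left (sum_inv_one_add_abs_le hjk hk) (by positivity)
      _ = 90 * (R * Real.log k) := by rw [hR]; ring
  have hC : ∑ q ∈ Finset.range n, (if 2 * k < q then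
      (q : ℝ) ^ (p - 2) + (k : ℝ) ^ p * (q : ℝ) ^ (-2 : ℝ) else 0) ≤ 2 / η * R := by
    have h1 := sum_rpow_sub_two_le (p := p) (by linarith) (show 1 ≤ k by omega) n
    have h2 := sum_rpow_sub_two_le (p := 0) (by norm_num) (show 1 ≤ k by omega) n
    norm_num at h2
    have h3 : ∀ q : ℕ, (if 2 * k < q then (q : ℝ) ^ (p - 2) + (k : ℝ) ^ p * (q : ℝ) ^ (-2 : ℝ) else 0)
        = (if 2 * k < q then (q : ℝ) ^ (p - 2) else 0)
          + (k : ℝ) ^ p * (if 2 * k < q then (q : ℝ) ^ (-2 : ℝ) else 0) := by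
      intro q; split_ifs <;> ring
    rw [Finset.sum_congr rfl fun q _ => h3 q, Finset.sum_add_distrib, ← Finset.mul_sum]
    have h4 : 1 / (1 - p) * (k : ℝ) ^ (p - 1) ≤ 1 / η * ((k : ℝ) ^ p / k) := by
      rw [Real.rpow_sub_one hk0.ne']
      exact mul_le_mul_of_nonneg_right (one_div_le_one_div_of_le hη (by linarith)) (by positivity)
    have h5 := mul_le_mul_of_nonneg_left h2 hkp.le
    have h6 : (k : ℝ) ^ p / k ≤ R := div_le_div_of_nonneg_right (by linarith) hk0.le
    have h7 : 1 / η * ((k : ℝ) ^ p / k) ≤ 1 / η * R :=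
      mul_le_mul_of_nonneg_left h6 (by positivity)
    have h8 : (k : ℝ) ^ p * (k : ℝ) ^ (-1 : ℝ) ≤ 1 / η * R := by
      rw [Real.rpow_neg_one, ← div_eq_mul_inv]
      exact h6.trans (le_mul_of_one_le_left hR0.le hη')
    have h9 : 2 / η * R = 1 / η * R + 1 / η * R := by ring
    rw [h9]
    norm_num at h1 h4 h5 h7 h8 ⊢
    linarith
  simp only [kernelBound, Finset.sum_add_distrib]
  have h1 : R ≤ R * Real.log k := le_mul_of_one_le_right hR0.le hlog
  have h2 : 1 / η * R ≤ 1 / η * (R * Real.log k) := mul_le_mul_of_nonneg_left h1 (by positivity)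
  have h3 : R * Real.log k ≤ 1 / η * (R * Real.log k) :=
    le_mul_of_one_le_left (by positivity) hη'
  have h4 : 122 / η * (((j : ℝ) ^ p + (k : ℝ) ^ p) * Real.log k / k)
      = 122 * (1 / η * (R * Real.log k)) := by rw [hR]; ring
  have h5 : 30 / η * R = 30 * (1 / η * R) := by ring
  have h6 : 2 / η * R = 2 * (1 / η * R) := by ring
  rw [h4]
  rw [h5] at hA
  rw [h6] at hC
  linarith

end KernelSums

/-! ### Trigonometric polynomials and the spectral form of covariances. -/

section TrigPoly

variable {κ : Type*} [Fintype κ]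

/-- The trigonometric polynomial with frequencies `τ` and coefficients `u`. -/
noncomputable def trigPoly (τ : κ → ℤ) (u : κ → ℂ) (x : ℝ) : ℂ :=
  ∑ a, u a * Complex.exp (Complex.I * ((τ a : ℝ) * x : ℝ))

@[fun_prop]
lemma continuous_trigPoly (τ : κ → ℤ) (u : κ → ℂ) : Continuous (trigPoly τ u) := by
  unfold trigPoly
  fun_prop

lemma integral_exp_int_mul (m : ℤ) (y : ℝ) :
    ∫ x in y..(y + 2 * Real.pi), Complex.exp (Complex.I * ((m : ℝ) * x : ℝ))
      = if m = 0 then (2 * Real.pi : ℂ) else 0 := by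
  split_ifs with hm
  · simp [hm]
  · have hc : Complex.I * m ≠ 0 := mul_ne_zero Complex.I_ne_zero (by exact_mod_cast hm)
    have h := integral_exp_mul_complex (a := y) (b := y + 2 * Real.pi) hc
    have h1 : ∀ x : ℝ, Complex.I * ((m : ℝ) * x : ℝ) = Complex.I * m * x := by
      intro x; push_cast; ring
    simp_rw [h1]
    rw [h]
    have h2 : Complex.I * m * ((y + 2 * Real.pi : ℝ) : ℂ)
        = Complex.I * m * y + m * (2 * Real.pi * Complex.I) := by push_cast; ring
    rw [h2, Complex.exp_periodic.int_mul m, sub_self, zero_div]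

lemma trigPoly_mul_conj (τ : κ → ℤ) (u v : κ → ℂ) (x : ℝ) :
    trigPoly τ u x * (starRingEnd ℂ) (trigPoly τ v x)
      = ∑ a, ∑ b, u a * (starRingEnd ℂ) (v b)
        * Complex.exp (Complex.I * (((τ a - τ b : ℤ) : ℝ) * x : ℝ)) := by
  unfold trigPoly
  rw [map_sum, Finset.sum_mul_sum]
  refine Finset.sum_congr rfl fun a _ => Finset.sum_congr rfl fun b _ => ?_
  rw [map_mul, ← Complex.exp_conj, map_mul, Complex.conj_I, Complex.conj_ofReal, mul_mul_mul_comm,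
    ← Complex.exp_add]
  congr 2
  push_cast
  ring

lemma integral_trigPoly_mul_conj {τ : κ → ℤ} (hτ : Function.Injective τ) (u v : κ → ℂ) (y : ℝ) :
    ∫ x in y..(y + 2 * Real.pi), trigPoly τ u x * (starRingEnd ℂ) (trigPoly τ v x)
      = 2 * Real.pi * ∑ a, u a * (starRingEnd ℂ) (v a) := by
  classical
  simp_rw [trigPoly_mul_conj]
  rw [intervalIntegral.integral_finsetSum fun a _ => Continuous.intervalIntegrable (by fun_prop) _ _,
    Finset.mul_sum]
  refine Finset.sum_congr rfl fun a _ => ?_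
  rw [intervalIntegral.integral_finsetSum fun b _ => Continuous.intervalIntegrable (by fun_prop) _ _]
  simp_rw [intervalIntegral.integral_const_mul, integral_exp_int_mul, sub_eq_zero, hτ.eq_iff]
  simp [mul_comm]

lemma integral_norm_trigPoly_sq {τ : κ → ℤ} (hτ : Function.Injective τ) (u : κ → ℂ) (y : ℝ) :
    ∫ x in y..(y + 2 * Real.pi), ‖trigPoly τ u x‖ ^ 2 = 2 * Real.pi * ∑ a, ‖u a‖ ^ 2 := by
  have h := integral_trigPoly_mul_conj hτ u u y
  simp_rw [Complex.mul_conj, Complex.normSq_eq_norm_sq] at h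
  rw [intervalIntegral.integral_ofReal] at h
  exact_mod_cast h

lemma norm_trigPoly_neg (τ : κ → ℤ) (u : κ → ℝ) (x : ℝ) :
    ‖trigPoly τ (fun a => (u a : ℂ)) (-x)‖ = ‖trigPoly τ (fun a => (u a : ℂ)) x‖ := by
  rw [← Complex.norm_conj]
  congr 1
  unfold trigPoly
  rw [map_sum]
  refine Finset.sum_congr rfl fun a _ => ?_
  rw [map_mul, ← Complex.exp_conj, map_mul, Complex.conj_I, Complex.conj_ofReal,
    Complex.conj_ofReal]
  congr 2
  push_cast
  ring

variable {Ω : Type*} [MeasurableSpace Ω] {P : Measure Ω} {X : ℤ → Ω → ℝ} {f : ℝ → ℝ}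

lemma HasSpectralDensity.intervalIntegrable (h : HasSpectralDensity P X f) :
    IntervalIntegrable f volume (-Real.pi) Real.pi := by
  rw [intervalIntegrable_iff_integrableOn_Icc_of_le (by linarith [Real.pi_pos])]
  exact h.integrableOn

/-- The spectral representation of the autocovariances extended bilinearly: linear forms in the
process become trigonometric polynomials integrated against `f`. -/
lemma HasSpectralDensity.covariance_sum [IsProbabilityMeasure P] (h : HasSpectralDensity P X f)
    (τ : κ → ℤ) (u v : κ → ℝ) :
    ((cov[fun ω => ∑ a, u a * X (τ a) ω, fun ω => ∑ a, v a * X (τ a) ω; P] : ℝ) : ℂ)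
      = ∫ x in (-Real.pi)..Real.pi, trigPoly τ (fun a => (u a : ℂ)) x
          * (starRingEnd ℂ) (trigPoly τ (fun a => (v a : ℂ)) x) * (f x : ℂ) := by
  have hf : IntervalIntegrable (fun x => (f x : ℂ)) volume (-Real.pi) Real.pi :=
    ⟨h.intervalIntegrable.1.ofReal, h.intervalIntegrable.2.ofReal⟩
  have hi : ∀ a b, IntervalIntegrable (fun x : ℝ => (u a : ℂ) * (starRingEnd ℂ) (v b : ℂ)
        * Complex.exp (Complex.I * (((τ a - τ b : ℤ) : ℝ) * x : ℝ)) * (f x : ℂ))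
      volume (-Real.pi) Real.pi := fun a b =>
    hf.continuousOn_mul (Continuous.continuousOn (by fun_prop))
  rw [covariance_sum_mul_sum_mul (fun a => h.memLp (τ a)) (fun a => h.memLp (τ a))]
  simp_rw [trigPoly_mul_conj, Finset.sum_mul]
  rw [intervalIntegral.integral_finsetSum fun a _ => by
    simpa only [Finset.sum_fn] using IntervalIntegrable.sum Finset.univ fun b _ => hi a b]
  rw [Complex.ofReal_sum]
  refine Finset.sum_congr rfl fun a _ => ?_
  rw [intervalIntegral.integral_finsetSum fun b _ => hi a b, Complex.ofReal_sum]
  refine Finset.sum_congr rfl fun b _ => ?_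
  rw [Complex.ofReal_mul, Complex.ofReal_mul, h.cov_eq, Complex.conj_ofReal, ← intervalIntegral.integral_const_mul]
  congr 1
  ext x
  ring

/-- Replacing the spectral density by a constant. -/
lemma HasSpectralDensity.abs_covariance_sum_sub_le [IsProbabilityMeasure P]
    (h : HasSpectralDensity P X f) {τ : κ → ℤ} (hτ : Function.Injective τ) (u v : κ → ℝ) (c : ℝ) :
    |cov[fun ω => ∑ a, u a * X (τ a) ω, fun ω => ∑ a, v a * X (τ a) ω; P]
        - 2 * Real.pi * c * ∑ a, u a * v a|
      ≤ ∫ x in (-Real.pi)..Real.pi, |f x - c| * (‖trigPoly τ (fun a => (u a : ℂ)) x‖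
          * ‖trigPoly τ (fun a => (v a : ℂ)) x‖) := by
  have hπ : -Real.pi ≤ Real.pi := by linarith [Real.pi_pos]
  set F : ℝ → ℂ := fun x => trigPoly τ (fun a => (u a : ℂ)) x
    * (starRingEnd ℂ) (trigPoly τ (fun a => (v a : ℂ)) x) with hF
  have hFc : Continuous F := by
    rw [hF]
    exact (continuous_trigPoly _ _).mul (Complex.continuous_conj.comp (continuous_trigPoly _ _))
  have hf : IntervalIntegrable (fun x => (f x : ℂ)) volume (-Real.pi) Real.pi :=
    ⟨h.intervalIntegrable.1.ofReal, h.intervalIntegrable.2.ofReal⟩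
  have h1 := h.covariance_sum τ u v
  -- By orthogonality over a full period, a constant density `c` contributes exactly `2πc ∑ u v`;
  -- only `f - c` is left to estimate.
  have h2 := integral_trigPoly_mul_conj hτ (fun a => (u a : ℂ)) (fun a => (v a : ℂ)) (-Real.pi)
  rw [show -Real.pi + 2 * Real.pi = Real.pi by ring] at h2
  rw [← Real.norm_eq_abs, ← Complex.norm_real]
  have h3 : ((cov[fun ω => ∑ a, u a * X (τ a) ω, fun ω => ∑ a, v a * X (τ a) ω; P]
        - 2 * Real.pi * c * ∑ a, u a * v a : ℝ) : ℂ)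
      = ∫ x in (-Real.pi)..Real.pi, F x * ((f x - c : ℝ) : ℂ) := by
    have h4 : ∀ x, F x * ((f x - c : ℝ) : ℂ) = F x * (f x : ℂ) - c * F x := by
      intro x; push_cast; ring
    simp_rw [h4]
    rw [intervalIntegral.integral_sub (hf.continuousOn_mul hFc.continuousOn)
      ((hFc.const_mul _).intervalIntegrable _ _), intervalIntegral.integral_const_mul, h2]
    push_cast
    rw [h1]
    simp only [Complex.conj_ofReal, hF]
    ring
  rw [h3]
  refine (intervalIntegral.norm_integral_le_integral_norm hπ).trans (le_of_eq ?_)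
  congr 1
  ext x
  rw [norm_mul, Complex.norm_real, Real.norm_eq_abs, hF, norm_mul, Complex.norm_conj]
  ring

end TrigPoly

/-! ### The Dirichlet kernel. -/

section Dirichlet

/-- The Dirichlet kernel `∑_{t = 1}^n e^{itx}`. -/
noncomputable def dirichletSum (n : ℕ) (x : ℝ) : ℂ :=
  ∑ t : Fin n, Complex.exp (Complex.I * (((t : ℕ) + 1 : ℝ) * x : ℝ))

lemma norm_dirichletSum_le (n : ℕ) (x : ℝ) : ‖dirichletSum n x‖ ≤ n := by
  unfold dirichletSum
  refine (norm_sum_le _ _).trans ?_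
  simp_rw [Complex.norm_exp_I_mul_ofReal]
  simp

lemma exp_sub_one_mul_dirichletSum (n : ℕ) (x : ℝ) :
    (Complex.exp (Complex.I * x) - 1) * dirichletSum n x
      = Complex.exp (Complex.I * x) * (Complex.exp (Complex.I * (n * x : ℝ)) - 1) := by
  unfold dirichletSum
  have h : ∀ t : Fin n, Complex.exp (Complex.I * (((t : ℕ) + 1 : ℝ) * x : ℝ))
      = Complex.exp (Complex.I * x) * Complex.exp (Complex.I * x) ^ (t : ℕ) := by
    intro t
    rw [← Complex.exp_nat_mul, ← Complex.exp_add]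
    congr 1
    push_cast
    ring
  simp_rw [h]
  rw [← Finset.mul_sum, mul_left_comm, Fin.sum_univ_eq_sum_range (fun t =>
    Complex.exp (Complex.I * x) ^ t), mul_geom_sum, ← Complex.exp_nat_mul]
  congr 3
  push_cast
  ring

/-- The product form remains true where `sin (x / 2) = 0`. -/
lemma norm_dirichletSum_mul (n : ℕ) (x : ℝ) :
    |Real.sin (x / 2)| * ‖dirichletSum n x‖ = |Real.sin (n * x / 2)| := by
  have h := congrArg norm (exp_sub_one_mul_dirichletSum n x)
  rw [norm_mul, norm_mul, Complex.norm_exp_I_mul_ofReal, one_mul,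
    Complex.norm_exp_I_mul_ofReal_sub_one, Complex.norm_exp_I_mul_ofReal_sub_one, norm_mul,
    norm_mul] at h
  simp only [Real.norm_eq_abs, abs_two] at h
  linarith

lemma dirichletSum_fourierFreq_eq_zero {n m : ℕ} (hm : 1 ≤ m) (hmn : m < n) :
    dirichletSum n (fourierFreq n m) = 0 := by
  have hn : (0 : ℝ) < n := by exact_mod_cast (by omega : 0 < n)
  have h := norm_dirichletSum_mul n (fourierFreq n m)
  have h1 : n * fourierFreq n m / 2 = m * Real.pi := by unfold fourierFreq; field_simp
  have h2 : 0 < Real.sin (fourierFreq n m / 2) := by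
    have hm0 : (0 : ℝ) < m := by exact_mod_cast hm
    have hmn' : (m : ℝ) < n := by exact_mod_cast hmn
    have h3 : fourierFreq n m / 2 = Real.pi * (m / n) := by unfold fourierFreq; ring
    rw [h3]
    refine Real.sin_pos_of_pos_of_lt_pi (by positivity) ?_
    have : (m : ℝ) / n < 1 := by rwa [div_lt_one hn]
    nlinarith [Real.pi_pos]
  rw [h1, Real.sin_nat_mul_pi, abs_zero, mul_eq_zero] at h
  rcases h with h | h
  · exact absurd (abs_eq_zero.mp h) h2.ne'
  · exact norm_eq_zero.mp h

/-- The larger of the two Dirichlet kernels centred at `±ω_j`, normalised. -/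
noncomputable def kernelMax (n j : ℕ) (x : ℝ) : ℝ :=
  max ‖dirichletSum n (x + fourierFreq n j)‖ ‖dirichletSum n (x - fourierFreq n j)‖ / n

lemma kernelMax_nonneg (n j : ℕ) (x : ℝ) : 0 ≤ kernelMax n j x := by
  unfold kernelMax; positivity

lemma kernelMax_le_one (n j : ℕ) (x : ℝ) : kernelMax n j x ≤ 1 :=
  div_le_one_of_le₀ (max_le (norm_dirichletSum_le _ _) (norm_dirichletSum_le _ _)) (by positivity)

/-- Here `a` is the frequency in units of `2π/n`. At `x ± ω_j` the numerator of the kernel is `|sin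
(πa)|`, since the shift is a multiple of `π`. Jordan's inequality bounds the denominator at `x -
ω_j`; the one at `x + ω_j` is no smaller, as both half-angles lie in `[0, π/2]`. -/
lemma abs_sub_mul_kernelMax_le {n j : ℕ} (hj : 2 * j ≤ n) (hn : 0 < n) {x a : ℝ}
    (hx0 : 0 ≤ x) (hx : x ≤ Real.pi) (ha : a = n * x / (2 * Real.pi)) :
    2 * |a - j| * kernelMax n j x ≤ |Real.sin (Real.pi * a)| := by
  have hn' : (0 : ℝ) < n := by exact_mod_cast hn
  have hπ := Real.pi_pos
  have hj' : 2 * (j : ℝ) ≤ n := by exact_mod_cast hj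
  set ω := fourierFreq n j with hω
  have hω0 : 0 ≤ ω := by rw [hω]; unfold fourierFreq; positivity
  have hωπ : ω ≤ Real.pi := by
    rw [hω]; unfold fourierFreq; rw [div_le_iff₀ hn']; nlinarith
  have hxa : x = 2 * Real.pi * a / n := by rw [ha]; field_simp
  have hsub : |x - ω| = 2 * Real.pi * |a - j| / n := by
    rw [hxa, hω]; unfold fourierFreq
    rw [← sub_div, ← mul_sub, abs_div, abs_mul, abs_of_pos hn', abs_of_pos (by positivity)]
  have hlow : 2 * |a - j| / n ≤ |Real.sin ((x - ω) / 2)| := by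
    have h := Real.mul_abs_le_abs_sin (x := (x - ω) / 2) (by
      rw [abs_div, abs_two, div_le_div_iff_of_pos_right two_pos, abs_le]
      constructor <;> linarith)
    refine le_trans (le_of_eq ?_) h
    rw [abs_div, abs_two, hsub]
    field_simp
  have hlow' : 2 * |a - j| / n ≤ |Real.sin ((x + ω) / 2)| := by
    refine hlow.trans (sq_le_sq.mp ?_)
    have h1 := Real.sin_nonneg_of_nonneg_of_le_pi (x := x / 2) (by linarith) (by linarith)
    have h2 := Real.sin_nonneg_of_nonneg_of_le_pi (x := ω / 2) (by linarith) (by linarith)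
    have h3 := Real.cos_nonneg_of_mem_Icc (x := x / 2) ⟨by linarith, by linarith⟩
    have h4 := Real.cos_nonneg_of_mem_Icc (x := ω / 2) ⟨by linarith, by linarith⟩
    rw [sub_div, add_div, Real.sin_sub, Real.sin_add]
    have := mul_nonneg (mul_nonneg h1 h4) (mul_nonneg h3 h2)
    nlinarith
  have hs : ∀ y, (∃ m : ℤ, n * y / 2 = Real.pi * a + m * Real.pi) →
      2 * |a - j| / n ≤ |Real.sin (y / 2)| →
      2 * |a - j| * (‖dirichletSum n y‖ / n) ≤ |Real.sin (Real.pi * a)| := by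
    rintro y ⟨m, hm⟩ hy
    have h := norm_dirichletSum_mul n y
    rw [hm] at h
    have h2 : |Real.sin (Real.pi * a + m * Real.pi)| = |Real.sin (Real.pi * a)| := by
      rw [Real.sin_add_int_mul_pi, abs_mul, abs_zpow, abs_neg, abs_one, one_zpow, one_mul]
    rw [← h2, ← h]
    calc 2 * |a - j| * (‖dirichletSum n y‖ / n) = 2 * |a - j| / n * ‖dirichletSum n y‖ := by ring
      _ ≤ _ := mul_le_mul_of_nonneg_right hy (norm_nonneg _)
  have hp := hs (x + ω) ⟨j, by rw [hxa, hω]; unfold fourierFreq; push_cast; field_simp⟩ hlow'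
  have hm := hs (x - ω) ⟨-j, by rw [hxa, hω]; unfold fourierFreq; push_cast; field_simp; ring⟩ hlow
  unfold kernelMax
  rcases max_choice ‖dirichletSum n (x + fourierFreq n j)‖ ‖dirichletSum n (x - fourierFreq n j)‖
    with h | h <;> rw [h] <;> assumption

end Dirichlet

/-! ### Factorisation over epochs and energy on cells. -/

section EpochWeights

/-- Bounding an integral over consecutive intervals of length `b`. -/
lemma integral_le_sum_mul {b c y : ℝ} {n : ℕ} {G Q : ℝ → ℝ} {H : ℕ → ℝ} (hb : 0 ≤ b)
    (hy0 : 0 ≤ y) (hyn : y ≤ b * n) (hG : IntervalIntegrable G volume 0 y) (hQ : Continuous Q)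
    (hHQ : ∀ q x, 0 ≤ H q * Q x)
    (hGH : ∀ q : ℕ, ∀ x, b * q < x → x < b * (q + 1) → x ≤ y → G x ≤ H q * Q x)
    (hc : ∀ q : ℕ, ∫ x in (b * q)..(b * (q + 1)), Q x = c) :
    ∫ x in 0..y, G x ≤ (∑ q ∈ Finset.range n, H q) * c := by
  -- Extending `G` by zero lets `n` full cells overshoot `y`; on the part beyond `y` only
  -- nonnegativity of `H q * Q` is needed.
  set G' := (Set.Ioc 0 y).indicator G with hG'
  have hint : Integrable G' volume :=
    ((intervalIntegrable_iff_integrableOn_Ioc_of_le hy0).mp hG).integrable_indicator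
      measurableSet_Ioc
  have h1 : ∫ x in 0..y, G x = ∫ x in 0..(b * n), G' x := by
    rw [intervalIntegral.integral_of_le hy0, intervalIntegral.integral_of_le (hy0.trans hyn), hG',
      setIntegral_indicator measurableSet_Ioc,
      Set.inter_eq_self_of_subset_right (Set.Ioc_subset_Ioc_right hyn)]
  have h2 := intervalIntegral.sum_integral_adjacent_intervals (f := G') (μ := volume)
    (a := fun q : ℕ => b * q) (n := n) fun q _ => hint.intervalIntegrable
  simp only [Nat.cast_zero, mul_zero] at h2
  rw [h1, ← h2, Finset.sum_mul]
  refine Finset.sum_le_sum fun q _ => ?_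
  rw [← hc q, ← intervalIntegral.integral_const_mul]
  push_cast
  refine intervalIntegral.integral_mono_on_of_le_Ioo
    (mul_le_mul_of_nonneg_left (by linarith) hb) hint.intervalIntegrable
    ((hQ.const_mul _).intervalIntegrable _ _) fun x hx => ?_
  rw [hG', Set.indicator_apply]
  split_ifs with hxy
  · exact hGH q x hx.1 hx.2 hxy.2
  · exact hHQ q x

lemma integral_neg_eq_two_mul {h : ℝ → ℝ} {y : ℝ} (hy : 0 ≤ y)
    (hint : IntervalIntegrable h volume (-y) y)
    (heven : ∀ x, 0 < x → x ≤ y → h (-x) = h x) :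
    ∫ x in (-y)..y, h x = 2 * ∫ x in 0..y, h x := by
  have h1 : ∫ x in (-y)..0, h x = ∫ x in 0..y, h x := by
    have h2 := intervalIntegral.integral_comp_neg (a := 0) (b := y) h
    rw [neg_zero] at h2
    rw [← h2]
    refine intervalIntegral.integral_congr_ae (Filter.Eventually.of_forall fun x hx => ?_)
    rw [Set.uIoc_of_le hy] at hx
    exact heven x hx.1 hx.2
  have h0 : (0 : ℝ) ∈ Set.uIcc (-y) y := by
    rw [Set.uIcc_of_le (by linarith)]; exact ⟨by linarith, hy⟩
  rw [← intervalIntegral.integral_add_adjacent_intervals (b := 0)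
    (hint.mono_set (Set.uIcc_subset_uIcc_left h0)) (hint.mono_set (Set.uIcc_subset_uIcc_right h0)),
    h1]
  ring

variable {g n : ℕ}

/-- The time of the `t`-th observation of the `ℓ`-th epoch. -/
def epochTime (g n : ℕ) (p : Fin g × Fin n) : ℤ := (((p.2 : ℕ) + 1 + p.1 * n : ℕ) : ℤ)

lemma epochTime_injective (g n : ℕ) : Function.Injective (epochTime g n) := by
  intro p q h
  refine (finProdFinEquiv (m := g) (n := n)).injective (Fin.ext ?_)
  unfold epochTime at h
  simp only [finProdFinEquiv_apply_val]
  have h' : (p.2 : ℕ) + 1 + p.1 * n = q.2 + 1 + q.1 * n := by exact_mod_cast h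
  rw [mul_comm n, mul_comm n]
  omega

/-- Coefficients of the linear form in the process given by the real and imaginary parts
of the epoch Fourier transforms. -/
noncomputable def epochWeight (n : ℕ) (r x : ℝ) (v : Fin g ⊕ Fin g → ℝ) (p : Fin g × Fin n) : ℝ :=
  r * (v (Sum.inl p.1) * Real.cos (((p.2 : ℕ) + 1 : ℝ) * x)
    + v (Sum.inr p.1) * Real.sin (((p.2 : ℕ) + 1 : ℝ) * x))

/-- The polynomial `∑_ℓ (α_ℓ + s i β_ℓ) e^{iℓθ}`. -/
noncomputable def epochPoly (s : ℝ) (v : Fin g ⊕ Fin g → ℝ) (θ : ℝ) : ℂ :=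
  trigPoly (fun ℓ : Fin g => ((ℓ : ℕ) : ℤ))
    (fun ℓ => (v (Sum.inl ℓ) : ℂ) + s * v (Sum.inr ℓ) * Complex.I) θ

lemma continuous_epochPoly (s : ℝ) (v : Fin g ⊕ Fin g → ℝ) : Continuous (epochPoly s v) :=
  continuous_trigPoly _ _

/-- Splitting cosine and sine into exponentials separates the two time scales: the position within
an epoch gives Dirichlet kernels at `y ± x`, the epoch index a polynomial in `e^(iny)`. -/
lemma trigPoly_epochWeight (r x y : ℝ) (v : Fin g ⊕ Fin g → ℝ) :
    trigPoly (epochTime g n) (fun p => (epochWeight n r x v p : ℂ)) y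
      = r / 2 * (epochPoly (-1) v (n * y) * dirichletSum n (y + x)
        + epochPoly 1 v (n * y) * dirichletSum n (y - x)) := by
  unfold epochPoly trigPoly dirichletSum
  rw [Finset.sum_mul_sum, Finset.sum_mul_sum, ← Finset.sum_add_distrib, Finset.mul_sum,
    Fintype.sum_prod_type]
  refine Finset.sum_congr rfl fun ℓ _ => ?_
  rw [← Finset.sum_add_distrib, Finset.mul_sum]
  refine Finset.sum_congr rfl fun t _ => ?_
  unfold epochWeight epochTime
  have h1 : Complex.exp (Complex.I * ((((((t : ℕ) + 1 + ℓ * n : ℕ) : ℤ) : ℝ) * y : ℝ) : ℂ))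
      = Complex.exp (Complex.I * ((((ℓ : ℕ) : ℤ) : ℝ) * (n * y) : ℝ))
        * Complex.exp (Complex.I * ((((t : ℕ) + 1 : ℝ) * y : ℝ))) := by
    rw [← Complex.exp_add]; congr 1; push_cast; ring
  have h2 : Complex.exp (Complex.I * ((((t : ℕ) + 1 : ℝ) * (y + x) : ℝ)))
      = Complex.exp (Complex.I * ((((t : ℕ) + 1 : ℝ) * y : ℝ)))
        * Complex.exp ((((t : ℕ) + 1 : ℝ) * x : ℝ) * Complex.I) := by
    rw [← Complex.exp_add]; congr 1; push_cast; ring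
  have h3 : Complex.exp (Complex.I * ((((t : ℕ) + 1 : ℝ) * (y - x) : ℝ)))
      = Complex.exp (Complex.I * ((((t : ℕ) + 1 : ℝ) * y : ℝ)))
        * Complex.exp (-(((t : ℕ) + 1 : ℝ) * x : ℝ) * Complex.I) := by
    rw [← Complex.exp_add]; congr 1; push_cast; ring
  rw [h1, h2, h3]
  simp only [Complex.ofReal_mul, Complex.ofReal_add, Complex.ofReal_cos, Complex.ofReal_sin,
    Complex.cos, Complex.sin]
  push_cast
  ring

lemma norm_trigPoly_epochWeight_le {r : ℝ} (hr : 0 ≤ r) (hn : 0 < n) (j : ℕ) (y : ℝ)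
    (v : Fin g ⊕ Fin g → ℝ) :
    ‖trigPoly (epochTime g n) (fun p => (epochWeight n r (fourierFreq n j) v p : ℂ)) y‖
      ≤ r * n / 2 * kernelMax n j y * (‖epochPoly (-1) v (n * y)‖ + ‖epochPoly 1 v (n * y)‖) := by
  have hn' : (0 : ℝ) < n := by exact_mod_cast hn
  rw [trigPoly_epochWeight, norm_mul, norm_div, Complex.norm_real, Real.norm_of_nonneg hr,
    Complex.norm_ofNat]
  have h1 : ‖dirichletSum n (y + fourierFreq n j)‖ ≤ n * kernelMax n j y := by
    unfold kernelMax
    rw [mul_div_cancel₀ _ hn'.ne']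
    exact le_max_left _ _
  have h2 : ‖dirichletSum n (y - fourierFreq n j)‖ ≤ n * kernelMax n j y := by
    unfold kernelMax
    rw [mul_div_cancel₀ _ hn'.ne']
    exact le_max_right _ _
  calc _ ≤ r / 2 * (‖epochPoly (-1) v (n * y)‖ * (n * kernelMax n j y)
        + ‖epochPoly 1 v (n * y)‖ * (n * kernelMax n j y)) := by
        refine mul_le_mul_of_nonneg_left ((norm_add_le _ _).trans ?_) (by positivity)
        rw [norm_mul, norm_mul]
        exact add_le_add (mul_le_mul_of_nonneg_left h1 (norm_nonneg _))
          (mul_le_mul_of_nonneg_left h2 (norm_nonneg _))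
    _ = _ := by ring

/-- The squared modulus of the epoch polynomials. -/
noncomputable def epochEnergy (n : ℕ) (v : Fin g ⊕ Fin g → ℝ) (y : ℝ) : ℝ :=
  ‖epochPoly (-1) v (n * y)‖ ^ 2 + ‖epochPoly 1 v (n * y)‖ ^ 2

lemma epochEnergy_nonneg (v : Fin g ⊕ Fin g → ℝ) (y : ℝ) : 0 ≤ epochEnergy n v y := by
  unfold epochEnergy; positivity

lemma continuous_epochEnergy (v : Fin g ⊕ Fin g → ℝ) : Continuous (epochEnergy n v) := by
  unfold epochEnergy
  have h := fun s : ℝ => continuous_epochPoly s v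
  exact ((((h _).comp (continuous_const_mul _)).norm).pow 2).add
    ((((h _).comp (continuous_const_mul _)).norm).pow 2)

/-- Each cell is exactly one period of `y ↦ epochPoly s v (n * y)`, so Parseval holds cell by cell
with no loss in `g`. This is the source of uniformity in the number of epochs. -/
lemma integral_epochEnergy (hn : 0 < n) (v : Fin g ⊕ Fin g → ℝ) (q : ℕ) :
    ∫ y in (2 * Real.pi / n * q)..(2 * Real.pi / n * (q + 1)), epochEnergy n v y
      = 4 * Real.pi / n * ∑ i, v i ^ 2 := by
  have hn' : (n : ℝ) ≠ 0 := by exact_mod_cast hn.ne'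
  have hinj : Function.Injective (fun ℓ : Fin g => ((ℓ : ℕ) : ℤ)) := fun a b h =>
    Fin.ext (by simpa using h)
  have key : ∀ s : ℝ, s ^ 2 = 1 →
      ∫ y in (2 * Real.pi / n * q)..(2 * Real.pi / n * (q + 1)), ‖epochPoly s v (n * y)‖ ^ 2
        = 2 * Real.pi / n * ∑ i, v i ^ 2 := by
    intro s hs
    rw [intervalIntegral.integral_comp_mul_left (fun θ => ‖epochPoly s v θ‖ ^ 2) hn']
    have h1 : (n : ℝ) * (2 * Real.pi / n * (q + 1)) = n * (2 * Real.pi / n * q) + 2 * Real.pi := by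
      field_simp
    rw [h1]
    unfold epochPoly
    rw [integral_norm_trigPoly_sq hinj, Fintype.sum_sum_type, ← Finset.sum_add_distrib, smul_eq_mul]
    have h2 : ∀ ℓ : Fin g, ‖(v (Sum.inl ℓ) : ℂ) + s * v (Sum.inr ℓ) * Complex.I‖ ^ 2
        = v (Sum.inl ℓ) ^ 2 + v (Sum.inr ℓ) ^ 2 := by
      intro ℓ
      rw [← Complex.normSq_eq_norm_sq, ← Complex.ofReal_mul, Complex.normSq_add_mul_I, mul_pow, hs,
        one_mul]
    simp_rw [h2]
    field_simp
  have hcont : ∀ s : ℝ, Continuous fun y : ℝ => ‖epochPoly s v (n * y)‖ ^ 2 := fun s =>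
    (((continuous_epochPoly s v).comp (continuous_const_mul (n : ℝ))).norm).pow 2
  unfold epochEnergy
  rw [intervalIntegral.integral_add ((hcont _).intervalIntegrable _ _)
    ((hcont _).intervalIntegrable _ _), key _ (by norm_num), key _ (by norm_num)]
  ring

lemma norm_trigPoly_mul_norm_trigPoly_le {r r' : ℝ} (hr : 0 ≤ r) (hr' : 0 ≤ r') (hn : 0 < n)
    (j k : ℕ) (y : ℝ) (v v' : Fin g ⊕ Fin g → ℝ) :
    ‖trigPoly (epochTime g n) (fun p => (epochWeight n r (fourierFreq n j) v p : ℂ)) y‖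
      * ‖trigPoly (epochTime g n) (fun p => (epochWeight n r' (fourierFreq n k) v' p : ℂ)) y‖
      ≤ r * r' * n ^ 2 / 4 * (kernelMax n j y * kernelMax n k y)
        * (epochEnergy n v y + epochEnergy n v' y) := by
  have h1 := norm_trigPoly_epochWeight_le hr hn j y v
  have h2 := norm_trigPoly_epochWeight_le hr' hn k y v'
  have hj := kernelMax_nonneg n j y
  have hk := kernelMax_nonneg n k y
  refine (mul_le_mul h1 h2 (norm_nonneg _) (by positivity)).trans ?_
  unfold epochEnergy
  set a := ‖epochPoly (-1) v (n * y)‖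
  set b := ‖epochPoly 1 v (n * y)‖
  set c := ‖epochPoly (-1) v' (n * y)‖
  set e := ‖epochPoly 1 v' (n * y)‖
  have h3 : (a + b) * (c + e) ≤ a ^ 2 + b ^ 2 + (c ^ 2 + e ^ 2) := by
    nlinarith [sq_nonneg (a - c), sq_nonneg (a - e), sq_nonneg (b - c), sq_nonneg (b - e)]
  have h4 : 0 ≤ r * r' * n ^ 2 / 4 * (kernelMax n j y * kernelMax n k y) := by positivity
  refine le_trans (le_of_eq ?_) (mul_le_mul_of_nonneg_left h3 h4)
  ring

end EpochWeights

/-! ### Oscillation of the spectral density and the integral estimate. -/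

section SpectralBound

variable {μ ν : ℝ} {φ : ℝ → ℝ}

/-- The Hölder condition serves only to give evenness, through `0 ^ ν = 0`; so no constant depends
on `ν`. -/
lemma MemLipschitzClass.neg_eq (h : MemLipschitzClass μ ν φ) (hν : 0 < ν) {x : ℝ}
    (hx0 : 0 < x) (hx : x ≤ Real.pi) : φ (-x) = φ x := by
  have h1 := h.hoelder (-x) ⟨by linarith, by linarith⟩ x ⟨by linarith, hx⟩ (by linarith) hx0.ne'
  rw [abs_neg, sub_self, abs_zero, Real.zero_rpow hν.ne', mul_zero] at h1
  have := abs_nonpos_iff.mp h1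
  linarith

lemma spectralDensity_mul {b a d : ℝ} (hb : 0 < b) (ha : 0 < a) :
    spectralDensity d φ (b * a) = b ^ (-2 * d) * (a ^ (-2 * d) * φ (b * a)) := by
  unfold spectralDensity
  rw [abs_of_pos (by positivity), Real.mul_rpow hb.le ha.le]
  ring

lemma abs_spectralDensity_sub_le (h : MemLipschitzClass μ ν φ) {d b a k : ℝ}
    (hb : 0 < b) (ha : 0 < a) (hk : 0 < k) (haπ : b * a ≤ Real.pi) (hkπ : b * k ≤ Real.pi) :
    |spectralDensity d φ (b * a) - spectralDensity d φ (b * k)|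
      ≤ μ * φ 0 * b ^ (-2 * d) * (a ^ (-2 * d) + k ^ (-2 * d)) := by
  have hπ := Real.pi_pos
  have hma : b * a ∈ Set.Icc (-Real.pi) Real.pi := ⟨by nlinarith [mul_pos hb ha], haπ⟩
  have hmk : b * k ∈ Set.Icc (-Real.pi) Real.pi := ⟨by nlinarith [mul_pos hb hk], hkπ⟩
  rw [spectralDensity_mul hb ha, spectralDensity_mul hb hk, ← mul_sub, abs_mul,
    abs_of_pos (Real.rpow_pos_of_pos hb _), mul_comm (μ * φ 0), mul_assoc]
  refine mul_le_mul_of_nonneg_left ?_ (Real.rpow_pos_of_pos hb _).le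
  have h1 := h.nonneg _ hma
  have h2 := h.nonneg _ hmk
  have h3 := mul_le_mul_of_nonneg_left (h.le_mul_zero _ hma) (Real.rpow_pos_of_pos ha (-2 * d)).le
  have h4 := mul_le_mul_of_nonneg_left (h.le_mul_zero _ hmk) (Real.rpow_pos_of_pos hk (-2 * d)).le
  have h5 := mul_nonneg (Real.rpow_pos_of_pos ha (-2 * d)).le h1
  have h6 := mul_nonneg (Real.rpow_pos_of_pos hk (-2 * d)).le h2
  rw [abs_le]
  constructor <;> nlinarith

lemma abs_spectralDensity_sub_le_of_half_le (h : MemLipschitzClass μ ν φ) {d b a k : ℝ}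
    (hd : |2 * d| ≤ 1) (hb : 0 < b) (hk : 0 < k) (hak : k / 2 ≤ a)
    (haπ : b * a ≤ Real.pi) (hkπ : b * k ≤ Real.pi) :
    |spectralDensity d φ (b * a) - spectralDensity d φ (b * k)|
      ≤ 6 * (μ * φ 0 * b ^ (-2 * d)) * k ^ (-2 * d) * |a - k| / k := by
  have hπ := Real.pi_pos
  have ha : 0 < a := by linarith
  have hma : b * a ∈ Set.Icc (-Real.pi) Real.pi := ⟨by nlinarith [mul_pos hb ha], haπ⟩
  have hmk : b * k ∈ Set.Icc (-Real.pi) Real.pi := ⟨by nlinarith [mul_pos hb hk], hkπ⟩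
  rw [spectralDensity_mul hb ha, spectralDensity_mul hb hk, ← mul_sub, abs_mul,
    abs_of_pos (Real.rpow_pos_of_pos hb _)]
  rw [abs_le] at hd
  have h1 := abs_rpow_mul_sub_le (p := -2 * d) hk hak (by linarith) (by linarith)
    (h.nonneg _ hma) (h.le_mul_zero _ hma) (B := φ (b * k)) (by
      refine (h.lipschitz _ hma _ hmk (by positivity) (by positivity)).trans (le_of_eq ?_)
      rw [abs_of_pos (mul_pos hb ha), abs_of_pos (mul_pos hb hk), ← mul_sub, abs_mul,
        abs_of_pos hb, ← mul_min_of_nonneg _ _ hb.le, mul_div_mul_left _ _ hb.ne'])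
  refine (mul_le_mul_of_nonneg_left h1 (Real.rpow_pos_of_pos hb _).le).trans (le_of_eq ?_)
  ring

variable {g n : ℕ}

lemma integral_abs_spectralDensity_sub_mul_le (h : MemLipschitzClass μ ν φ) (hν : 0 < ν)
    (hμφ : 0 ≤ μ * φ 0)
    {d η : ℝ} (hη : 0 < η) (hη1 : η ≤ 1) (hd1 : η - 1 ≤ -2 * d) (hd2 : -2 * d ≤ 1 - η)
    (hint : IntervalIntegrable (spectralDensity d φ) volume (-Real.pi) Real.pi)
    {j k : ℕ} (hj : 2 ≤ j) (hjk : j ≤ k) (hk : 3 ≤ k) (hkn : 2 * k < n)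
    {r r' : ℝ} (hr : 0 ≤ r) (hr' : 0 ≤ r') (v v' : Fin g ⊕ Fin g → ℝ) :
    ∫ x in (-Real.pi)..Real.pi,
        |spectralDensity d φ x - spectralDensity d φ (fourierFreq n k)|
        * (‖trigPoly (epochTime g n) (fun p => (epochWeight n r (fourierFreq n j) v p : ℂ)) x‖
          * ‖trigPoly (epochTime g n) (fun p => (epochWeight n r' (fourierFreq n k) v' p : ℂ)) x‖)
      ≤ 2 * Real.pi * n * (r * r') * (μ * φ 0 * (2 * Real.pi / n) ^ (-2 * d))
        * (122 / η * (((j : ℝ) ^ (-2 * d) + (k : ℝ) ^ (-2 * d)) * Real.log k / k))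
        * (∑ i, v i ^ 2 + ∑ i, v' i ^ 2) := by
  have hπ := Real.pi_pos
  have hn : 0 < n := by omega
  have hn' : (0 : ℝ) < n := by exact_mod_cast hn
  have hkn' : 2 * (k : ℝ) < n := by exact_mod_cast hkn
  have hk0 : (0 : ℝ) < k := by exact_mod_cast (by omega : 0 < k)
  -- In units of `b` the frequency `ω_k` becomes `k` and the cells become unit intervals; the power
  -- of `b` pulled out of the density is absorbed in `M`.
  set b := 2 * Real.pi / n with hb
  have hb0 : 0 < b := by positivity
  have hbk : fourierFreq n k = b * k := by unfold fourierFreq; rw [hb]; ring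
  have hkπ : b * k ≤ Real.pi := by
    rw [hb, div_mul_eq_mul_div, div_le_iff₀ hn']; nlinarith
  set p := -2 * d with hp
  set M := μ * φ 0 * b ^ p with hM
  have hM0 : 0 ≤ M := mul_nonneg hμφ (Real.rpow_pos_of_pos hb0 _).le
  set û := trigPoly (epochTime g n) (fun p => (epochWeight n r (fourierFreq n j) v p : ℂ)) with hu
  set w := trigPoly (epochTime g n) (fun p => (epochWeight n r' (fourierFreq n k) v' p : ℂ)) with hw
  set S := ∑ i, v i ^ 2 + ∑ i, v' i ^ 2 with hS
  have hS0 : 0 ≤ S := by positivity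
  have hGint : IntervalIntegrable (fun x => |spectralDensity d φ x
      - spectralDensity d φ (fourierFreq n k)| * (‖û x‖ * ‖w x‖)) volume (-Real.pi) Real.pi := by
    refine IntervalIntegrable.mul_continuousOn (IntervalIntegrable.abs
      (hint.sub intervalIntegrable_const)) (Continuous.continuousOn ?_)
    exact (continuous_trigPoly _ _).norm.mul (continuous_trigPoly _ _).norm
  rw [integral_neg_eq_two_mul hπ.le hGint]
  · have hle := integral_le_sum_mul (b := b) (y := Real.pi) (n := n)
      (G := fun x => |spectralDensity d φ x - spectralDensity d φ (fourierFreq n k)|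
        * (‖û x‖ * ‖w x‖))
      (Q := fun x => epochEnergy n v x + epochEnergy n v' x)
      (H := fun q => M * kernelBound p j k q * (r * r' * n ^ 2 / 4)) (c := 4 * Real.pi / n * S)
      hb0.le hπ.le (by rw [hb, div_mul_cancel₀ _ hn'.ne']; linarith)
      (hGint.mono_set (Set.uIcc_subset_uIcc_right (by
        rw [Set.uIcc_of_le (by linarith)]; exact ⟨by linarith, hπ.le⟩)))
      ((continuous_epochEnergy v).add (continuous_epochEnergy v'))
      (fun q x => by
        have := kernelBound_nonneg p j k q
        have := epochEnergy_nonneg (n := n) v x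
        have := epochEnergy_nonneg (n := n) v' x
        positivity)
      (fun q x hx1 hx2 hxπ => by
        have hx0 : 0 < x := lt_of_le_of_lt (by positivity) hx1
        set a := n * x / (2 * Real.pi) with ha
        have hxa : x = b * a := by rw [hb, ha]; field_simp
        have ha0 : 0 < a := by positivity
        have hqa : (q : ℝ) ≤ a := by
          rw [hxa] at hx1; exact (lt_of_mul_lt_mul_left hx1 hb0.le).le
        have haq : a < q + 1 := by
          rw [hxa] at hx2; exact lt_of_mul_lt_mul_left hx2 hb0.le
        have haπ : b * a ≤ Real.pi := hxa ▸ hxπ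
        have hkb := mul_mul_le_kernelBound (p := p) (M := M) (a := a) (s := |Real.sin (Real.pi * a)|)
          (x := kernelMax n j x) (y := kernelMax n k x)
          (Δ := |spectralDensity d φ x - spectralDensity d φ (fourierFreq n k)|) (q := q)
          hj hjk (by linarith) (by linarith) hM0 hqa haq ha0 (abs_nonneg _)
          (Real.abs_sin_le_one _)
          (by
            refine Real.abs_sin_le_abs.trans (le_of_eq ?_)
            exact abs_of_pos (by positivity))
          (by rw [hxa, hbk]; exact abs_spectralDensity_sub_le h hb0 ha0 hk0 haπ hkπ)
          (fun hka => by
            rw [hxa, hbk]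
            refine abs_spectralDensity_sub_le_of_half_le h ?_ hb0 hk0 hka haπ hkπ
            rw [abs_le]; constructor <;> linarith)
          (kernelMax_nonneg _ _ _) (kernelMax_le_one _ _ _)
          (abs_sub_mul_kernelMax_le (by omega) hn hx0.le hxπ ha)
          (kernelMax_nonneg _ _ _) (abs_sub_mul_kernelMax_le (by omega) hn hx0.le hxπ ha)
        have h2 := norm_trigPoly_mul_norm_trigPoly_le hr hr' hn j k x v v'
        have hE := epochEnergy_nonneg (n := n) v x
        have hE' := epochEnergy_nonneg (n := n) v' x
        have h3 := mul_le_mul_of_nonneg_left h2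
          (abs_nonneg (spectralDensity d φ x - spectralDensity d φ (fourierFreq n k)))
        refine h3.trans ?_
        have h4 := mul_le_mul_of_nonneg_right hkb
          (show 0 ≤ r * r' * n ^ 2 / 4 * (epochEnergy n v x + epochEnergy n v' x) by positivity)
        refine le_trans (le_of_eq ?_) (h4.trans (le_of_eq ?_)) <;> ring)
      (fun q => by
        rw [intervalIntegral.integral_add ((continuous_epochEnergy v).intervalIntegrable _ _)
          ((continuous_epochEnergy v').intervalIntegrable _ _), integral_epochEnergy hn,
          integral_epochEnergy hn, hS]
        ring)
    refine (mul_le_mul_of_nonneg_left hle two_pos.le).trans ?_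
    rw [← Finset.sum_mul, ← Finset.mul_sum]
    have hsum := sum_kernelBound_le (p := p) hη hη1 hd1 hd2 hj hjk hk n
    calc 2 * (M * (∑ q ∈ Finset.range n, kernelBound p j k q) * (r * r' * n ^ 2 / 4)
          * (4 * Real.pi / n * S))
        = (2 * Real.pi * n * (r * r') * M * S) * ∑ q ∈ Finset.range n, kernelBound p j k q := by
          field_simp
      _ ≤ (2 * Real.pi * n * (r * r') * M * S)
          * (122 / η * (((j : ℝ) ^ p + (k : ℝ) ^ p) * Real.log k / k)) :=
          mul_le_mul_of_nonneg_left hsum (by positivity)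
      _ = _ := by ring
  · intro x hx0 hx
    have h1 : spectralDensity d φ (-x) = spectralDensity d φ x := by
      unfold spectralDensity
      rw [abs_neg, h.neg_eq hν hx0 hx]
    rw [h1, hu, hw, norm_trigPoly_neg, norm_trigPoly_neg]

end SpectralBound

/-! ### Fourier transforms of the epochs as linear forms in the process. -/

section EpochTransforms

lemma sum_Icc_one_eq_sum_fin {M : Type*} [AddCommMonoid M] (n : ℕ) (F : ℕ → M) :
    ∑ t ∈ Finset.Icc 1 n, F t = ∑ t : Fin n, F (t + 1) := by
  rw [Fin.sum_univ_eq_sum_range (fun i => F (i + 1)) n, Finset.range_eq_Ico,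
    Finset.sum_Ico_add' F 0 n 1]
  rfl

lemma exp_I_mul_re (x : ℝ) : (Complex.exp (Complex.I * x)).re = Real.cos x := by
  rw [mul_comm, Complex.exp_ofReal_mul_I_re]

lemma exp_I_mul_im (x : ℝ) : (Complex.exp (Complex.I * x)).im = Real.sin x := by
  rw [mul_comm, Complex.exp_ofReal_mul_I_im]

lemma dirichletSum_re (n : ℕ) (x : ℝ) :
    (dirichletSum n x).re = ∑ t : Fin n, Real.cos (((t : ℕ) + 1 : ℝ) * x) := by
  unfold dirichletSum
  rw [Complex.re_sum]
  exact Finset.sum_congr rfl fun t _ => exp_I_mul_re _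

lemma dirichletSum_im (n : ℕ) (x : ℝ) :
    (dirichletSum n x).im = ∑ t : Fin n, Real.sin (((t : ℕ) + 1 : ℝ) * x) := by
  unfold dirichletSum
  rw [Complex.im_sum]
  exact Finset.sum_congr rfl fun t _ => exp_I_mul_im _

lemma dirichletSum_zero (n : ℕ) : dirichletSum n 0 = n := by simp [dirichletSum]

variable {g n : ℕ}

lemma sum_epochWeight (r x : ℝ) (v : Fin g ⊕ Fin g → ℝ) :
    ∑ p, epochWeight n r x v p
      = ∑ ℓ : Fin g, r * (v (Sum.inl ℓ) * (dirichletSum n x).re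
        + v (Sum.inr ℓ) * (dirichletSum n x).im) := by
  rw [Fintype.sum_prod_type]
  refine Finset.sum_congr rfl fun ℓ _ => ?_
  simp only [epochWeight, dirichletSum_re, dirichletSum_im, Finset.mul_sum,
    ← Finset.sum_add_distrib]

lemma sum_epochWeight_mul (r r' x x' : ℝ) (v v' : Fin g ⊕ Fin g → ℝ) :
    ∑ p, epochWeight n r x v p * epochWeight n r' x' v' p
      = r * r' / 2 * ∑ ℓ : Fin g,
        ((v (Sum.inl ℓ) * v' (Sum.inl ℓ) + v (Sum.inr ℓ) * v' (Sum.inr ℓ))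
            * (dirichletSum n (x - x')).re
          + (v (Sum.inl ℓ) * v' (Sum.inl ℓ) - v (Sum.inr ℓ) * v' (Sum.inr ℓ))
            * (dirichletSum n (x + x')).re
          + (v (Sum.inl ℓ) * v' (Sum.inr ℓ) + v (Sum.inr ℓ) * v' (Sum.inl ℓ))
            * (dirichletSum n (x + x')).im
          + (v (Sum.inr ℓ) * v' (Sum.inl ℓ) - v (Sum.inl ℓ) * v' (Sum.inr ℓ))
            * (dirichletSum n (x - x')).im) := by
  rw [Fintype.sum_prod_type, Finset.mul_sum]
  refine Finset.sum_congr rfl fun ℓ _ => ?_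
  simp only [dirichletSum_re, dirichletSum_im, Finset.mul_sum, ← Finset.sum_add_distrib]
  refine Finset.sum_congr rfl fun t _ => ?_
  unfold epochWeight
  rw [mul_sub, mul_add _ x x', Real.cos_sub, Real.cos_add, Real.sin_add, Real.sin_sub]
  ring

lemma fourierFreq_add (n j k : ℕ) :
    fourierFreq n j + fourierFreq n k = fourierFreq n (j + k) := by
  unfold fourierFreq; push_cast; ring

lemma sum_epochWeight_mul_self {j : ℕ} (hj : 1 ≤ j) (hjn : 2 * j < n) (r : ℝ)
    (v : Fin g ⊕ Fin g → ℝ) :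
    ∑ p, epochWeight n r (fourierFreq n j) v p * epochWeight n r (fourierFreq n j) v p
      = r ^ 2 * n / 2 * ∑ i, v i ^ 2 := by
  rw [sum_epochWeight_mul, sub_self, fourierFreq_add,
    dirichletSum_fourierFreq_eq_zero (by omega) (by omega), dirichletSum_zero, Fintype.sum_sum_type,
    ← Finset.sum_add_distrib, Finset.mul_sum, Finset.mul_sum]
  refine Finset.sum_congr rfl fun ℓ _ => ?_
  simp only [Complex.natCast_re, Complex.natCast_im, Complex.zero_re, Complex.zero_im]
  ring

lemma sum_epochWeight_mul_of_lt {j k : ℕ} (hjk : j < k) (hkn : 2 * k < n) (r r' : ℝ)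
    (v v' : Fin g ⊕ Fin g → ℝ) :
    ∑ p, epochWeight n r (fourierFreq n j) v p * epochWeight n r' (fourierFreq n k) v' p = 0 := by
  have h1 : fourierFreq n k - fourierFreq n j = fourierFreq n (k - j) := by
    rw [sub_eq_iff_eq_add, fourierFreq_add, Nat.sub_add_cancel hjk.le]
  simp_rw [mul_comm (epochWeight n r (fourierFreq n j) v _)]
  rw [sum_epochWeight_mul, h1, fourierFreq_add,
    dirichletSum_fourierFreq_eq_zero (by omega) (by omega),
    dirichletSum_fourierFreq_eq_zero (by omega) (by omega)]
  simp

variable {Ω : Type*}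

/-- Real and imaginary parts of the Fourier transforms of the epochs `0, …, g - 1`,
multiplied by `c`. -/
noncomputable def scaledDft (X : ℤ → Ω → ℝ) (n : ℕ) (c x : ℝ) : Fin g ⊕ Fin g → Ω → ℝ :=
  Sum.elim (fun ℓ a => c * (dft X n ℓ x a).re) (fun ℓ a => c * (dft X n ℓ x a).im)

lemma dft_re (X : ℤ → Ω → ℝ) (n : ℕ) (ℓ : Fin g) (x : ℝ) (a : Ω) :
    (dft X n ℓ x a).re = (√(2 * Real.pi * n))⁻¹
      * ∑ t : Fin n, Real.cos (((t : ℕ) + 1 : ℝ) * x) * X (epochTime g n (ℓ, t)) a := by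
  unfold dft
  rw [Complex.re_ofReal_mul, sum_Icc_one_eq_sum_fin, Complex.re_sum]
  congr 1
  refine Finset.sum_congr rfl fun t _ => ?_
  rw [Complex.re_ofReal_mul, exp_I_mul_re, mul_comm]
  push_cast
  rfl

lemma dft_im (X : ℤ → Ω → ℝ) (n : ℕ) (ℓ : Fin g) (x : ℝ) (a : Ω) :
    (dft X n ℓ x a).im = (√(2 * Real.pi * n))⁻¹
      * ∑ t : Fin n, Real.sin (((t : ℕ) + 1 : ℝ) * x) * X (epochTime g n (ℓ, t)) a := by
  unfold dft
  rw [Complex.im_ofReal_mul, sum_Icc_one_eq_sum_fin, Complex.im_sum]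
  congr 1
  refine Finset.sum_congr rfl fun t _ => ?_
  rw [Complex.im_ofReal_mul, exp_I_mul_im, mul_comm]
  push_cast
  rfl

lemma sum_mul_scaledDft (X : ℤ → Ω → ℝ) (c x : ℝ) (v : Fin g ⊕ Fin g → ℝ) (a : Ω) :
    ∑ i, v i * scaledDft X n c x i a
      = ∑ p, epochWeight n (c * (√(2 * Real.pi * n))⁻¹) x v p * X (epochTime g n p) a := by
  rw [Fintype.sum_sum_type, Fintype.sum_prod_type, ← Finset.sum_add_distrib]
  refine Finset.sum_congr rfl fun ℓ _ => ?_
  simp only [scaledDft, Sum.elim_inl, Sum.elim_inr, dft_re, dft_im, Finset.mul_sum,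
    ← Finset.sum_add_distrib]
  refine Finset.sum_congr rfl fun t _ => ?_
  unfold epochWeight
  ring

lemma scaledDft_eq_sum (X : ℤ → Ω → ℝ) (c x : ℝ) (i : Fin g ⊕ Fin g) (a : Ω) :
    scaledDft X n c x i a
      = ∑ p, epochWeight n (c * (√(2 * Real.pi * n))⁻¹) x (Pi.single i 1) p
        * X (epochTime g n p) a := by
  rw [← sum_mul_scaledDft]
  simp [Pi.single_apply]

lemma averagedPeriodogram_eq_sum_scaledDft (X : ℤ → Ω → ℝ) {c : ℝ} (hc : c ≠ 0) (x : ℝ) (a : Ω) :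
    averagedPeriodogram X g n x a
      = (g : ℝ)⁻¹ * (c ^ 2)⁻¹ * ∑ i : Fin g ⊕ Fin g, scaledDft X n c x i a ^ 2 := by
  unfold averagedPeriodogram periodogram
  rw [mul_assoc, Fintype.sum_sum_type, ← Finset.sum_add_distrib,
    ← Fin.sum_univ_eq_sum_range (fun ℓ => ‖dft X n ℓ x a‖ ^ 2) g, Finset.mul_sum Finset.univ _ (c ^ 2)⁻¹]
  congr 1
  refine Finset.sum_congr rfl fun ℓ _ => ?_
  simp only [scaledDft, Sum.elim_inl, Sum.elim_inr]
  rw [← Complex.normSq_eq_norm_sq, Complex.normSq_apply]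
  field_simp

variable [MeasurableSpace Ω] {P : Measure Ω} {X : ℤ → Ω → ℝ}

/-- Both vectors are linear images of the same finite family of observations, so they are jointly
Gaussian. -/
lemma hasGaussianLaw_scaledDft_prod (hX : IsGaussianProcess X P) (c x c' x' : ℝ) :
    HasGaussianLaw (fun ω => ((fun i : Fin g ⊕ Fin g => scaledDft X n c x i ω),
      (fun i : Fin g ⊕ Fin g => scaledDft X n c' x' i ω))) P := by
  have hV : HasGaussianLaw (fun ω p => X (epochTime g n p) ω) P := by
    let L : ((Finset.univ.image (epochTime g n)) → ℝ) →L[ℝ] (Fin g × Fin n → ℝ) :=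
      { toFun y p := y ⟨epochTime g n p, by simp⟩
        map_add' := by intros; rfl
        map_smul' := by intros; rfl
        cont := by fun_prop }
    exact (hX.hasGaussianLaw (Finset.univ.image (epochTime g n))).map L
  have hS := HasGaussianLaw.sum_mul hV (Sum.elim
    (fun i : Fin g ⊕ Fin g => epochWeight n (c * (√(2 * Real.pi * n))⁻¹) x (Pi.single i 1))
    (fun i : Fin g ⊕ Fin g => epochWeight n (c' * (√(2 * Real.pi * n))⁻¹) x' (Pi.single i 1)))
  let L : ((Fin g ⊕ Fin g) ⊕ (Fin g ⊕ Fin g) → ℝ) →L[ℝ]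
      (Fin g ⊕ Fin g → ℝ) × (Fin g ⊕ Fin g → ℝ) :=
    { toFun y := (fun i => y (Sum.inl i), fun i => y (Sum.inr i))
      map_add' := by intros; rfl
      map_smul' := by intros; rfl
      cont := by fun_prop }
  have h := hS.map L
  refine h.congr (Filter.Eventually.of_forall fun ω => ?_)
  simp only [Function.comp_apply, scaledDft_eq_sum]
  rfl

/-- The mean of the process need not be zero: it is constant in time, and the Dirichlet sum
annihilates constants at nonzero Fourier frequencies. -/
lemma integral_scaledDft [IsProbabilityMeasure P] {f : ℝ → ℝ} (h : HasSpectralDensity P X f)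
    {j : ℕ} (hj : 1 ≤ j) (hjn : j < n) (c : ℝ) (i : Fin g ⊕ Fin g) :
    ∫ ω, scaledDft X n c (fourierFreq n j) i ω ∂P = 0 := by
  simp_rw [scaledDft_eq_sum]
  rw [integral_finsetSum _ fun p _ => ((h.memLp _).integrable (by norm_num)).const_mul _]
  simp_rw [integral_const_mul, h.mean_eq (epochTime g n _) 0]
  rw [← Finset.sum_mul, sum_epochWeight, dirichletSum_fourierFreq_eq_zero hj hjn]
  simp

end EpochTransforms

/-! ### Covariances of the normalised transforms. -/

section CovarianceBound

/-- The larger term is the one at `x` when `d ≥ 0` and the one at `y` when `d ≤ 0`. Divided by `x ^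
(-d) * y ^ (-d)` it is `(y / x) ^ |d|` in both cases. -/
lemma rpow_add_rpow_le {x y d : ℝ} (hx : 0 < x) (hxy : x ≤ y) :
    x ^ (-2 * d) + y ^ (-2 * d) ≤ 2 * (x ^ (-|d|) * y ^ |d|) * (x ^ (-d) * y ^ (-d)) := by
  have hy : 0 < y := hx.trans_le hxy
  rcases le_total 0 d with hd | hd
  · rw [abs_of_nonneg hd]
    have h1 : 2 * (x ^ (-d) * y ^ d) * (x ^ (-d) * y ^ (-d)) = 2 * x ^ (-2 * d) := by
      rw [show -2 * d = -d + -d by ring, Real.rpow_add hx, Real.rpow_neg hy.le]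
      have := Real.rpow_pos_of_pos hy d
      field_simp
    have h2 := Real.rpow_le_rpow_of_nonpos hx hxy (show -2 * d ≤ 0 by linarith)
    linarith
  · rw [abs_of_nonpos hd, neg_neg]
    have h1 : 2 * (x ^ d * y ^ (-d)) * (x ^ (-d) * y ^ (-d)) = 2 * y ^ (-2 * d) := by
      rw [show -2 * d = -d + -d by ring, Real.rpow_add hy, Real.rpow_neg hx.le]
      have := Real.rpow_pos_of_pos hx d
      field_simp
    have h2 := Real.rpow_le_rpow hx.le hxy (show 0 ≤ -2 * d by linarith)
    linarith

variable {Ω : Type*} [MeasurableSpace Ω] {P : Measure Ω} {X : ℤ → Ω → ℝ}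
variable {μ ν d η κ : ℝ} {φ : ℝ → ℝ} {g n : ℕ}

/-- The order of magnitude of the covariances between Fourier transforms at distinct frequencies. -/
noncomputable def covRate (d : ℝ) (j k : ℕ) : ℝ :=
  Real.log k * ((j : ℝ) ^ (-|d|) * (k : ℝ) ^ (|d| - 1))

/-- The factor that normalises the Fourier transforms at frequency `x`. -/
noncomputable def normFactor (d : ℝ) (φ : ℝ → ℝ) (x : ℝ) : ℝ := √(2 / spectralDensity d φ x)

lemma spectralDensity_fourierFreq {j : ℕ} (hn : 0 < n) (hj : 0 < j) :
    spectralDensity d φ (fourierFreq n j)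
      = (2 * Real.pi / n) ^ (-2 * d) * ((j : ℝ) ^ (-2 * d) * φ (fourierFreq n j)) := by
  have hπ := Real.pi_pos
  have hn' : (0 : ℝ) < n := by exact_mod_cast hn
  have hbj : fourierFreq n j = 2 * Real.pi / n * j := by unfold fourierFreq; ring
  rw [hbj]
  exact spectralDensity_mul (by positivity) (by exact_mod_cast hj)

lemma spectralDensity_fourierFreq_pos {j : ℕ} (hn : 0 < n) (hj : 0 < j) (hκ : 0 < κ)
    (hφ : 0 < φ 0) (hf : κ * φ 0 ≤ φ (fourierFreq n j)) :
    0 < spectralDensity d φ (fourierFreq n j) := by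
  have hn' : (0 : ℝ) < n := by exact_mod_cast hn
  have hj' : (0 : ℝ) < j := by exact_mod_cast hj
  have : 0 < φ (fourierFreq n j) := (mul_pos hκ hφ).trans_le hf
  rw [spectralDensity_fourierFreq hn hj]
  have := Real.pi_pos
  positivity

lemma normFactor_le {j : ℕ} (hn : 0 < n) (hj : 0 < j) (hκ : 0 < κ) (hφ : 0 < φ 0)
    (hf : κ * φ 0 ≤ φ (fourierFreq n j)) :
    normFactor d φ (fourierFreq n j)
      ≤ √(2 / ((2 * Real.pi / n) ^ (-2 * d) * (κ * φ 0))) * (j : ℝ) ^ d := by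
  have hπ := Real.pi_pos
  have hn' : (0 : ℝ) < n := by exact_mod_cast hn
  have hj' : (0 : ℝ) < j := by exact_mod_cast hj
  have hκφ : 0 < κ * φ 0 := by positivity
  have hb : 0 < (2 * Real.pi / n : ℝ) ^ (-2 * d) := Real.rpow_pos_of_pos (by positivity) _
  unfold normFactor
  rw [Real.sqrt_le_iff]
  refine ⟨by positivity, ?_⟩
  rw [mul_pow, Real.sq_sqrt (by positivity), spectralDensity_fourierFreq hn hj,
    ← Real.rpow_natCast ((j : ℝ) ^ d), ← Real.rpow_mul hj'.le]
  have h1 : (j : ℝ) ^ (-2 * d) = ((j : ℝ) ^ (d * (2 : ℕ)))⁻¹ := by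
    rw [← Real.rpow_neg hj'.le]; congr 1; push_cast; ring
  rw [h1]
  have hJ : 0 < (j : ℝ) ^ (d * (2 : ℕ)) := Real.rpow_pos_of_pos hj' _
  calc 2 / ((2 * Real.pi / n : ℝ) ^ (-2 * d)
        * (((j : ℝ) ^ (d * (2 : ℕ)))⁻¹ * φ (fourierFreq n j)))
      ≤ 2 / ((2 * Real.pi / n : ℝ) ^ (-2 * d) * (((j : ℝ) ^ (d * (2 : ℕ)))⁻¹ * (κ * φ 0))) := by
        gcongr
    _ = _ := by field_simp

theorem abs_covariance_sum_scaledDft_sub_le [IsProbabilityMeasure P]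
    (h : MemLipschitzClass μ ν φ) (hν : 0 < ν) (hμ : 0 < μ) (hκ : 0 < κ) (hφ : 0 < φ 0)
    (hη : 0 < η) (hη1 : η ≤ 1) (hd1 : η - 1 ≤ -2 * d) (hd2 : -2 * d ≤ 1 - η)
    (hX : HasSpectralDensity P X (spectralDensity d φ))
    {j k : ℕ} (hj : 2 ≤ j) (hjk : j ≤ k) (hk : 3 ≤ k) (hkn : 2 * k < n)
    (hfj : κ * φ 0 ≤ φ (fourierFreq n j)) (hfk : κ * φ 0 ≤ φ (fourierFreq n k))
    (v v' : Fin g ⊕ Fin g → ℝ) :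
    |cov[fun ω => ∑ i, v i * scaledDft X n (normFactor d φ (fourierFreq n j)) (fourierFreq n j) i ω,
        fun ω => ∑ i, v' i * scaledDft X n (normFactor d φ (fourierFreq n k)) (fourierFreq n k) i ω;
        P]
      - 2 * Real.pi * spectralDensity d φ (fourierFreq n k)
        * ∑ p, epochWeight n (normFactor d φ (fourierFreq n j) * (√(2 * Real.pi * n))⁻¹)
            (fourierFreq n j) v p
          * epochWeight n (normFactor d φ (fourierFreq n k) * (√(2 * Real.pi * n))⁻¹)
            (fourierFreq n k) v' p|
      ≤ 488 * μ / (κ * η) * covRate d j k * (∑ i, v i ^ 2 + ∑ i, v' i ^ 2) := by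
  have hπ := Real.pi_pos
  have hn : 0 < n := by omega
  have hn' : (0 : ℝ) < n := by exact_mod_cast hn
  have hj0 : (0 : ℝ) < j := by exact_mod_cast (by omega : 0 < j)
  have hk0 : (0 : ℝ) < k := by exact_mod_cast (by omega : 0 < k)
  simp_rw [sum_mul_scaledDft]
  set cj := normFactor d φ (fourierFreq n j) with hcj
  set ck := normFactor d φ (fourierFreq n k) with hck
  have hcj0 : 0 ≤ cj := Real.sqrt_nonneg _
  have hck0 : 0 ≤ ck := Real.sqrt_nonneg _
  refine (hX.abs_covariance_sum_sub_le (epochTime_injective g n) _ _ _).trans ?_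
  refine (integral_abs_spectralDensity_sub_mul_le h hν (by positivity) hη hη1 hd1 hd2
    hX.intervalIntegrable hj hjk hk hkn (by positivity) (by positivity) v v').trans ?_
  set S := ∑ i, v i ^ 2 + ∑ i, v' i ^ 2
  have hS : 0 ≤ S := by positivity
  refine mul_le_mul_of_nonneg_right ?_ hS
  set B := (2 * Real.pi / n : ℝ) ^ (-2 * d) with hB
  have hB0 : 0 < B := Real.rpow_pos_of_pos (by positivity) _
  have hκφ : 0 < κ * φ 0 := by positivity
  have hcc : cj * ck ≤ 2 / (B * (κ * φ 0)) * ((j : ℝ) ^ d * (k : ℝ) ^ d) := by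
    have h1 := normFactor_le (d := d) hn (by omega) hκ hφ hfj
    have h2 := normFactor_le (d := d) hn (by omega) hκ hφ hfk
    refine (mul_le_mul h1 h2 hck0 (by positivity)).trans (le_of_eq ?_)
    rw [mul_mul_mul_comm, Real.mul_self_sqrt (by positivity)]
  have hrr : 2 * Real.pi * n * (cj * (√(2 * Real.pi * n))⁻¹ * (ck * (√(2 * Real.pi * n))⁻¹))
      = cj * ck := by
    have h1 : (√(2 * Real.pi * n))⁻¹ * (√(2 * Real.pi * n))⁻¹ = (2 * Real.pi * n)⁻¹ := by
      rw [← mul_inv, Real.mul_self_sqrt (by positivity)]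
    rw [mul_mul_mul_comm cj, h1]
    field_simp
  rw [hrr]
  have hlog : 0 ≤ Real.log k := Real.log_natCast_nonneg k
  have hjj : (j : ℝ) ^ d * (j : ℝ) ^ (-d) = 1 := by
    rw [← Real.rpow_add hj0, add_neg_cancel, Real.rpow_zero]
  have hkk : (k : ℝ) ^ d * (k : ℝ) ^ (-d) = 1 := by
    rw [← Real.rpow_add hk0, add_neg_cancel, Real.rpow_zero]
  have hpow := rpow_add_rpow_le (d := d) hj0 (show (j : ℝ) ≤ k by exact_mod_cast hjk)
  unfold covRate
  rw [Real.rpow_sub_one hk0.ne']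
  -- The powers of `2π/n` and the value `φ 0` cancel between normalisation and oscillation, so the
  -- bound is free of `n` and `φ`; `488 = 2 · 122 · 2`.
  calc cj * ck * (μ * φ 0 * B)
        * (122 / η * (((j : ℝ) ^ (-2 * d) + (k : ℝ) ^ (-2 * d)) * Real.log k / k))
      ≤ 2 / (B * (κ * φ 0)) * ((j : ℝ) ^ d * (k : ℝ) ^ d) * (μ * φ 0 * B)
        * (122 / η * (2 * ((j : ℝ) ^ (-|d|) * (k : ℝ) ^ |d|) * ((j : ℝ) ^ (-d) * (k : ℝ) ^ (-d))
          * Real.log k / k)) := by gcongr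
    _ = 488 * μ / (κ * η) * (Real.log k * ((j : ℝ) ^ (-|d|) * ((k : ℝ) ^ |d| / k)))
        * (((j : ℝ) ^ d * (j : ℝ) ^ (-d)) * ((k : ℝ) ^ d * (k : ℝ) ^ (-d))) := by
        field_simp
        ring
    _ = _ := by rw [hjj, hkk]; ring

end CovarianceBound

/-! ### From normalised transforms to the log periodogram. -/

section LogPeriodogram

variable {Ω : Type*} [MeasurableSpace Ω] {P : Measure Ω} {X : ℤ → Ω → ℝ}
variable {μ ν d η κ : ℝ} {φ : ℝ → ℝ} {g n : ℕ}

lemma normFactor_sq {j : ℕ} (hf : 0 < spectralDensity d φ (fourierFreq n j)) :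
    normFactor d φ (fourierFreq n j) ^ 2 = 2 / spectralDensity d φ (fourierFreq n j) :=
  Real.sq_sqrt (by positivity)

lemma covRate_self {j : ℕ} (hj : 0 < j) : covRate d j j = Real.log j / j := by
  have hj' : (0 : ℝ) < j := by exact_mod_cast hj
  unfold covRate
  rw [← Real.rpow_add hj', show -|d| + (|d| - 1) = -1 by ring, Real.rpow_neg_one, div_eq_mul_inv]

lemma covRate_sq {j k : ℕ} (hj : 0 < j) (hk : 0 < k) :
    covRate d j k ^ 2
      = Real.log k ^ 2 * (j : ℝ) ^ (-2 * |d|) * (k : ℝ) ^ (2 * |d| - 2) := by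
  have hj' : (0 : ℝ) < j := by exact_mod_cast hj
  have hk' : (0 : ℝ) < k := by exact_mod_cast hk
  unfold covRate
  rw [mul_pow, mul_pow, ← Real.rpow_natCast ((j : ℝ) ^ (-|d|)), ← Real.rpow_mul hj'.le,
    ← Real.rpow_natCast ((k : ℝ) ^ (|d| - 1)), ← Real.rpow_mul hk'.le, mul_assoc]
  congr 3 <;> push_cast <;> ring_nf

/-- A majorant uniform in `j` and `d` that tends to zero; it fixes the threshold `K` beyond which
the vectors are nearly white. -/
lemma covRate_le {j k : ℕ} (hd : |d| ≤ 1 / 2) (hj : 1 ≤ j) (hk : 1 ≤ k) :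
    covRate d j k ≤ Real.log k * (k : ℝ) ^ (-(1 / 2) : ℝ) := by
  have hj' : (1 : ℝ) ≤ j := by exact_mod_cast hj
  have hk' : (1 : ℝ) ≤ k := by exact_mod_cast hk
  refine mul_le_mul_of_nonneg_left ?_ (Real.log_natCast_nonneg k)
  have h1 : (j : ℝ) ^ (-|d|) ≤ 1 :=
    Real.rpow_le_one_of_one_le_of_nonpos hj' (by linarith [abs_nonneg d])
  have h2 : (k : ℝ) ^ (|d| - 1) ≤ (k : ℝ) ^ (-(1 / 2) : ℝ) :=
    Real.rpow_le_rpow_of_exponent_le hk' (by linarith)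
  calc _ ≤ 1 * (k : ℝ) ^ (-(1 / 2) : ℝ) := mul_le_mul h1 h2 (by positivity) zero_le_one
    _ = _ := one_mul _

lemma covRate_pos {j k : ℕ} (hj : 1 ≤ j) (hk : 2 ≤ k) : 0 < covRate d j k := by
  have hj' : (0 : ℝ) < j := by exact_mod_cast hj
  have hk' : (1 : ℝ) < k := by exact_mod_cast hk
  have := Real.log_pos hk'
  unfold covRate
  positivity

lemma exists_forall_log_mul_rpow_le (A : ℝ) :
    ∃ K : ℕ, ∀ k : ℕ, K ≤ k → A * (Real.log k * (k : ℝ) ^ (-(1 / 2) : ℝ)) ≤ 1 / 4 := by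
  have h1 : Filter.Tendsto (fun x : ℝ => Real.log x / x ^ (1 / 2 : ℝ)) Filter.atTop (nhds 0) :=
    (isLittleO_log_rpow_atTop (by norm_num)).tendsto_div_nhds_zero
  have h2 := (h1.const_mul A).comp tendsto_natCast_atTop_atTop
  rw [mul_zero] at h2
  obtain ⟨K, hK⟩ := Filter.eventually_atTop.mp
    (h2.eventually (eventually_le_nhds (show (0 : ℝ) < 1 / 4 by norm_num)))
  refine ⟨K, fun k hk => ?_⟩
  have h3 := hK k hk
  simp only [Function.comp_apply] at h3
  rwa [Real.rpow_neg (Nat.cast_nonneg k), ← div_eq_mul_inv]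

theorem abs_variance_sum_scaledDft_sub_le [IsProbabilityMeasure P]
    (h : MemLipschitzClass μ ν φ) (hν : 0 < ν) (hμ : 0 < μ) (hκ : 0 < κ) (hφ : 0 < φ 0)
    (hη : 0 < η) (hη1 : η ≤ 1) (hd1 : η - 1 ≤ -2 * d) (hd2 : -2 * d ≤ 1 - η)
    (hX : HasSpectralDensity P X (spectralDensity d φ))
    {j : ℕ} (hj : 3 ≤ j) (hjn : 2 * j < n) (hfj : κ * φ 0 ≤ φ (fourierFreq n j))
    (v : Fin g ⊕ Fin g → ℝ) :
    |Var[fun ω => ∑ i, v i * scaledDft X n (normFactor d φ (fourierFreq n j)) (fourierFreq n j) i ω;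
        P] - ∑ i, v i ^ 2|
      ≤ 976 * μ / (κ * η) * covRate d j j * ∑ i, v i ^ 2 := by
  have hn : 0 < n := by omega
  have hn' : (0 : ℝ) < n := by exact_mod_cast hn
  have hf := spectralDensity_fourierFreq_pos (d := d) hn (by omega) hκ hφ hfj
  have hmem : MemLp (fun ω => ∑ i, v i * scaledDft X n (normFactor d φ (fourierFreq n j))
      (fourierFreq n j) i ω) 2 P := by
    simp_rw [sum_mul_scaledDft]
    exact memLp_finsetSum _ fun p _ => (hX.memLp _).const_mul _
  have h1 := abs_covariance_sum_scaledDft_sub_le h hν hμ hκ hφ hη hη1 hd1 hd2 hX (by omega) le_rfl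
    hj hjn hfj hfj v v
  rw [covariance_self hmem.aestronglyMeasurable.aemeasurable,
    sum_epochWeight_mul_self (by omega) hjn, mul_pow, normFactor_sq hf, inv_pow,
    Real.sq_sqrt (by positivity)] at h1
  have h2 : 2 * Real.pi * spectralDensity d φ (fourierFreq n j)
      * (2 / spectralDensity d φ (fourierFreq n j) * (2 * Real.pi * n)⁻¹ * n / 2 * ∑ i, v i ^ 2)
      = ∑ i, v i ^ 2 := by
    have := Real.pi_pos
    field_simp
  rw [h2] at h1
  refine h1.trans (le_of_eq ?_)
  ring

theorem abs_covariance_sum_scaledDft_le [IsProbabilityMeasure P]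
    (h : MemLipschitzClass μ ν φ) (hν : 0 < ν) (hμ : 0 < μ) (hκ : 0 < κ) (hφ : 0 < φ 0)
    (hη : 0 < η) (hη1 : η ≤ 1) (hd1 : η - 1 ≤ -2 * d) (hd2 : -2 * d ≤ 1 - η)
    (hX : HasSpectralDensity P X (spectralDensity d φ))
    {j k : ℕ} (hj : 2 ≤ j) (hjk : j < k) (hkn : 2 * k < n)
    (hfj : κ * φ 0 ≤ φ (fourierFreq n j)) (hfk : κ * φ 0 ≤ φ (fourierFreq n k))
    (v v' : Fin g ⊕ Fin g → ℝ) :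
    |cov[fun ω => ∑ i, v i * scaledDft X n (normFactor d φ (fourierFreq n j)) (fourierFreq n j) i ω,
        fun ω => ∑ i, v' i * scaledDft X n (normFactor d φ (fourierFreq n k)) (fourierFreq n k) i ω;
        P]|
      ≤ 976 * μ / (κ * η) * covRate d j k * (∑ i, v i ^ 2 + ∑ i, v' i ^ 2) / 2 := by
  have h1 := abs_covariance_sum_scaledDft_sub_le h hν hμ hκ hφ hη hη1 hd1 hd2 hX hj hjk.le
    (by omega) hkn hfj hfk v v'
  rw [sum_epochWeight_mul_of_lt hjk hkn, mul_zero, sub_zero] at h1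
  refine h1.trans (le_of_eq ?_)
  ring

/-- Splitting the logarithm of a product needs a nonzero sum of squares. One coordinate has variance
at least `1 - ε > 0`, so it is almost surely nonzero. -/
lemma xi_ae_eq [IsProbabilityMeasure P] (hg : 1 ≤ g) {j : ℕ}
    (hf : 0 < spectralDensity d φ (fourierFreq n j))
    (hG : HasGaussianLaw (fun ω (i : Fin g ⊕ Fin g) =>
      scaledDft X n (normFactor d φ (fourierFreq n j)) (fourierFreq n j) i ω) P)
    {ε : ℝ} (hε : ε < 1)
    (hV : ∀ v : Fin g ⊕ Fin g → ℝ, |Var[fun ω => ∑ i, v i *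
      scaledDft X n (normFactor d φ (fourierFreq n j)) (fourierFreq n j) i ω; P] - ∑ i, v i ^ 2|
        ≤ ε * ∑ i, v i ^ 2) :
    xi X (spectralDensity d φ) g n j =ᵐ[P] fun ω => Real.log (∑ i : Fin g ⊕ Fin g,
      scaledDft X n (normFactor d φ (fourierFreq n j)) (fourierFreq n j) i ω ^ 2)
        - (digamma g + Real.log 2) := by
  set c := normFactor d φ (fourierFreq n j) with hc
  have hg' : (0 : ℝ) < g := by exact_mod_cast hg
  have hc2 : c ^ 2 = 2 / spectralDensity d φ (fourierFreq n j) := normFactor_sq hf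
  have hc0 : c ≠ 0 := by
    intro h0
    rw [h0] at hc2
    have : 0 < 2 / spectralDensity d φ (fourierFreq n j) := by positivity
    rw [← hc2] at this
    norm_num at this
  let i₀ : Fin g ⊕ Fin g := Sum.inl ⟨0, hg⟩
  have hne : ∀ᵐ ω ∂P, scaledDft X n c (fourierFreq n j) i₀ ω ≠ 0 := by
    have hG0 := hG.eval i₀
    have hv := hV (Pi.single i₀ 1)
    have h1 : ∀ ω, ∑ i, (Pi.single i₀ 1 : Fin g ⊕ Fin g → ℝ) i * scaledDft X n c (fourierFreq n j) i ω
        = scaledDft X n c (fourierFreq n j) i₀ ω := by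
      intro ω; simp [Pi.single_apply]
    have h2 : ∑ i, (Pi.single i₀ 1 : Fin g ⊕ Fin g → ℝ) i ^ 2 = 1 := by
      simp [Pi.single_apply]
    simp_rw [h1] at hv
    rw [h2, mul_one, abs_le] at hv
    have hvar : (Var[scaledDft X n c (fourierFreq n j) i₀; P]).toNNReal ≠ 0 := by
      rw [ne_eq, Real.toNNReal_eq_zero, not_le]
      linarith [hv.1]
    have hmap := hG0.map_eq_gaussianReal
    have := nullSingletonClass_gaussianReal (μ := P[scaledDft X n c (fourierFreq n j) i₀]) hvar
    have h3 : (P.map (scaledDft X n c (fourierFreq n j) i₀)) {0} = 0 := by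
      rw [hmap]; exact measure_singleton 0
    rw [Measure.map_apply_of_aemeasurable hG0.aemeasurable (measurableSet_singleton 0)] at h3
    exact measure_eq_zero_iff_ae_notMem.mp h3
  filter_upwards [hne] with ω hω
  have hS : (∑ i : Fin g ⊕ Fin g, scaledDft X n c (fourierFreq n j) i ω ^ 2) ≠ 0 := by
    refine (lt_of_lt_of_le (by positivity) (Finset.single_le_sum
      (f := fun i => scaledDft X n c (fourierFreq n j) i ω ^ 2)
      (fun i _ => sq_nonneg _) (Finset.mem_univ i₀))).ne'
  unfold xi
  rw [averagedPeriodogram_eq_sum_scaledDft X hc0, hc2, Real.log_mul (by positivity) hS,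
    Real.log_mul (by positivity) (by positivity), Real.log_inv, Real.log_inv,
    Real.log_div two_ne_zero hf.ne']
  ring

end LogPeriodogram

end AvgPeriodogram

/-! ### The main theorem: choice of constants and assembly. -/

theorem mainTheorem3 (δm δp μ κ : ℝ) (hδm : 0 ≤ δm) (hδm' : δm < 1 / 2)
    (hδp : 0 ≤ δp) (hδp' : δp < 1 / 2) (hμ : 1 ≤ μ) (hκ : 0 < κ) :
    ∃ K : ℕ, 1 ≤ K ∧ ∃ C : ℝ, 0 < C ∧
      ∀ (ν : ℝ), 0 < ν → ν ≤ 1 → ∀ (d : ℝ), -δm ≤ d → d ≤ δp →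
      ∀ (fstar : ℝ → ℝ), AvgPeriodogram.IsShortMemoryPart fstar →
        AvgPeriodogram.MemLipschitzClass μ ν fstar →
      ∀ (Ω : Type*) (_ : MeasurableSpace Ω) (P : Measure Ω) (_ : IsProbabilityMeasure P)
        (X : ℤ → Ω → ℝ), IsGaussianProcess X P →
        AvgPeriodogram.HasSpectralDensity P X (AvgPeriodogram.spectralDensity d fstar) →
      ∀ (g n : ℕ), 1 ≤ g →
      ∀ (ξ : ℕ → Ω → ℝ), ξ = AvgPeriodogram.xi X (AvgPeriodogram.spectralDensity d fstar) g n →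
        (∀ j : ℕ, K ≤ j → j ≤ (n - 1) / 2 →
          κ * fstar 0 ≤ fstar (AvgPeriodogram.fourierFreq n j) →
          MemLp (ξ j) 2 P ∧
          |∫ a, ξ j a ∂P| ≤ C * Real.log (1 + j) / j ∧
          |Var[ξ j; P] - deriv AvgPeriodogram.digamma g| ≤ C * Real.log (1 + j) ^ 2 / j ^ 2) ∧
        (∀ j k : ℕ, K ≤ j → j < k → k ≤ (n - 1) / 2 →
          κ * fstar 0 ≤ fstar (AvgPeriodogram.fourierFreq n j) →
          κ * fstar 0 ≤ fstar (AvgPeriodogram.fourierFreq n k) →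
          |cov[ξ j, ξ k; P]| ≤
            C * Real.log k ^ 2 * (j : ℝ) ^ (-2 * |d|) * (k : ℝ) ^ (2 * |d| - 2)) := by
  have hδ0 : 0 ≤ max δm δp := hδm.trans (le_max_left _ _)
  have hδ1 : max δm δp < 1 / 2 := max_lt hδm' hδp'
  -- `η` is the distance from the admissible exponents `-2d` to `±1`, uniformly over the range of
  -- `d`.
  set η := 1 - 2 * max δm δp with hη
  have hη0 : 0 < η := by linarith
  have hη1 : η ≤ 1 := by linarith
  have hμ0 : 0 < μ := by linarith
  set A := 976 * μ / (κ * η) with hA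
  have hA0 : 0 < A := by positivity
  obtain ⟨K, hK⟩ := AvgPeriodogram.exists_forall_log_mul_rpow_le A
  set D := deriv AvgPeriodogram.digamma 1 with hD
  have hC1 : (8 + 4 * D) * A ^ 2 ≤ 2 * A + (10 + 4 * |D|) * A ^ 2 := by
    nlinarith [le_abs_self D, sq_nonneg A]
  have hC2 : (10 + 2 * D) * A ^ 2 ≤ 2 * A + (10 + 4 * |D|) * A ^ 2 := by
    nlinarith [le_abs_self D, abs_nonneg D, sq_nonneg A]
  have hC3 : 2 * A ≤ 2 * A + (10 + 4 * |D|) * A ^ 2 := by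
    have : 0 ≤ (10 + 4 * |D|) * A ^ 2 := by positivity
    linarith
  -- The `3` ensures `log k ≥ 1`. The constant dominates those of the mean, variance and covariance
  -- bounds, with `|D|` making its positivity evident.
  refine ⟨max K 3, by omega, 2 * A + (10 + 4 * |D|) * A ^ 2, by positivity, ?_⟩
  intro ν hν _ d hd1 hd2 φ hφ hL Ω _ P _ X hX hS g n hg ξ hξ
  subst hξ
  have hdm : d ≤ max δm δp := hd2.trans (le_max_right _ _)
  have hdm' : -max δm δp ≤ d := (neg_le_neg (le_max_left _ _)).trans hd1
  have hd : |d| ≤ 1 / 2 := by rw [abs_le]; constructor <;> linarith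
  have hp1 : η - 1 ≤ -2 * d := by linarith
  have hp2 : -2 * d ≤ 1 - η := by linarith
  have hcard : Fintype.card (Fin g ⊕ Fin g) = 2 * g := by
    rw [Fintype.card_sum, Fintype.card_fin]; ring
  have hrate : ∀ j k : ℕ, 1 ≤ j → max K 3 ≤ k → A * AvgPeriodogram.covRate d j k ≤ 1 / 4 :=
    fun j k hj hk => (mul_le_mul_of_nonneg_left
      (AvgPeriodogram.covRate_le hd hj (by omega)) hA0.le).trans (hK k (by omega))
  set c : ℕ → ℝ := fun j => AvgPeriodogram.normFactor d φ (AvgPeriodogram.fourierFreq n j) with hc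
  set U : ℕ → Fin g ⊕ Fin g → Ω → ℝ := fun j =>
    AvgPeriodogram.scaledDft X n (c j) (AvgPeriodogram.fourierFreq n j) with hU
  have hgauss : ∀ j k : ℕ, HasGaussianLaw (fun ω => (fun i => U j i ω, fun i => U k i ω)) P :=
    fun j k => AvgPeriodogram.hasGaussianLaw_scaledDft_prod hX _ _ _ _
  have hvar : ∀ j : ℕ, max K 3 ≤ j → j ≤ (n - 1) / 2 →
      κ * φ 0 ≤ φ (AvgPeriodogram.fourierFreq n j) → ∀ v : Fin g ⊕ Fin g → ℝ,
      |Var[fun ω => ∑ i, v i * U j i ω; P] - ∑ i, v i ^ 2|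
        ≤ A * AvgPeriodogram.covRate d j j * ∑ i, v i ^ 2 := fun j hj hjn hfj v =>
    AvgPeriodogram.abs_variance_sum_scaledDft_sub_le hL hν hμ0 hκ hφ.pos_zero hη0 hη1 hp1 hp2 hS
      (by omega) (by omega) hfj v
  have hvar' : ∀ j : ℕ, max K 3 ≤ j → j ≤ (n - 1) / 2 →
      κ * φ 0 ≤ φ (AvgPeriodogram.fourierFreq n j) → ∀ v : Fin g ⊕ Fin g → ℝ,
      |Var[fun ω => ∑ i, v i * U j i ω; P] - ∑ i, v i ^ 2| ≤ 1 / 4 * ∑ i, v i ^ 2 :=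
    fun j hj hjn hfj v => (hvar j hj hjn hfj v).trans
      (mul_le_mul_of_nonneg_right (hrate j j (by omega) hj) (by positivity))
  have hmean : ∀ j : ℕ, max K 3 ≤ j → j ≤ (n - 1) / 2 → ∀ i, ∫ ω, U j i ω ∂P = 0 :=
    fun j hj hjn i => AvgPeriodogram.integral_scaledDft hS (by omega) (by omega) _ i
  have hxi : ∀ j : ℕ, max K 3 ≤ j → j ≤ (n - 1) / 2 →
      κ * φ 0 ≤ φ (AvgPeriodogram.fourierFreq n j) →
      AvgPeriodogram.xi X (AvgPeriodogram.spectralDensity d φ) g n j =ᵐ[P]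
        fun ω => Real.log (∑ i, U j i ω ^ 2) - (AvgPeriodogram.digamma g + Real.log 2) :=
    fun j hj hjn hfj => AvgPeriodogram.xi_ae_eq hg
      (AvgPeriodogram.spectralDensity_fourierFreq_pos (by omega) (by omega) hκ hφ.pos_zero hfj)
      (hgauss j j).fst (by norm_num : (1 / 4 : ℝ) < 1) (hvar' j hj hjn hfj)
  have hmom := fun (j : ℕ) (hj : max K 3 ≤ j) (hjn : j ≤ (n - 1) / 2)
      (hfj : κ * φ 0 ≤ φ (AvgPeriodogram.fourierFreq n j)) =>
    AvgPeriodogram.log_norm_sq_moments hg hcard (hgauss j j).fst (hmean j hj hjn)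
      (mul_nonneg hA0.le (AvgPeriodogram.covRate_pos (d := d) (by omega) (by omega)).le)
      ((hrate j j (by omega) hj).trans (by norm_num)) (hvar j hj hjn hfj)
  refine ⟨fun j hj hjn hfj => ?_, fun j k hj hjk hkn hfj hfk => ?_⟩
  · obtain ⟨h1, h2, h3⟩ := hmom j hj hjn hfj
    have hae := hxi j hj hjn hfj
    have hj0 : (0 : ℝ) < j := by exact_mod_cast (by omega : 0 < j)
    have hlog0 : 0 ≤ Real.log j := Real.log_natCast_nonneg j
    have hlog : Real.log j ≤ Real.log (1 + j) := Real.log_le_log hj0 (by linarith)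
    rw [AvgPeriodogram.covRate_self (by omega)] at h2 h3
    refine ⟨(h1.sub (memLp_const _)).ae_eq hae.symm, ?_, ?_⟩
    · rw [integral_congr_ae hae, integral_sub (h1.integrable (by norm_num)) (integrable_const _),
        integral_const, probReal_univ, one_smul]
      calc _ ≤ 2 * (A * (Real.log j / j)) := h2
        _ = 2 * A * Real.log j / j := by ring
        _ ≤ _ := by gcongr
    · rw [variance_congr hae, variance_sub_const h1.aestronglyMeasurable]
      calc _ ≤ (8 + 4 * D) * (A * (Real.log j / j)) ^ 2 := h3
        _ = (8 + 4 * D) * A ^ 2 * Real.log j ^ 2 / j ^ 2 := by ring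
        _ ≤ _ := by gcongr
  · have hjn : j ≤ (n - 1) / 2 := by omega
    have hk : max K 3 ≤ k := by omega
    have hr := hrate j k (by omega) hk
    have hr0 : 0 < A * AvgPeriodogram.covRate d j k :=
      mul_pos hA0 (AvgPeriodogram.covRate_pos (by omega) (by omega))
    have h1 := (hmom j hj hjn hfj).1.integrable (by norm_num)
    have h2 := (hmom k hk hkn hfk).1.integrable (by norm_num)
    -- Taking `ε = 1/4` and `ρ = A * covRate d j k ≤ 1/4` gives `ε + 2ρ² ≤ 3/8`. A fixed `ε`
    -- suffices, because the covariance bound depends on `ρ` alone.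
    have hmain := AvgPeriodogram.abs_covariance_log_norm_sq_le hg hcard (hgauss j k)
      (hmean j hj hjn) (hmean k hk hkn) (by norm_num : (0 : ℝ) ≤ 1 / 4) hr0 (by nlinarith)
      (hvar' j hj hjn hfj) (hvar' k hk hkn hfk) fun v w =>
        AvgPeriodogram.abs_covariance_sum_scaledDft_le hL hν hμ0 hκ hφ.pos_zero hη0 hη1 hp1 hp2 hS
          (by omega) hjk (by omega) hfj hfk v w
    rw [AvgPeriodogram.covariance_congr_ae (hxi j hj hjn hfj) (hxi k hk hkn hfk),
      covariance_sub_const_left h1, covariance_sub_const_right h2]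
    calc _ ≤ (10 + 2 * D) * (A * AvgPeriodogram.covRate d j k) ^ 2 := hmain
      _ = (10 + 2 * D) * A ^ 2 * (Real.log k ^ 2 * (j : ℝ) ^ (-2 * |d|)
          * (k : ℝ) ^ (2 * |d| - 2)) := by
        rw [mul_pow, AvgPeriodogram.covRate_sq (by omega) (by omega)]; ring
      _ ≤ (2 * A + (10 + 4 * |D|) * A ^ 2) * (Real.log k ^ 2 * (j : ℝ) ^ (-2 * |d|)
          * (k : ℝ) ^ (2 * |d| - 2)) := by gcongr
      _ = _ := by ring
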